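/- Let $0<p<1$, $q=1-p$, and let $\xi_1,\xi_2,\dots$ be independent random variables with $P(\xi_i=1)=p$ and $P(\xi_i=0)=q$. For $n\ge 1$ let $U^{(n)}$ be the length of the longest arithmetic progression contained in the random set $\Sigma_n=\{1\le i\le n:\xi_i=1\}$; that is, $U^{(n)}$ is the largest $m\ge 1$ for which there are integers $a,s\ge 1$ with $s\le n$, $a+(m-1)s\le n$ and $\xi_a=\xi_{a+s}=\dots=\xi_{a+(m-1)s}=1$ (and $U^{(n)}=0$ if $\Sigma_n=\emptyset$). Put $C=-2/\ln p$, $D=1/\ln p$, $h_n=C\ln n+D\ln\ln n$ and, for $1<r\le n$, $$\lambda_{n,r}=\frac{n^2p^r(p+qr)}{2r(r-1)}.$$ (1) There is a constant $K$ depending only on $p$ such that for all $n\ge 3$ $$\max_{1<r\le n}\bigl|P(U^{(n)}<r)-e^{-\lambda_{n,r}}\bigr|\le K\,\frac{\ln^4 n\,\ln\ln n}{n}.$$ (2) For every real $a<1$ there is a constant $K$ depending only on $p$ and $a$ such that for all $n\ge 3$ and all real $x\ge aD\ln\ln n$ with $h_n+x\in\mathbb Z$ $$\Bigl|\exp\Bigl(\frac{-q\ln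 p}{4}\,p^x\Bigr)P(U^{(n)}<h_n+x)-1\Bigr|\le K\,\frac{\ln\ln n}{\ln^{1-a}n}.$$ (3) As $n\to\infty$, $\dfrac{U^{(n)}-C\ln n}{\ln\ln n}\to D$ in probability. (4) Almost surely, $$D=\liminf_{n\to\infty}\frac{U^{(n)}-C\ln n}{\ln\ln n}<\limsup_{n\to\infty}\frac{U^{(n)}-C\ln n}{\ln\ln n}=0,$$ $$\lim_{n\to\infty}\frac1{n\ln n}\Bigl(\sum_{k=1}^nU^{(2^k)}+\frac{\ln 2}{\ln p}\,n^2\Bigr)=D,\qquad \lim_{n\to\infty}\frac1{\ln n\,\ln\ln n}\Bigl(\sum_{k=1}^n\frac{U^{(k)}}{k}+D\ln^2n\Bigr)=D.$$ -/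

import Mathlib

open MeasureTheory ProbabilityTheory Filter Topology

universe u

noncomputable section

namespace LongestAP

/-- `ξ 1, ξ 2, …` is a Bernoulli sequence with success probability `p` on the probability space
`(Ω, μ)`: the variables are independent and each takes the value `1` with probability `p` and the
value `0` with probability `1 - p`. Only the indices `i ≥ 1` matter. -/
structure IsBernoulliSequence {Ω : Type*} [MeasurableSpace Ω] (μ : Measure Ω) (p : ℝ)
    (ξ : ℕ → Ω → ℝ) : Prop where
  measurable : ∀ i, 1 ≤ i → Measurable (ξ i)
  indep : iIndepFun (fun i : {i : ℕ // 1 ≤ i} => ξ i) μ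
  prob_one : ∀ i, 1 ≤ i → μ.real {ω | ξ i ω = 1} = p
  prob_zero : ∀ i, 1 ≤ i → μ.real {ω | ξ i ω = 0} = 1 - p

/-- The maximal length `m` of an arithmetic progression `a, a + s, …, a + (m - 1) s` in
`{1, …, n}` on which the sequence `x` equals `1`; it is `0` if `x a ≠ 1`
(`sSup ∅ = 0` in `ℕ`). Meant for `1 ≤ a ≤ n` and `1 ≤ s`. -/
def apLength (x : ℕ → ℝ) (n a s : ℕ) : ℕ :=
  sSup {m : ℕ | 1 ≤ m ∧ m ≤ 1 + (n - a) / s ∧ ∀ j < m, x (a + j * s) = 1}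

/-- The length of the longest arithmetic progression in `{1 ≤ i ≤ n : x i = 1}`. -/
def longestAP (x : ℕ → ℝ) (n : ℕ) : ℕ :=
  (Finset.Icc 1 n ×ˢ Finset.Icc 1 n).sup fun as => apLength x n as.1 as.2

/-- The random variable `U^{(n)}`. -/
def U {Ω : Type*} (ξ : ℕ → Ω → ℝ) (n : ℕ) (ω : Ω) : ℕ :=
  longestAP (fun i => ξ i ω) n

/-- The constant `C = -2 / ln p`. -/
def C (p : ℝ) : ℝ := -2 / Real.log p

/-- The constant `D = 1 / ln p`. -/
def D (p : ℝ) : ℝ := 1 / Real.log p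

/-- `λ_{n,r} = n² pʳ (p + q r) / (2 r (r - 1))` with `q = 1 - p`. -/
def lam (p : ℝ) (n r : ℕ) : ℝ :=
  (n : ℝ) ^ 2 * p ^ r * (p + (1 - p) * r) / (2 * r * ((r : ℝ) - 1))

/-- `h_n = C ln n + D ln ln n`. -/
def h (p : ℝ) (n : ℕ) : ℝ := C p * Real.log n + D p * Real.log (Real.log n)

/-- The normalized length `(U^{(n)} - C ln n) / ln ln n`. -/
def normU {Ω : Type*} (p : ℝ) (ξ : ℕ → Ω → ℝ) (n : ℕ) (ω : Ω) : ℝ :=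
  ((U ξ n ω : ℝ) - C p * Real.log n) / Real.log (Real.log n)

end LongestAP

end

/-! A run of successes along a progression contains many shorter runs, so the events "this
progression consists of successes" come in clumps. The remedy is to count only fresh progressions
(`freshEvent`), those whose predecessor is out of range or a failure. By `longestAP_lt_iff` the
length stays below d + 1 exactly when no fresh progression with d + 1 points occurs, and the
expected number of these is `lam p n (d + 1)` up to an error of order n p^(d+1).

Two distinct fresh progressions with the same step and a common point exclude each other. With
different steps, two progressions share at most about half of their points, and at most about a
third unless one step is twice the other. So the fresh events are locally dependent with small joint
probabilities, and the Chen-Stein method (`abs_measureReal_eventCount_eq_zero_sub_exp_le`) gives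
exp(-λ) with an error of order log^4 n / n around the critical length. For very long progressions a
union bound suffices, for short ones monotonicity in the length. The outcome is
`exists_poisson_bound`, on which all four assertions rest.

For (2), h_n is chosen so that n² p^(h_n) = log n; hence λ at level h_n + x is close to (q |log p| /
4) p^x. Since a < 1, the factor exp((q |log p| / 4) p^x) is smaller than every power of n and the
error of (1) absorbs it.

For (3) and (4) take n = 2^k and the level C log n + y log k, where λ has order k^(y log p - 1). For
y < D the exponent is positive and staying below the level has summable probability. For y > D the
exponent is negative, so the exceedance probabilities divided by k are summable and exceedances have
density zero. For y > 0 the exceedances themselves are summable. For y < 0 their probability is at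
least of order 1/k, also for the independent blocks (2^k, 2^(k+1)], and the second Borel-Cantelli
lemma applies. `DyadicRegular` collects these facts; the almost sure limits follow deterministically
because the length is monotone in n. -/

namespace LongestAP

/-! ### Stein's equation for the Poisson law -/

/-- The solution of the Stein equation of the Poisson law with parameter `l` for the set `{0}`. -/
noncomputable def steinFun (l : ℝ) (w : ℕ) : ℝ :=
  ∫ t in (0 : ℝ)..1, t ^ (w - 1) * Real.exp (-l * t)

theorem steinFun_integrable (l : ℝ) (w : ℕ) :
    IntervalIntegrable (fun t : ℝ => t ^ w * Real.exp (-l * t)) volume 0 1 :=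
  Continuous.intervalIntegrable (by fun_prop) _ _

/-- Integrate the derivative of t^w e^(-lt) over [0, 1]; the boundary term 0^w is the indicator of w
= 0. The truncated exponent `w - 1` at w = 0 is harmless, since the factor w removes that value. -/
theorem steinFun_equation (l : ℝ) (w : ℕ) :
    l * steinFun l (w + 1) = w * steinFun l w + (if w = 0 then 1 else 0) - Real.exp (-l) := by
  have hd : ∀ t : ℝ, HasDerivAt (fun t : ℝ => t ^ w * Real.exp (-l * t))
      (w * (t ^ (w - 1) * Real.exp (-l * t)) - l * (t ^ w * Real.exp (-l * t))) t := by
    intro t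
    have h1 : HasDerivAt (fun t : ℝ => -l * t) (-l) t := by
      simpa using (hasDerivAt_id t).const_mul (-l)
    have := (hasDerivAt_pow w t).mul h1.exp
    exact this.congr_deriv (by ring)
  have h := intervalIntegral.integral_eq_sub_of_hasDerivAt (a := 0) (b := 1) (fun t _ => hd t)
    (Continuous.intervalIntegrable (by fun_prop) _ _)
  rw [intervalIntegral.integral_sub ((steinFun_integrable l (w - 1)).const_mul _)
    ((steinFun_integrable l w).const_mul _), intervalIntegral.integral_const_mul,
    intervalIntegral.integral_const_mul] at h
  simp only [steinFun, Nat.add_sub_cancel]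
  rcases Nat.eq_zero_or_pos w with rfl | hw
  · simp at h ⊢
    linarith
  · have hw0 : w ≠ 0 := hw.ne'
    simp only [one_pow, mul_one, one_mul, mul_zero, Real.exp_zero, ne_eq, hw0, not_false_eq_true,
      zero_pow, sub_zero, if_false, add_zero] at h ⊢
    linarith

/-- The integrand lies in [0, 1] and decreases in w. The crude increment bound 1, without the usual
factor of order 1/l, is precise enough for the rate needed here. -/
theorem steinFun_antitone_step {l : ℝ} (hl : 0 ≤ l) (w : ℕ) :
    steinFun l (w + 1) ≤ steinFun l w ∧ steinFun l w - steinFun l (w + 1) ≤ 1 := by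
  have hle : ∀ (m : ℕ) (t : ℝ), t ∈ Set.Icc (0 : ℝ) 1 → t ^ m * Real.exp (-l * t) ≤ 1 := by
    intro m t ht
    have h1 : t ^ m ≤ 1 := pow_le_one₀ ht.1 ht.2
    have h2 : Real.exp (-l * t) ≤ 1 := Real.exp_le_one_iff.2 (by nlinarith [ht.1])
    exact mul_le_one₀ h1 (Real.exp_pos _).le h2
  constructor
  · refine intervalIntegral.integral_mono_on zero_le_one (steinFun_integrable l _)
      (steinFun_integrable l _) fun t ht => ?_
    exact mul_le_mul_of_nonneg_right (pow_le_pow_of_le_one ht.1 ht.2 (by omega))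
      (Real.exp_pos _).le
  · have h1 : steinFun l w ≤ 1 := by
      have := intervalIntegral.integral_mono_on (a := (0 : ℝ)) (b := 1) zero_le_one
        (steinFun_integrable l (w - 1)) (intervalIntegrable_const (c := (1 : ℝ)))
        fun t ht => hle (w - 1) t ht
      simpa [steinFun] using this
    have h2 : 0 ≤ steinFun l (w + 1) :=
      intervalIntegral.integral_nonneg zero_le_one fun t ht =>
        mul_nonneg (pow_nonneg ht.1 _) (Real.exp_pos _).le
    linarith

theorem steinFun_sub_le {l : ℝ} (hl : 0 ≤ l) (w k : ℕ) :
    0 ≤ steinFun l w - steinFun l (w + k) ∧ steinFun l w - steinFun l (w + k) ≤ k := by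
  induction k with
  | zero => simp
  | succ k ih =>
    have := steinFun_antitone_step hl (w + k)
    rw [← add_assoc]
    push_cast
    constructor <;> linarith [ih.1, ih.2, this.1, this.2]

/-! ### Poisson approximation for locally dependent events -/

open Classical in
/-- The number of events `E i`, `i ∈ I`, that contain `ω`. -/
noncomputable def eventCount {Ω ι : Type*} (E : ι → Set Ω) (I : Finset ι) (ω : Ω) : ℕ :=
  (I.filter fun i => ω ∈ E i).card

section

variable {Ω ι κ : Type*}

theorem eventCount_eq_sum (E : ι → Set Ω) (I : Finset ι) (ω : Ω) :
    (eventCount E I ω : ℝ) = ∑ i ∈ I, (E i).indicator (fun _ => (1 : ℝ)) ω := by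
  classical
  simp [eventCount, Set.indicator_apply]

theorem eventCount_union [DecidableEq ι] (E : ι → Set Ω) {I J : Finset ι} (h : Disjoint I J)
    (ω : Ω) : eventCount E (I ∪ J) ω = eventCount E I ω + eventCount E J ω := by
  classical
  have : ((eventCount E (I ∪ J) ω : ℕ) : ℝ) = (eventCount E I ω + eventCount E J ω : ℕ) := by
    push_cast
    simp only [eventCount_eq_sum, Finset.sum_union h]
  exact_mod_cast this

theorem eventCount_singleton (E : ι → Set Ω) (i : ι) {ω : Ω} (h : ω ∈ E i) :
    eventCount E {i} ω = 1 := by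
  have : (eventCount E {i} ω : ℝ) = 1 := by simp [eventCount_eq_sum, h]
  exact_mod_cast this

theorem eventCount_le (E : ι → Set Ω) (I : Finset ι) (ω : Ω) : eventCount E I ω ≤ I.card :=
  by
  classical
  exact Finset.card_filter_le _ _

theorem eventCount_eq_zero (E : ι → Set Ω) (I : Finset ι) (ω : Ω) :
    eventCount E I ω = 0 ↔ ∀ i ∈ I, ω ∉ E i := by
  classical
  simp [eventCount, Finset.filter_eq_empty_iff]

theorem measurable_eventCount {m : MeasurableSpace Ω} {E : ι → Set Ω} {I : Finset ι}
    (hE : ∀ i ∈ I, MeasurableSet[m] (E i)) : Measurable[m] (eventCount E I) := by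
  classical
  have : eventCount E I = fun ω => ∑ i ∈ I, (E i).indicator (fun _ => 1) ω := by
    ext ω
    simp [eventCount, Set.indicator_apply]
  rw [this]
  exact Finset.measurable_sum _ fun i hi => measurable_const.indicator (hE i hi)

theorem integrable_comp_eventCount [MeasurableSpace Ω] {μ : Measure Ω} [IsFiniteMeasure μ]
    {E : ι → Set Ω} {I : Finset ι} (hE : ∀ i ∈ I, MeasurableSet (E i)) (g : ℕ → ℝ) :
    Integrable (fun ω => g (eventCount E I ω)) μ := by
  refine Integrable.of_bound (C := ∑ k ∈ Finset.range (I.card + 1), |g k|)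
    ((Measurable.of_discrete (f := g)).comp (measurable_eventCount hE)).aestronglyMeasurable
    (ae_of_all _ fun ω => ?_)
  exact Finset.single_le_sum (f := fun k => |g k|) (fun _ _ => abs_nonneg _)
    (Finset.mem_range.2 (Nat.lt_succ_of_le (eventCount_le E I ω)))

theorem integral_eventCount [MeasurableSpace Ω] {μ : Measure Ω} [IsFiniteMeasure μ]
    {E : ι → Set Ω} {I : Finset ι} (hE : ∀ i ∈ I, MeasurableSet (E i)) :
    ∫ ω, (eventCount E I ω : ℝ) ∂μ = ∑ i ∈ I, μ.real (E i) := by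
  simp only [eventCount_eq_sum]
  rw [integral_finsetSum _ fun i hi => (integrable_const _).indicator (hE i hi)]
  refine Finset.sum_congr rfl fun i hi => ?_
  rw [integral_indicator_const _ (hE i hi)]
  simp

open Classical in
/-- The contribution of a single event to the error of the Poisson approximation. -/
theorem abs_integral_indicator_mul_sub_le [MeasurableSpace Ω] {μ : Measure Ω}
    [IsProbabilityMeasure μ] {m : κ → MeasurableSpace Ω} (hm : ∀ k, m k ≤ ‹MeasurableSpace Ω›)
    (hind : iIndep m μ) {E : ι → Set Ω} {A : ι → Set κ} {I : Finset ι}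
    (hE : ∀ i ∈ I, MeasurableSet[⨆ k ∈ A i, m k] (E i)) {l : ℝ} (hl : 0 ≤ l)
    {i : ι} (hi : i ∈ I) (hne : (A i).Nonempty) :
    |∫ ω, (E i).indicator (fun _ => (1 : ℝ)) ω * steinFun l (eventCount E I ω) ∂μ -
        μ.real (E i) * ∫ ω, steinFun l (eventCount E I ω + 1) ∂μ| ≤
      (∑ j ∈ I.filter fun j => ¬ Disjoint (A i) (A j), μ.real (E i) * μ.real (E j)) +
      ∑ j ∈ I.filter fun j => ¬ Disjoint (A i) (A j) ∧ j ≠ i, μ.real (E i ∩ E j) := by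
  have hEm : ∀ j ∈ I, MeasurableSet (E j) := fun j hj =>
    (iSup₂_le fun k _ => hm k : (⨆ k ∈ A j, m k) ≤ _) _ (hE j hj)
  set F := I.filter fun j => Disjoint (A i) (A j) with hF
  set G := I.filter fun j => ¬ Disjoint (A i) (A j) with hG
  set H := I.filter fun j => ¬ Disjoint (A i) (A j) ∧ j ≠ i with hH
  have hFm : ∀ j ∈ F, MeasurableSet (E j) := fun j hj => hEm j (Finset.mem_filter.1 hj).1
  have hGm : ∀ j ∈ G, MeasurableSet (E j) := fun j hj => hEm j (Finset.mem_filter.1 hj).1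
  have hHm : ∀ j ∈ H, MeasurableSet (E j) := fun j hj => hEm j (Finset.mem_filter.1 hj).1
  have hself : ¬ Disjoint (A i) (A i) := by
    rw [disjoint_self]; exact hne.ne_empty
  have hGH : G = {i} ∪ H := by
    ext j
    simp only [hG, hH, Finset.mem_filter, Finset.mem_union, Finset.mem_singleton]
    constructor
    · rintro ⟨h1, h2⟩
      by_cases h : j = i
      · exact Or.inl h
      · exact Or.inr ⟨h1, h2, h⟩
    · rintro (rfl | ⟨h1, h2, -⟩)
      · exact ⟨hi, hself⟩
      · exact ⟨h1, h2⟩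
  have hFG : I = F ∪ G := (Finset.filter_union_filter_not_eq _ _).symm
  have hFGd : Disjoint F G := Finset.disjoint_filter_filter_not _ _ _
  have hcount : ∀ ω, eventCount E I ω = eventCount E F ω + eventCount E G ω := fun ω => by
    conv_lhs => rw [hFG]
    exact eventCount_union E hFGd ω
  -- F collects the events independent of `E i`, G its neighbours, H the neighbours other than i
  -- itself. On `E i` the event i contributes exactly 1.
  have hcount' : ∀ ω ∈ E i, eventCount E I ω = eventCount E F ω + 1 + eventCount E H ω := by
    intro ω hω
    rw [hcount, hGH, eventCount_union E (by simp [hH]), eventCount_singleton E i hω]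
    ring
  have hindep : ∫ ω, (E i).indicator (fun _ => (1 : ℝ)) ω * steinFun l (eventCount E F ω + 1) ∂μ =
      μ.real (E i) * ∫ ω, steinFun l (eventCount E F ω + 1) ∂μ := by
    have hI := indep_iSup_of_disjoint hm hind (S := A i) (T := (A i)ᶜ) disjoint_compl_right
    have hV : Measurable[⨆ k ∈ (A i)ᶜ, m k] (eventCount E F) := by
      refine measurable_eventCount fun j hj => ?_
      have hj' := Finset.mem_filter.1 hj
      have : (⨆ k ∈ A j, m k) ≤ ⨆ k ∈ (A i)ᶜ, m k :=
        biSup_mono fun k hk hk' => Set.disjoint_left.1 hj'.2 hk' hk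
      exact this _ (hE j hj'.1)
    have hX : Measurable[⨆ k ∈ A i, m k] ((E i).indicator (fun _ => (1 : ℝ))) :=
      measurable_const.indicator (hE i hi)
    have hXY : IndepFun ((E i).indicator (fun _ => (1 : ℝ)))
        (fun ω => steinFun l (eventCount E F ω + 1)) μ := by
      rw [IndepFun_iff_Indep]
      refine indep_of_indep_of_le_left (indep_of_indep_of_le_right hI ?_) hX.comap_le
      exact Measurable.comap_le
        ((Measurable.of_discrete (f := fun w : ℕ => steinFun l (w + 1))).comp hV)
    have := hXY.integral_mul_eq_mul_integral
      (measurable_const.indicator (hEm i hi)).aestronglyMeasurable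
      (integrable_comp_eventCount hFm fun w => steinFun l (w + 1)).aestronglyMeasurable
    simp only [Pi.mul_apply] at this
    rw [this, integral_indicator_const _ (hEm i hi)]
    simp
  have hint1 : ∀ J : Finset ι, (∀ j ∈ J, MeasurableSet (E j)) → ∀ g : ℕ → ℝ,
      Integrable (fun ω => (E i).indicator (fun _ => (1 : ℝ)) ω * g (eventCount E J ω)) μ := by
    intro J hJ g
    have : (fun ω => (E i).indicator (fun _ => (1 : ℝ)) ω * g (eventCount E J ω)) =
        (E i).indicator fun ω => g (eventCount E J ω) := by
      ext ω
      by_cases h : ω ∈ E i <;> simp [h]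
    rw [this]
    exact (integrable_comp_eventCount hJ g).indicator (hEm i hi)
  -- Dropping H from the argument costs at most its count on `E i`, which integrates to the joint
  -- probabilities.
  have b2 : |∫ ω, (E i).indicator (fun _ => (1 : ℝ)) ω * steinFun l (eventCount E I ω) ∂μ -
      ∫ ω, (E i).indicator (fun _ => (1 : ℝ)) ω * steinFun l (eventCount E F ω + 1) ∂μ| ≤
      ∑ j ∈ H, μ.real (E i ∩ E j) := by
    rw [← integral_sub (hint1 I hEm _) (hint1 F hFm fun w => steinFun l (w + 1))]
    have hsum : ∑ j ∈ H, μ.real (E i ∩ E j) =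
        ∫ ω, (E i).indicator (fun _ => (1 : ℝ)) ω * (eventCount E H ω : ℝ) ∂μ := by
      have : ∀ ω, (E i).indicator (fun _ => (1 : ℝ)) ω * (eventCount E H ω : ℝ) =
          ∑ j ∈ H, (E i ∩ E j).indicator (fun _ => (1 : ℝ)) ω := by
        intro ω
        rw [eventCount_eq_sum, Finset.mul_sum]
        refine Finset.sum_congr rfl fun j _ => ?_
        by_cases h1 : ω ∈ E i <;> by_cases h2 : ω ∈ E j <;> simp [h1, h2]
      simp only [this]
      rw [integral_finsetSum _ fun j hj =>
        (integrable_const _).indicator ((hEm i hi).inter (hHm j hj))]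
      refine Finset.sum_congr rfl fun j hj => ?_
      rw [integral_indicator_const _ ((hEm i hi).inter (hHm j hj))]
      simp
    rw [hsum]
    refine (abs_integral_le_integral_abs).trans
      (integral_mono ((hint1 I hEm _).sub (hint1 F hFm fun w => steinFun l (w + 1))).abs
        (hint1 H hHm fun w => (w : ℝ)) fun ω => ?_)
    by_cases h : ω ∈ E i
    · simp only [Set.indicator_of_mem h, one_mul, hcount' ω h]
      have := steinFun_sub_le hl (eventCount E F ω + 1) (eventCount E H ω)
      rw [abs_sub_comm, abs_of_nonneg this.1]
      exact this.2
    · simp [h]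
  -- After factorization, putting G back costs at most its expected count; this yields the products
  -- of probabilities.
  have b1 : |∫ ω, steinFun l (eventCount E F ω + 1) ∂μ -
      ∫ ω, steinFun l (eventCount E I ω + 1) ∂μ| ≤ ∑ j ∈ G, μ.real (E j) := by
    have i1 := integrable_comp_eventCount (μ := μ) hFm fun w => steinFun l (w + 1)
    have i2 := integrable_comp_eventCount (μ := μ) hEm fun w => steinFun l (w + 1)
    rw [← integral_sub i1 i2, ← integral_eventCount hGm]
    refine (abs_integral_le_integral_abs).trans
      (integral_mono (i1.sub i2).abs (integrable_comp_eventCount hGm fun w => (w : ℝ))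
        fun ω => ?_)
    have := steinFun_sub_le hl (eventCount E F ω + 1) (eventCount E G ω)
    simp only [hcount ω]
    rw [add_right_comm, abs_of_nonneg this.1]
    exact this.2
  rw [hindep] at b2
  calc _ ≤ |∫ ω, (E i).indicator (fun _ => (1 : ℝ)) ω * steinFun l (eventCount E I ω) ∂μ -
        μ.real (E i) * ∫ ω, steinFun l (eventCount E F ω + 1) ∂μ| +
        |μ.real (E i) * ∫ ω, steinFun l (eventCount E F ω + 1) ∂μ -
        μ.real (E i) * ∫ ω, steinFun l (eventCount E I ω + 1) ∂μ| := abs_sub_le _ _ _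
    _ ≤ (∑ j ∈ H, μ.real (E i ∩ E j)) + μ.real (E i) * ∑ j ∈ G, μ.real (E j) := by
      refine add_le_add b2 ?_
      rw [← mul_sub, abs_mul, abs_of_nonneg measureReal_nonneg]
      exact mul_le_mul_of_nonneg_left b1 measureReal_nonneg
    _ = _ := by rw [Finset.mul_sum, add_comm]

open Classical in
/-- Poisson approximation of the probability that none of finitely many locally dependent events
occurs. -/
theorem abs_measureReal_eventCount_eq_zero_sub_exp_le [MeasurableSpace Ω] {μ : Measure Ω}
    [IsProbabilityMeasure μ] {m : κ → MeasurableSpace Ω} (hm : ∀ k, m k ≤ ‹MeasurableSpace Ω›)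
    (hind : iIndep m μ) {E : ι → Set Ω} {A : ι → Set κ} {I : Finset ι}
    (hE : ∀ i ∈ I, MeasurableSet[⨆ k ∈ A i, m k] (E i)) (hne : ∀ i ∈ I, (A i).Nonempty) :
    |μ.real {ω | ∀ i ∈ I, ω ∉ E i} - Real.exp (-∑ i ∈ I, μ.real (E i))| ≤
      ∑ i ∈ I, ((∑ j ∈ I.filter fun j => ¬ Disjoint (A i) (A j), μ.real (E i) * μ.real (E j)) +
      ∑ j ∈ I.filter fun j => ¬ Disjoint (A i) (A j) ∧ j ≠ i, μ.real (E i ∩ E j)) := by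
  have hEm : ∀ j ∈ I, MeasurableSet (E j) := fun j hj =>
    (iSup₂_le fun k _ => hm k : (⨆ k ∈ A j, m k) ≤ _) _ (hE j hj)
  set l := ∑ i ∈ I, μ.real (E i) with hldef
  have hl : 0 ≤ l := Finset.sum_nonneg fun i _ => measureReal_nonneg
  have hset : {ω | ∀ i ∈ I, ω ∉ E i} = {ω | eventCount E I ω = 0} := by
    ext ω
    simp [eventCount_eq_zero]
  have hmeas : MeasurableSet {ω | eventCount E I ω = 0} :=
    measurable_eventCount hEm (measurableSet_singleton 0)
  have hX : ∀ i ∈ I, Integrable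
      (fun ω => (E i).indicator (fun _ => (1 : ℝ)) ω * steinFun l (eventCount E I ω)) μ := by
    intro i hi
    have : (fun ω => (E i).indicator (fun _ => (1 : ℝ)) ω * steinFun l (eventCount E I ω)) =
        (E i).indicator fun ω => steinFun l (eventCount E I ω) := by
      ext ω
      by_cases h : ω ∈ E i <;> simp [h]
    rw [this]
    exact (integrable_comp_eventCount hEm _).indicator (hEm i hi)
  -- Stein's equation evaluated at the count and integrated, with w and l expanded as sums over the
  -- events.
  have key : μ.real {ω | eventCount E I ω = 0} - Real.exp (-l) =
      -∑ i ∈ I, (∫ ω, (E i).indicator (fun _ => (1 : ℝ)) ω * steinFun l (eventCount E I ω) ∂μ -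
        μ.real (E i) * ∫ ω, steinFun l (eventCount E I ω + 1) ∂μ) := by
    rw [Finset.sum_sub_distrib, ← Finset.sum_mul, ← integral_finsetSum _ hX, ← hldef,
      ← integral_const_mul]
    have e1 : μ.real {ω | eventCount E I ω = 0} =
        ∫ ω, (if eventCount E I ω = 0 then (1 : ℝ) else 0) ∂μ := by
      have : (fun ω => if eventCount E I ω = 0 then (1 : ℝ) else 0) =
          {ω | eventCount E I ω = 0}.indicator fun _ => (1 : ℝ) := by
        ext ω
        simp [Set.indicator_apply]
      rw [this, integral_indicator_const _ hmeas]
      simp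
    have e2 : Real.exp (-l) = ∫ _, Real.exp (-l) ∂μ := by simp
    rw [e1, e2, ← integral_sub (integrable_comp_eventCount hEm fun w => if w = 0 then (1 : ℝ) else 0)
      (integrable_const _), ← integral_sub (integrable_finsetSum _ hX)
      ((integrable_comp_eventCount hEm fun w => steinFun l (w + 1)).const_mul _), ← integral_neg]
    congr 1
    ext ω
    rw [← Finset.sum_mul, ← eventCount_eq_sum, steinFun_equation]
    ring
  rw [hset, key, abs_neg]
  exact (Finset.abs_sum_le_sum_abs _ _).trans (Finset.sum_le_sum fun i hi =>
    abs_integral_indicator_mul_sub_le hm hind hE hl hi (hne i hi))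

end

/-! ### Reduction to progressions that cannot be continued to the left -/

theorem mem_apLength_set_bddAbove (x : ℕ → ℝ) (n a s : ℕ) :
    BddAbove {m : ℕ | 1 ≤ m ∧ m ≤ 1 + (n - a) / s ∧ ∀ j < m, x (a + j * s) = 1} :=
  ⟨1 + (n - a) / s, fun _ hm => hm.2.1⟩

theorem succ_le_longestAP_iff (x : ℕ → ℝ) (n : ℕ) {d : ℕ} (hd : 1 ≤ d) :
    d + 1 ≤ longestAP x n ↔
      ∃ a s, 1 ≤ a ∧ 1 ≤ s ∧ a + d * s ≤ n ∧ ∀ j < d + 1, x (a + j * s) = 1 := by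
  unfold longestAP
  rw [Finset.le_sup_iff (by simp : (⊥ : ℕ) < d + 1)]
  constructor
  · rintro ⟨⟨a, s⟩, has, hle⟩
    simp only [Finset.mem_product, Finset.mem_Icc] at has hle
    have hne : {m : ℕ | 1 ≤ m ∧ m ≤ 1 + (n - a) / s ∧ ∀ j < m, x (a + j * s) = 1}.Nonempty := by
      by_contra h
      rw [Set.not_nonempty_iff_eq_empty] at h
      simp [apLength, h] at hle
    have hmem := Nat.sSup_mem hne (mem_apLength_set_bddAbove x n a s)
    refine ⟨a, s, has.1.1, has.2.1, ?_, fun j hj => hmem.2.2 j (lt_of_lt_of_le hj hle)⟩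
    have h1 : d ≤ (n - a) / s := by
      have := hle.trans hmem.2.1
      omega
    have := (Nat.le_div_iff_mul_le (by omega)).1 h1
    omega
  · rintro ⟨a, s, ha, hs, hle, h⟩
    -- This is where d ≥ 1 matters: it forces the step into the range 1, …, n over which `longestAP`
    -- takes its supremum.
    have : s ≤ d * s := Nat.le_mul_of_pos_left s hd
    refine ⟨(a, s), by simp only [Finset.mem_product, Finset.mem_Icc]; omega,
      le_csSup (mem_apLength_set_bddAbove x n a s) ⟨by omega, ?_, h⟩⟩
    have : d ≤ (n - a) / s := (Nat.le_div_iff_mul_le (by omega)).2 (by omega)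
    show d + 1 ≤ 1 + (n - a) / s
    omega

/-- The pairs `(a, s)` for which the progression `a, a + s, …, a + d s` lies in `{1, …, n}`. -/
def progressions (n d : ℕ) : Finset (ℕ × ℕ) :=
  (Finset.Icc 1 n ×ˢ Finset.Icc 1 n).filter fun c => c.1 + d * c.2 ≤ n

theorem mem_progressions {n d : ℕ} (hd : 1 ≤ d) {c : ℕ × ℕ} :
    c ∈ progressions n d ↔ 1 ≤ c.1 ∧ 1 ≤ c.2 ∧ c.1 + d * c.2 ≤ n := by
  have : c.2 ≤ d * c.2 := Nat.le_mul_of_pos_left _ hd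
  simp only [progressions, Finset.mem_filter, Finset.mem_product, Finset.mem_Icc]
  omega

/-- The longest progression is short iff there is no progression that cannot be continued to the
left. -/
theorem longestAP_lt_iff (x : ℕ → ℝ) (n : ℕ) {d : ℕ} (hd : 1 ≤ d) :
    longestAP x n < d + 1 ↔ ∀ c ∈ progressions n d,
      ¬ ((c.1 ≤ c.2 ∨ x (c.1 - c.2) ≠ 1) ∧ ∀ j < d + 1, x (c.1 + j * c.2) = 1) := by
  rw [← not_le, succ_le_longestAP_iff x n hd]
  constructor
  · rintro h ⟨a, s⟩ hc ⟨-, h1⟩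
    obtain ⟨h2, h3, h4⟩ := (mem_progressions hd).1 hc
    exact h ⟨a, s, h2, h3, h4, h1⟩
  · rintro h ⟨a, s, ha, hs, hle, h1⟩
    -- Descent: a progression that can be continued is shifted one step to the left, keeping d + 1
    -- points and lowering its first term, until it is fresh.
    induction a using Nat.strong_induction_on with
    | _ a ih =>
      by_cases hf : a ≤ s ∨ x (a - s) ≠ 1
      · exact h (a, s) ((mem_progressions hd).2 ⟨ha, hs, hle⟩) ⟨hf, h1⟩
      · push Not at hf
        refine ih (a - s) (by omega) (by omega) (by omega) fun j hj => ?_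
        rcases j with _ | j
        · simpa using hf.2
        · have := h1 j (by omega)
          rwa [show a - s + (j + 1) * s = a + j * s by rw [add_mul]; omega]

theorem longestAP_mono (x : ℕ → ℝ) : Monotone (longestAP x) := by
  intro n n' hnn
  refine Finset.sup_le fun c hc => ?_
  refine le_trans ?_ (Finset.le_sup (f := fun c : ℕ × ℕ => apLength x n' c.1 c.2)
    (Finset.product_subset_product (Finset.Icc_subset_Icc_right hnn)
      (Finset.Icc_subset_Icc_right hnn) hc))
  refine csSup_le_csSup' (mem_apLength_set_bddAbove x n' c.1 c.2) fun m hm => ?_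
  refine ⟨hm.1, hm.2.1.trans ?_, hm.2.2⟩
  gcongr

/-- A progression of the shifted sequence is a progression of the original one. -/
theorem longestAP_shift_le (x : ℕ → ℝ) (m n : ℕ) {r : ℕ} (hr : 2 ≤ r)
    (h : r ≤ longestAP (fun i => x (m + i)) n) : r ≤ longestAP x (m + n) := by
  obtain ⟨d, rfl⟩ : ∃ d, r = d + 1 := ⟨r - 1, by omega⟩
  rw [succ_le_longestAP_iff _ _ (by omega)] at h ⊢
  obtain ⟨a, s, ha, hs, hle, h1⟩ := h
  exact ⟨m + a, s, by omega, hs, by omega, fun j hj => by rw [add_assoc]; exact h1 j hj⟩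

/-! ### Counting progressions -/

theorem step_le_of_mem_progressions {n d : ℕ} (hd : 1 ≤ d) {c : ℕ × ℕ}
    (hc : c ∈ progressions n d) : c.2 ≤ n / d := by
  have := (mem_progressions hd).1 hc
  rw [Nat.le_div_iff_mul_le (by omega), mul_comm]
  omega

theorem card_progressions_le {n d : ℕ} (hd : 1 ≤ d) :
    (progressions n d).card ≤ n * (n / d) := by
  have : progressions n d ⊆ Finset.Icc 1 n ×ˢ Finset.Icc 1 (n / d) := by
    intro c hc
    have h1 := (mem_progressions hd).1 hc
    have h2 := step_le_of_mem_progressions hd hc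
    simp only [Finset.mem_product, Finset.mem_Icc]
    omega
  simpa using Finset.card_le_card this

theorem card_progressions (n d : ℕ) :
    (progressions n d).card = ∑ s ∈ Finset.Icc 1 n, (n - d * s) := by
  unfold progressions
  rw [Finset.card_filter, Finset.sum_product_right]
  refine Finset.sum_congr rfl fun s _ => ?_
  rw [← Finset.card_filter]
  have : (Finset.Icc 1 n).filter (fun a => a + d * s ≤ n) = Finset.Icc 1 (n - d * s) := by
    ext a
    simp only [Finset.mem_filter, Finset.mem_Icc]
    omega
  rw [this, Nat.card_Icc, Nat.add_sub_cancel]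

/-- With n = d m + e by division, the deviation is exactly -(d m + e²/d)/2, and e²/d ≤ e. -/
theorem abs_card_progressions_sub_le (n : ℕ) {d : ℕ} (hd : 1 ≤ d) :
    |((progressions n d).card : ℝ) - (n : ℝ) ^ 2 / (2 * (d : ℝ))| ≤ (n : ℝ) := by
  set m := n / d with hm
  have hmn : m ≤ n := Nat.div_le_self _ _
  have hsum : ((progressions n d).card : ℝ) = ∑ s ∈ Finset.Icc 1 m, ((n : ℝ) - d * s) := by
    rw [card_progressions, ← Finset.sum_subset (Finset.Icc_subset_Icc_right hmn)]
    · push_cast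
      refine Finset.sum_congr rfl fun s hs => ?_
      have h1 := (Finset.mem_Icc.1 hs).2
      rw [hm, Nat.le_div_iff_mul_le (by omega), mul_comm] at h1
      rw [Nat.cast_sub h1]
      push_cast
      ring
    · intro s _ hs
      have hs' : ¬ s ≤ m := fun h => hs (Finset.mem_Icc.2 ⟨(Finset.mem_Icc.1 ‹_›).1, h⟩)
      rw [hm, Nat.le_div_iff_mul_le (by omega), mul_comm] at hs'
      omega
  have hform : ∀ k : ℕ, ∑ s ∈ Finset.Icc 1 k, ((n : ℝ) - d * s) = (k : ℝ) * n - d * (k * (k + 1) / 2) := by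
    intro k
    induction k with
    | zero => simp
    | succ k ih =>
      rw [Finset.sum_Icc_succ_top (by omega), ih]
      push_cast
      ring
  rw [hsum, hform]
  obtain ⟨e, he⟩ : ∃ e, e = n % d := ⟨_, rfl⟩
  have hed : (e : ℝ) ≤ d := by exact_mod_cast (he ▸ Nat.mod_lt n (by omega)).le
  have hn : (n : ℝ) = d * m + e := by
    rw [he]
    exact_mod_cast (Nat.div_add_mod n d).symm
  have hd0 : (0 : ℝ) < d := by exact_mod_cast hd
  have he0 : (0 : ℝ) ≤ e := Nat.cast_nonneg _
  have hm0 : (0 : ℝ) ≤ m := Nat.cast_nonneg _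
  have key : (m : ℝ) * n - d * (m * (m + 1) / 2) - (n : ℝ) ^ 2 / (2 * d) =
      -(d * m / 2 + e * (e / d) / 2) := by
    rw [hn]
    field_simp
    ring
  have h1 : (e : ℝ) / d ≤ 1 := (div_le_one hd0).2 hed
  have h2 : (e : ℝ) * (e / d) ≤ e := mul_le_of_le_one_right he0 h1
  rw [key, abs_neg, abs_of_nonneg (by positivity), hn]
  have : 0 ≤ (d : ℝ) * m := by positivity
  linarith

/-- Adding the predecessor as a new first point is a bijection onto the progressions with one more
point. -/
theorem card_progressions_filter_lt (n : ℕ) {d : ℕ} (hd : 1 ≤ d) :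
    ((progressions n d).filter fun c => c.2 < c.1).card = (progressions n (d + 1)).card := by
  symm
  refine Finset.card_bij (fun c _ => (c.1 + c.2, c.2)) ?_ ?_ ?_
  · intro c hc
    have := (mem_progressions (by omega)).1 hc
    rw [Finset.mem_filter, mem_progressions hd]
    simp only [add_mul] at this ⊢
    omega
  · rintro ⟨a, s⟩ _ ⟨b, t⟩ _ h
    simp only [Prod.mk.injEq] at h ⊢
    omega
  · rintro ⟨a, s⟩ hc
    rw [Finset.mem_filter, mem_progressions hd] at hc
    simp only at hc
    refine ⟨(a - s, s), (mem_progressions (by omega)).2 ?_, by simp only [Prod.mk.injEq, and_true]; omega⟩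
    simp only [add_mul]
    omega

/-! ### Overlaps of two progressions -/

theorem card_le_of_modEq {T : Finset ℕ} {d u : ℕ} (hT : ∀ j ∈ T, j ≤ d)
    (h : ∀ i ∈ T, ∀ j ∈ T, i ≡ j [MOD u]) : T.card ≤ d / u + 1 := by
  rw [← Finset.card_range (d / u + 1)]
  refine Finset.card_le_card_of_injOn (fun j => j / u) (fun j hj => ?_) fun i hi j hj hij => ?_
  · simpa [Nat.lt_succ_iff] using Nat.div_le_div_right (hT j hj)
  · have h1 := h i hi j hj
    rw [← Nat.div_add_mod i u, ← Nat.div_add_mod j u, h1]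
    simp only at hij
    rw [hij]

/-- The points of the progression `a, a + s, …, a + d s`. -/
def points (d : ℕ) (c : ℕ × ℕ) : Finset ℕ :=
  (Finset.range (d + 1)).image fun j => c.1 + j * c.2

theorem mem_points {d : ℕ} {c : ℕ × ℕ} {k : ℕ} :
    k ∈ points d c ↔ ∃ j < d + 1, c.1 + j * c.2 = k := by
  simp [points]

theorem card_points (d : ℕ) {c : ℕ × ℕ} (hc : 1 ≤ c.2) : (points d c).card = d + 1 := by
  unfold points
  rw [Finset.card_image_of_injective, Finset.card_range]
  intro i j hij
  exact Nat.eq_of_mul_eq_mul_right hc (Nat.add_left_cancel hij)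

/-- If the j-th point of c lies on e, then j * c.2 is fixed modulo e.2, hence j is fixed modulo e.2
/ gcd, and j runs through 0, …, d. -/
theorem card_points_inter_le (d : ℕ) {c e : ℕ × ℕ} (he : 1 ≤ e.2) :
    (points d c ∩ points d e).card ≤ d / (e.2 / c.2.gcd e.2) + 1 := by
  set g := c.2.gcd e.2 with hg
  have hsub : points d c ∩ points d e ⊆
      ((Finset.range (d + 1)).filter fun j => c.1 + j * c.2 ∈ points d e).image
        fun j => c.1 + j * c.2 := by
    intro k hk
    obtain ⟨h1, h2⟩ := Finset.mem_inter.1 hk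
    obtain ⟨j, hj, rfl⟩ := mem_points.1 h1
    exact Finset.mem_image.2 ⟨j, Finset.mem_filter.2 ⟨Finset.mem_range.2 hj, h2⟩, rfl⟩
  refine (Finset.card_le_card hsub).trans (Finset.card_image_le.trans ?_)
  refine card_le_of_modEq (fun j hj => ?_) fun i hi j hj => ?_
  · have := Finset.mem_range.1 (Finset.mem_filter.1 hj).1
    omega
  · obtain ⟨k, -, hk⟩ := mem_points.1 (Finset.mem_filter.1 hi).2
    obtain ⟨k', -, hk'⟩ := mem_points.1 (Finset.mem_filter.1 hj).2
    have h1 : c.2 * i ≡ c.2 * j [MOD e.2] := by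
      rw [Nat.modEq_iff_dvd]
      refine ⟨k' - k, ?_⟩
      have e1 : (e.1 + k * e.2 : ℤ) = c.1 + i * c.2 := by exact_mod_cast hk
      have e2 : (e.1 + k' * e.2 : ℤ) = c.1 + j * c.2 := by exact_mod_cast hk'
      push_cast
      linarith
    have := Nat.ModEq.cancel_left_div_gcd he h1
    rwa [Nat.gcd_comm, ← hg] at this

/-- Write the ratio of the steps in lowest terms s : t. As s ≠ t, the larger is at least 2, and at
least 3 unless the ratio is 1 : 2 or 2 : 1. That exceptional ratio leaves only two possible steps
for e, which compensates the larger overlap. -/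
theorem card_points_inter_le_of_ne (d : ℕ) {c e : ℕ × ℕ} (hc : 1 ≤ c.2) (he : 1 ≤ e.2)
    (hne : c.2 ≠ e.2) : (points d c ∩ points d e).card ≤ d / 2 + 1 ∧
      (¬ (e.2 = 2 * c.2 ∨ c.2 = 2 * e.2) → (points d c ∩ points d e).card ≤ d / 3 + 1) := by
  have h1 := card_points_inter_le d (c := c) he
  have h2 := card_points_inter_le d (c := e) hc
  rw [Finset.inter_comm, Nat.gcd_comm] at h2
  obtain ⟨s, hs⟩ := Nat.gcd_dvd_left c.2 e.2
  obtain ⟨t, ht⟩ := Nat.gcd_dvd_right c.2 e.2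
  have hcop := Nat.coprime_div_gcd_div_gcd (Nat.gcd_pos_of_pos_left e.2 hc)
  set g := c.2.gcd e.2 with hg
  have hgpos : 0 < g := Nat.gcd_pos_of_pos_left _ hc
  have hs' : c.2 / g = s := by rw [hs]; exact Nat.mul_div_cancel_left _ hgpos
  have ht' : e.2 / g = t := by rw [ht]; exact Nat.mul_div_cancel_left _ hgpos
  rw [ht'] at h1
  rw [hs'] at h2
  rw [hs', ht'] at hcop
  have hs0 : s ≠ 0 := by rintro rfl; omega
  have ht0 : t ≠ 0 := by rintro rfl; omega
  have hst : s ≠ t := by rintro rfl; omega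
  constructor
  · rcases lt_or_gt_of_ne hst with h | h
    · exact h1.trans (Nat.add_le_add_right (Nat.div_le_div_left (by omega) (by omega)) 1)
    · exact h2.trans (Nat.add_le_add_right (Nat.div_le_div_left (by omega) (by omega)) 1)
  · intro h
    by_cases h3 : 3 ≤ t
    · exact h1.trans (Nat.add_le_add_right (Nat.div_le_div_left (by omega) (by omega)) 1)
    by_cases h4 : 3 ≤ s
    · exact h2.trans (Nat.add_le_add_right (Nat.div_le_div_left (by omega) (by omega)) 1)
    exfalso
    apply h
    have : (s = 1 ∧ t = 2) ∨ (s = 2 ∧ t = 1) := by omega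
    rcases this with ⟨rfl, rfl⟩ | ⟨rfl, rfl⟩
    · left; omega
    · right; omega

/-- The index sets of the events attached to two progressions, which consist of the points of the
progression and of its predecessor, have an element in common. -/
def Touch (d : ℕ) (c e : ℕ × ℕ) : Prop :=
  ∃ i < d + 2, ∃ j < d + 2, c.1 + i * c.2 + e.2 = e.1 + j * e.2 + c.2

-- The step of e together with the positions i, j of a common element determines the first term of
-- e.
open Classical in
theorem card_filter_touch_le (n d : ℕ) (c : ℕ × ℕ) (T : Finset ℕ) :
    ((progressions n d).filter fun e => Touch d c e ∧ e.2 ∈ T).card ≤ (d + 2) ^ 2 * T.card := by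
  have hsub : ((progressions n d).filter fun e => Touch d c e ∧ e.2 ∈ T) ⊆
      ((Finset.range (d + 2) ×ˢ Finset.range (d + 2)) ×ˢ T).image fun v =>
        (c.1 + v.1.1 * c.2 + v.2 - (v.1.2 * v.2 + c.2), v.2) := by
    rintro ⟨b, t⟩ he
    obtain ⟨-, ⟨i, hi, j, hj, h⟩, hT⟩ := Finset.mem_filter.1 he
    refine Finset.mem_image.2 ⟨((i, j), t), ?_, ?_⟩
    · simp only [Finset.mem_product, Finset.mem_range]
      exact ⟨⟨hi, hj⟩, hT⟩
    · simp only [Prod.mk.injEq, and_true] at h ⊢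
      omega
  refine (Finset.card_le_card hsub).trans (Finset.card_image_le.trans ?_)
  simp [sq]

-- Two common points, at positions i, i' in c and j, j' in e, determine e: its step is |i - i'| c.2
-- / |j - j'|, and the first term follows. Hence four indices below d + 1 suffice, independently of
-- n.
open Classical in
theorem card_filter_two_le_inter_le (n d : ℕ) (c : ℕ × ℕ) :
    ((progressions n d).filter fun e => 2 ≤ (points d c ∩ points d e).card).card ≤
      (d + 1) ^ 4 := by
  have hsub : ((progressions n d).filter fun e => 2 ≤ (points d c ∩ points d e).card) ⊆
      ((Finset.range (d + 1) ×ˢ Finset.range (d + 1)) ×ˢ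
        (Finset.range (d + 1) ×ˢ Finset.range (d + 1))).image fun v =>
        (c.1 + v.1.1 * c.2 - v.2.1 * (((v.1.1 : ℤ) - v.1.2).natAbs * c.2 /
            ((v.2.1 : ℤ) - v.2.2).natAbs),
          ((v.1.1 : ℤ) - v.1.2).natAbs * c.2 / ((v.2.1 : ℤ) - v.2.2).natAbs) := by
    rintro ⟨b, t⟩ he
    obtain ⟨k, hk, k', hk', hne⟩ := Finset.one_lt_card.1 (Finset.mem_filter.1 he).2
    obtain ⟨h1, h2⟩ := Finset.mem_inter.1 hk
    obtain ⟨h3, h4⟩ := Finset.mem_inter.1 hk'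
    obtain ⟨i, hi, hik⟩ := mem_points.1 h1
    obtain ⟨j, hj, hjk⟩ := mem_points.1 h2
    obtain ⟨i', hi', hik'⟩ := mem_points.1 h3
    obtain ⟨j', hj', hjk'⟩ := mem_points.1 h4
    simp only at hjk hjk'
    have hjj : j ≠ j' := by
      rintro rfl
      exact hne (hjk.symm.trans hjk')
    have hpos : 0 < ((j : ℤ) - j').natAbs := by omega
    have hmul : ((i : ℤ) - i').natAbs * c.2 = ((j : ℤ) - j').natAbs * t := by
      have : ((i : ℤ) - i') * c.2 = ((j : ℤ) - j') * t := by
        have e1 : (b + j * t : ℤ) = c.1 + i * c.2 := by exact_mod_cast hjk.trans hik.symm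
        have e2 : (b + j' * t : ℤ) = c.1 + i' * c.2 := by exact_mod_cast hjk'.trans hik'.symm
        linarith
      simpa [Int.natAbs_mul] using congrArg Int.natAbs this
    have ht : ((i : ℤ) - i').natAbs * c.2 / ((j : ℤ) - j').natAbs = t := by
      rw [hmul]
      exact Nat.mul_div_cancel_left _ hpos
    refine Finset.mem_image.2 ⟨((i, i'), (j, j')), ?_, ?_⟩
    · simp only [Finset.mem_product, Finset.mem_range]
      exact ⟨⟨hi, hi'⟩, hj, hj'⟩
    · simp only [ht, Prod.mk.injEq, and_true]
      omega
  refine (Finset.card_le_card hsub).trans (Finset.card_image_le.trans ?_)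
  simp only [Finset.card_product, Finset.card_range]
  exact le_of_eq (by ring)

/-! ### Probabilities of fresh progressions -/

section

variable {Ω : Type*} {ξ : ℕ → Ω → ℝ}

/-- The event that the progression `c.1, c.1 + c.2, …, c.1 + d * c.2` consists of successes and
cannot be continued to the left. -/
def freshEvent (ξ : ℕ → Ω → ℝ) (d : ℕ) (c : ℕ × ℕ) : Set Ω :=
  {ω | (c.1 ≤ c.2 ∨ ξ (c.1 - c.2) ω ≠ 1) ∧ ∀ j < d + 1, ξ (c.1 + j * c.2) ω = 1}

/-- The indices of the variables on which `freshEvent ξ d c` depends. -/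
def indexSet (d : ℕ) (c : ℕ × ℕ) : Set {i : ℕ // 1 ≤ i} :=
  {k | ∃ j < d + 2, (k : ℕ) + c.2 = c.1 + j * c.2}

theorem touch_of_not_disjoint {d : ℕ} {c e : ℕ × ℕ}
    (h : ¬ Disjoint (indexSet d c) (indexSet d e)) : Touch d c e := by
  obtain ⟨k, ⟨i, hi, h1⟩, ⟨j, hj, h2⟩⟩ := Set.not_disjoint_iff.1 h
  exact ⟨i, hi, j, hj, by omega⟩

/-- The event that all variables with index in `T` are successes. -/
def onesEvent (ξ : ℕ → Ω → ℝ) (T : Finset ℕ) : Set Ω :=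
  {ω | ∀ i ∈ T, ξ i ω = 1}

theorem freshEvent_subset (d : ℕ) (c : ℕ × ℕ) :
    freshEvent ξ d c ⊆ onesEvent ξ (points d c) := by
  rintro ω ⟨-, h⟩ i hi
  obtain ⟨j, hj, rfl⟩ := mem_points.1 hi
  exact h j hj

theorem measurableSet_freshEvent (ξ : ℕ → Ω → ℝ) {d : ℕ} {c : ℕ × ℕ} (hc : 1 ≤ c.1) :
    MeasurableSet[⨆ k ∈ indexSet d c, MeasurableSpace.comap (ξ (k : ℕ)) inferInstance]
      (freshEvent ξ d c) := by
  have hm : ∀ i (hi : 1 ≤ i), (⟨i, hi⟩ : {i : ℕ // 1 ≤ i}) ∈ indexSet d c →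
      MeasurableSet[⨆ k ∈ indexSet d c, MeasurableSpace.comap (ξ (k : ℕ)) inferInstance]
        {ω | ξ i ω = 1} := by
    intro i hi hmem
    have hle := le_iSup₂ (f := fun (k : {i : ℕ // 1 ≤ i}) (_ : k ∈ indexSet d c) =>
      MeasurableSpace.comap (ξ (k : ℕ)) (inferInstance : MeasurableSpace ℝ)) ⟨i, hi⟩ hmem
    exact hle _ ⟨{1}, measurableSet_singleton 1, rfl⟩
  have hset : freshEvent ξ d c = {ω | c.1 ≤ c.2 ∨ ξ (c.1 - c.2) ω ≠ 1} ∩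
      ⋂ j ∈ Finset.range (d + 1), {ω | ξ (c.1 + j * c.2) ω = 1} := by
    ext ω
    simp [freshEvent]
  rw [hset]
  refine MeasurableSet.inter ?_ (Finset.measurableSet_biInter _ fun j hj => ?_)
  · by_cases h : c.1 ≤ c.2
    · simp [h]
    · simp only [h, false_or]
      -- In `indexSet` the value 0 stands for the predecessor and j + 1 for the j-th point.
      refine (hm (c.1 - c.2) (by omega) ⟨0, by omega, ?_⟩).compl
      simp only [zero_mul]
      omega
  · refine hm _ (by omega) ⟨j + 1, by simpa using hj, ?_⟩
    simp only
    ring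

/-- The predecessor of the later progression is a point of the earlier one, so it would have to be
both a failure and a success. This removes the pairs with the largest overlaps. -/
theorem freshEvent_inter_eq_empty {d : ℕ} {c e : ℕ × ℕ} (hc : 1 ≤ c.1) (hs : c.2 = e.2)
    (hlt : c.1 < e.1) (h : (points d c ∩ points d e).Nonempty) :
    freshEvent ξ d c ∩ freshEvent ξ d e = ∅ := by
  obtain ⟨k, hk⟩ := h
  obtain ⟨i, hi, hik⟩ := mem_points.1 (Finset.mem_inter.1 hk).1
  obtain ⟨j, hj, hjk⟩ := mem_points.1 (Finset.mem_inter.1 hk).2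
  rw [← hs] at hjk
  have hji : j < i := by
    by_contra hcon
    have : i * c.2 ≤ j * c.2 := Nat.mul_le_mul_right _ (not_lt.1 hcon)
    omega
  obtain ⟨v, rfl⟩ : ∃ v, i = j + v + 1 := ⟨i - j - 1, by omega⟩
  have he : e.1 = c.1 + v * c.2 + c.2 := by
    have : (j + v + 1) * c.2 = j * c.2 + v * c.2 + c.2 := by ring
    omega
  rw [Set.eq_empty_iff_forall_notMem]
  rintro ω ⟨h1, h2⟩
  rcases h2.1 with h3 | h3
  · omega
  · apply h3
    rw [← hs, he, Nat.add_sub_cancel]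
    exact h1.2 v (by omega)

theorem setOf_U_lt_eq (ξ : ℕ → Ω → ℝ) (n : ℕ) {d : ℕ} (hd : 1 ≤ d) :
    {ω | U ξ n ω < d + 1} = {ω | ∀ c ∈ progressions n d, ω ∉ freshEvent ξ d c} := by
  ext ω
  exact longestAP_lt_iff (fun i => ξ i ω) n hd

variable [MeasurableSpace Ω] {μ : Measure Ω} {p : ℝ}

theorem IsBernoulliSequence.measureReal_onesEvent (hξ : IsBernoulliSequence μ p ξ) {T : Finset ℕ}
    (hT : ∀ i ∈ T, 1 ≤ i) : μ.real (onesEvent ξ T) = p ^ T.card := by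
  have h := hξ.indep.measure_inter_preimage_eq_mul (T.subtype fun i => 1 ≤ i)
    (sets := fun _ => {1}) fun _ _ => measurableSet_singleton _
  have hset : onesEvent ξ T = ⋂ i ∈ T.subtype (fun i => 1 ≤ i), ξ (i : ℕ) ⁻¹' {1} := by
    ext ω
    simp only [onesEvent, Set.mem_ofPred_eq, Finset.mem_subtype, Set.mem_iInter, Set.mem_preimage,
      Set.mem_singleton_iff, Subtype.forall]
    exact ⟨fun h i _ hi => h i hi, fun h i hi => h i (hT i hi) hi⟩
  rw [hset, measureReal_def, h, ENNReal.toReal_prod]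
  have : ∀ i ∈ T.subtype fun i => 1 ≤ i, (μ (ξ (i : ℕ) ⁻¹' {1})).toReal = p := fun i _ =>
    hξ.prob_one i i.2
  rw [Finset.prod_congr rfl this, Finset.prod_const, Finset.card_subtype,
    Finset.filter_true_of_mem hT]

theorem IsBernoulliSequence.measurableSet_eq_one (hξ : IsBernoulliSequence μ p ξ) {i : ℕ}
    (hi : 1 ≤ i) : MeasurableSet {ω | ξ i ω = 1} :=
  hξ.measurable i hi (measurableSet_singleton 1)

theorem IsBernoulliSequence.measurableSet_onesEvent (hξ : IsBernoulliSequence μ p ξ)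
    {T : Finset ℕ} (hT : ∀ i ∈ T, 1 ≤ i) : MeasurableSet (onesEvent ξ T) := by
  have : onesEvent ξ T = ⋂ i ∈ T, {ω | ξ i ω = 1} := by
    ext ω
    simp [onesEvent]
  rw [this]
  exact Finset.measurableSet_biInter _ fun i hi => hξ.measurableSet_eq_one (hT i hi)

theorem one_le_of_mem_points {d : ℕ} {c : ℕ × ℕ} (hc : 1 ≤ c.1) {i : ℕ} (hi : i ∈ points d c) :
    1 ≤ i := by
  obtain ⟨j, -, rfl⟩ := mem_points.1 hi
  omega

theorem indexSet_nonempty {d : ℕ} {c : ℕ × ℕ} (hc : 1 ≤ c.1) : (indexSet d c).Nonempty :=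
  ⟨⟨c.1, hc⟩, 1, by omega, by simp⟩

theorem IsBernoulliSequence.measureReal_freshEvent [IsProbabilityMeasure μ]
    (hξ : IsBernoulliSequence μ p ξ) (d : ℕ) {c : ℕ × ℕ} (hc : 1 ≤ c.1) (hc' : 1 ≤ c.2) :
    μ.real (freshEvent ξ d c) = p ^ (d + 1) * (if c.2 < c.1 then 1 - p else 1) := by
  have hT := fun i => one_le_of_mem_points (d := d) hc (i := i)
  split_ifs with h
  · have hnot : c.1 - c.2 ∉ points d c := by
      intro hmem
      obtain ⟨j, -, hj⟩ := mem_points.1 hmem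
      omega
    have hT' : ∀ i ∈ insert (c.1 - c.2) (points d c), 1 ≤ i := by
      intro i hi
      rcases Finset.mem_insert.1 hi with rfl | hi
      · omega
      · exact hT i hi
    have hset : freshEvent ξ d c =
        onesEvent ξ (points d c) \ onesEvent ξ (insert (c.1 - c.2) (points d c)) := by
      ext ω
      constructor
      · intro hω
        refine ⟨freshEvent_subset d c hω, fun h1 => ?_⟩
        rcases hω.1 with h2 | h2
        · omega
        · exact h2 (h1 _ (Finset.mem_insert_self _ _))
      · rintro ⟨h1, h2⟩
        refine ⟨Or.inr fun h3 => h2 fun i hi => ?_, fun j hj => h1 _ (mem_points.2 ⟨j, hj, rfl⟩)⟩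
        rcases Finset.mem_insert.1 hi with rfl | hi
        · exact h3
        · exact h1 i hi
    have hsub : onesEvent ξ (insert (c.1 - c.2) (points d c)) ⊆ onesEvent ξ (points d c) :=
      fun ω (hω : ∀ i ∈ _, ξ i ω = 1) i hi => hω i (Finset.mem_insert_of_mem hi)
    rw [hset, measureReal_sdiff hsub
      (hξ.measurableSet_onesEvent hT'), hξ.measureReal_onesEvent hT, hξ.measureReal_onesEvent hT',
      Finset.card_insert_of_notMem hnot, card_points d hc']
    ring
  · have hset : freshEvent ξ d c = onesEvent ξ (points d c) := by
      refine (freshEvent_subset d c).antisymm fun ω hω => ⟨Or.inl (by omega), fun j hj => ?_⟩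
      exact hω _ (mem_points.2 ⟨j, hj, rfl⟩)
    rw [hset, hξ.measureReal_onesEvent hT, card_points d hc', mul_one]

theorem IsBernoulliSequence.measureReal_freshEvent_le [IsProbabilityMeasure μ]
    (hξ : IsBernoulliSequence μ p ξ) (hp : 0 ≤ p) (d : ℕ) {c : ℕ × ℕ} (hc : 1 ≤ c.1)
    (hc' : 1 ≤ c.2) : μ.real (freshEvent ξ d c) ≤ p ^ (d + 1) := by
  rw [hξ.measureReal_freshEvent d hc hc']
  refine mul_le_of_le_one_right (pow_nonneg hp _) ?_
  split_ifs <;> linarith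

/-- A predecessor inside the range costs a factor 1 - p, and the progressions that have one are
counted by `progressions n (d + 1)`. -/
theorem IsBernoulliSequence.sum_measureReal_freshEvent [IsProbabilityMeasure μ]
    (hξ : IsBernoulliSequence μ p ξ) (n : ℕ) {d : ℕ} (hd : 1 ≤ d) :
    ∑ c ∈ progressions n d, μ.real (freshEvent ξ d c) =
      p ^ (d + 1) * ((progressions n d).card - p * (progressions n (d + 1)).card) := by
  have h1 : ∀ c ∈ progressions n d, μ.real (freshEvent ξ d c) =
      p ^ (d + 1) * (1 - p * if c.2 < c.1 then 1 else 0) := by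
    intro c hc
    have := (mem_progressions hd).1 hc
    rw [hξ.measureReal_freshEvent d this.1 this.2.1]
    split_ifs <;> ring
  rw [Finset.sum_congr rfl h1, ← Finset.mul_sum, Finset.sum_sub_distrib, ← Finset.mul_sum,
    ← Finset.sum_filter, ← card_progressions_filter_lt n hd]
  simp

/-- Both events force successes on the union of the points, of size 2(d + 1) minus the overlap. The
three terms belong to overlap at most 1, to step ratio 2, and to any other ratio with at least two
common points; equal steps with such an overlap contribute nothing. -/
theorem IsBernoulliSequence.measureReal_freshEvent_inter_le [IsProbabilityMeasure μ]
    (hξ : IsBernoulliSequence μ p ξ) (hp0 : 0 ≤ p) (hp1 : p ≤ 1) {d : ℕ} {c e : ℕ × ℕ}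
    (hc : 1 ≤ c.1) (hc' : 1 ≤ c.2) (he : 1 ≤ e.1) (he' : 1 ≤ e.2) (hne : e ≠ c) :
    μ.real (freshEvent ξ d c ∩ freshEvent ξ d e) ≤ p ^ (2 * d + 1) +
      (if e.2 = 2 * c.2 ∨ c.2 = 2 * e.2 then p ^ (2 * d + 1 - d / 2) else 0) +
      (if 2 ≤ (points d c ∩ points d e).card then p ^ (2 * d + 1 - d / 3) else 0) := by
  have hT : ∀ i ∈ points d c ∪ points d e, 1 ≤ i := by
    intro i hi
    rcases Finset.mem_union.1 hi with h | h
    · exact one_le_of_mem_points hc h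
    · exact one_le_of_mem_points he h
  have hle : μ.real (freshEvent ξ d c ∩ freshEvent ξ d e) ≤
      p ^ (points d c ∪ points d e).card := by
    rw [← hξ.measureReal_onesEvent hT]
    refine measureReal_mono ?_
    rintro ω ⟨h1, h2⟩ i hi
    rcases Finset.mem_union.1 hi with h | h
    · exact freshEvent_subset d c h1 i h
    · exact freshEvent_subset d e h2 i h
  have hcard := Finset.card_union_add_card_inter (points d c) (points d e)
  rw [card_points d hc', card_points d he'] at hcard
  have hnn : ∀ (P : Prop) [Decidable P] (k : ℕ), 0 ≤ if P then p ^ k else 0 := by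
    intro P _ k
    split_ifs <;> positivity
  have hpow : ∀ k, k ≤ (points d c ∪ points d e).card →
      μ.real (freshEvent ξ d c ∩ freshEvent ξ d e) ≤ p ^ k := fun k hk =>
    hle.trans (pow_le_pow_of_le_one hp0 hp1 hk)
  have hpos : 0 ≤ p ^ (2 * d + 1) := pow_nonneg hp0 _
  by_cases h2 : 2 ≤ (points d c ∩ points d e).card
  · by_cases hs : c.2 = e.2
    · have hne' : (points d c ∩ points d e).Nonempty := Finset.card_pos.1 (by omega)
      have hemp : freshEvent ξ d c ∩ freshEvent ξ d e = ∅ := by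
        rcases lt_trichotomy c.1 e.1 with h | h | h
        · exact freshEvent_inter_eq_empty hc hs h hne'
        · exact absurd (Prod.ext h hs).symm hne
        · rw [Set.inter_comm]
          exact freshEvent_inter_eq_empty he hs.symm h (by rwa [Finset.inter_comm])
      rw [hemp, measureReal_empty]
      exact add_nonneg (add_nonneg hpos (hnn _ _)) (hnn _ _)
    · obtain ⟨h3, h4⟩ := card_points_inter_le_of_ne d hc' he' hs
      by_cases h5 : e.2 = 2 * c.2 ∨ c.2 = 2 * e.2
      · have h6 := hpow (2 * d + 1 - d / 2) (by omega)
        have := hnn (2 ≤ (points d c ∩ points d e).card) (2 * d + 1 - d / 3)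
        rw [if_pos h5]
        linarith
      · have h6 := hpow (2 * d + 1 - d / 3) (by have := h4 h5; omega)
        have := hnn (e.2 = 2 * c.2 ∨ c.2 = 2 * e.2) (2 * d + 1 - d / 2)
        rw [if_pos h2]
        linarith
  · have h6 := hpow (2 * d + 1) (by omega)
    have h7 := hnn (e.2 = 2 * c.2 ∨ c.2 = 2 * e.2) (2 * d + 1 - d / 2)
    have h8 := hnn (2 ≤ (points d c ∩ points d e).card) (2 * d + 1 - d / 3)
    linarith

theorem IsBernoulliSequence.measurableSet_freshEvent (hξ : IsBernoulliSequence μ p ξ) {d : ℕ}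
    {c : ℕ × ℕ} (hc : 1 ≤ c.1) : MeasurableSet (freshEvent ξ d c) :=
  (iSup₂_le fun k _ => (hξ.measurable k k.2).comap_le :
    (⨆ k ∈ indexSet d c, MeasurableSpace.comap (ξ (k : ℕ)) inferInstance) ≤ _) _
    (LongestAP.measurableSet_freshEvent ξ hc)

theorem IsBernoulliSequence.measurableSet_U_lt (hξ : IsBernoulliSequence μ p ξ) (n : ℕ) {r : ℕ}
    (hr : 2 ≤ r) : MeasurableSet {ω | U ξ n ω < r} := by
  obtain ⟨d, rfl⟩ : ∃ d, r = d + 1 := ⟨r - 1, by omega⟩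
  have hd : 1 ≤ d := by omega
  rw [setOf_U_lt_eq ξ n hd]
  have : {ω | ∀ c ∈ progressions n d, ω ∉ freshEvent ξ d c} =
      ⋂ c ∈ progressions n d, (freshEvent ξ d c)ᶜ := by
    ext ω
    simp
  rw [this]
  exact Finset.measurableSet_biInter _ fun c hc =>
    (hξ.measurableSet_freshEvent ((mem_progressions hd).1 hc).1).compl

/-- The Poisson approximation of the distribution of the longest progression, with an explicit
error term. -/
theorem IsBernoulliSequence.abs_measureReal_U_lt_sub_le [IsProbabilityMeasure μ]
    (hξ : IsBernoulliSequence μ p ξ) (hp0 : 0 ≤ p) (hp1 : p ≤ 1) (n : ℕ) {d : ℕ} (hd : 1 ≤ d) :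
    |μ.real {ω | U ξ n ω < d + 1} - Real.exp (-(p ^ (d + 1) *
        ((progressions n d).card - p * (progressions n (d + 1)).card)))| ≤
      (progressions n d).card * (2 * ((d + 2) ^ 2 * ((n / d : ℕ) : ℝ) * p ^ (2 * d + 1)) +
        2 * (d + 2) ^ 2 * p ^ (2 * d + 1 - d / 2) + (d + 1) ^ 4 * p ^ (2 * d + 1 - d / 3)) := by
  classical
  have hm : ∀ k : {i : ℕ // 1 ≤ i},
      MeasurableSpace.comap (ξ (k : ℕ)) inferInstance ≤ ‹MeasurableSpace Ω› := fun k =>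
    (hξ.measurable k k.2).comap_le
  have key := abs_measureReal_eventCount_eq_zero_sub_exp_le (μ := μ) hm
    ((iIndepFun_iff_iIndep _ _ _).1 hξ.indep) (E := freshEvent ξ d) (A := indexSet d)
    (I := progressions n d)
    (fun c hc => LongestAP.measurableSet_freshEvent ξ ((mem_progressions hd).1 hc).1)
    (fun c hc => indexSet_nonempty ((mem_progressions hd).1 hc).1)
  rw [hξ.sum_measureReal_freshEvent n hd] at key
  rw [setOf_U_lt_eq ξ n hd]
  refine key.trans ?_
  rw [← nsmul_eq_mul]
  refine Finset.sum_le_card_nsmul _ _ _ fun c hc => ?_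
  obtain ⟨hc1, hc2, -⟩ := (mem_progressions hd).1 hc
  set J := (progressions n d).filter fun e => ¬ Disjoint (indexSet d c) (indexSet d e) with hJ
  have hJcard : ∀ (P : ℕ × ℕ → Prop) [DecidablePred P] (T : Finset ℕ),
      (∀ e ∈ progressions n d, P e → e.2 ∈ T) → (J.filter P).card ≤ (d + 2) ^ 2 * T.card := by
    intro P _ T hPT
    refine (Finset.card_le_card ?_).trans (card_filter_touch_le n d c T)
    intro e he
    obtain ⟨h1, h2⟩ := Finset.mem_filter.1 he
    obtain ⟨h3, h4⟩ := Finset.mem_filter.1 h1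
    exact Finset.mem_filter.2 ⟨h3, touch_of_not_disjoint h4, hPT e h3 h2⟩
  have hJ1 : (J.card : ℝ) ≤ (d + 2) ^ 2 * ((n / d : ℕ) : ℝ) := by
    have := hJcard (fun _ => True) (Finset.Icc 1 (n / d)) fun e he _ =>
      Finset.mem_Icc.2 ⟨((mem_progressions hd).1 he).2.1, step_le_of_mem_progressions hd he⟩
    simp only [Finset.filter_true, Nat.card_Icc, Nat.add_sub_cancel] at this
    exact_mod_cast this
  have hJ2 : ((J.filter fun e => e.2 = 2 * c.2 ∨ c.2 = 2 * e.2).card : ℝ) ≤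
      2 * (d + 2) ^ 2 := by
    -- For odd `c.2` the rounded value `c.2 / 2` is merely superfluous: the second alternative is
    -- then impossible.
    have := hJcard (fun e => e.2 = 2 * c.2 ∨ c.2 = 2 * e.2) {2 * c.2, c.2 / 2} fun e _ he => by
      simp only [Finset.mem_insert, Finset.mem_singleton]
      omega
    have h2 : ({2 * c.2, c.2 / 2} : Finset ℕ).card ≤ 2 := Finset.card_le_two
    have h3 := this.trans (Nat.mul_le_mul_left _ h2)
    rw [mul_comm _ 2] at h3
    exact_mod_cast h3
  have hJ3 : ((J.filter fun e => 2 ≤ (points d c ∩ points d e).card).card : ℝ) ≤ (d + 1) ^ 4 := by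
    have : (J.filter fun e => 2 ≤ (points d c ∩ points d e).card).card ≤ (d + 1) ^ 4 :=
      (Finset.card_le_card (Finset.filter_subset_filter _ (Finset.filter_subset _ _))).trans
        (card_filter_two_le_inter_le n d c)
    exact_mod_cast this
  have hb1 : ∑ e ∈ J, μ.real (freshEvent ξ d c) * μ.real (freshEvent ξ d e) ≤
      (d + 2) ^ 2 * ((n / d : ℕ) : ℝ) * p ^ (2 * d + 1) := by
    have : ∀ e ∈ J, μ.real (freshEvent ξ d c) * μ.real (freshEvent ξ d e) ≤ p ^ (2 * d + 1) := by
      intro e he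
      obtain ⟨he1, he2, -⟩ := (mem_progressions hd).1 (Finset.mem_filter.1 he).1
      calc _ ≤ p ^ (d + 1) * p ^ (d + 1) := mul_le_mul (hξ.measureReal_freshEvent_le hp0 d hc1 hc2)
            (hξ.measureReal_freshEvent_le hp0 d he1 he2) measureReal_nonneg (pow_nonneg hp0 _)
        _ = p ^ (2 * d + 2) := by rw [← pow_add]; congr 1; ring
        _ ≤ _ := pow_le_pow_of_le_one hp0 hp1 (by omega)
    refine (Finset.sum_le_card_nsmul _ _ _ this).trans ?_
    rw [nsmul_eq_mul]
    exact mul_le_mul_of_nonneg_right hJ1 (pow_nonneg hp0 _)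
  have hb2 : ∑ e ∈ (progressions n d).filter
        (fun e => ¬ Disjoint (indexSet d c) (indexSet d e) ∧ e ≠ c),
        μ.real (freshEvent ξ d c ∩ freshEvent ξ d e) ≤
      (d + 2) ^ 2 * ((n / d : ℕ) : ℝ) * p ^ (2 * d + 1) +
        2 * (d + 2) ^ 2 * p ^ (2 * d + 1 - d / 2) + (d + 1) ^ 4 * p ^ (2 * d + 1 - d / 3) := by
    have hnn : ∀ (P : Prop) [Decidable P] (k : ℕ), 0 ≤ if P then p ^ k else 0 := by
      intro P _ k
      split_ifs <;> positivity
    calc _ ≤ ∑ e ∈ (progressions n d).filter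
          (fun e => ¬ Disjoint (indexSet d c) (indexSet d e) ∧ e ≠ c), (p ^ (2 * d + 1) +
          (if e.2 = 2 * c.2 ∨ c.2 = 2 * e.2 then p ^ (2 * d + 1 - d / 2) else 0) +
          (if 2 ≤ (points d c ∩ points d e).card then p ^ (2 * d + 1 - d / 3) else 0)) := by
          refine Finset.sum_le_sum fun e he => ?_
          obtain ⟨h1, -, h2⟩ := Finset.mem_filter.1 he
          obtain ⟨he1, he2, -⟩ := (mem_progressions hd).1 h1
          exact hξ.measureReal_freshEvent_inter_le hp0 hp1 hc1 hc2 he1 he2 h2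
      _ ≤ ∑ e ∈ J, (p ^ (2 * d + 1) +
          (if e.2 = 2 * c.2 ∨ c.2 = 2 * e.2 then p ^ (2 * d + 1 - d / 2) else 0) +
          (if 2 ≤ (points d c ∩ points d e).card then p ^ (2 * d + 1 - d / 3) else 0)) := by
          refine Finset.sum_le_sum_of_subset_of_nonneg (fun e he => ?_) fun e _ _ =>
            add_nonneg (add_nonneg (pow_nonneg hp0 _) (hnn _ _)) (hnn _ _)
          obtain ⟨h1, h2, -⟩ := Finset.mem_filter.1 he
          exact Finset.mem_filter.2 ⟨h1, h2⟩
      _ ≤ _ := by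
          rw [Finset.sum_add_distrib, Finset.sum_add_distrib, ← Finset.sum_filter,
            ← Finset.sum_filter, Finset.sum_const, Finset.sum_const, Finset.sum_const,
            nsmul_eq_mul, nsmul_eq_mul, nsmul_eq_mul]
          gcongr
  refine le_trans (le_of_eq ?_) ((add_le_add hb1 hb2).trans (le_of_eq (by ring)))
  congr!

end

/-! ### The uniform estimate with rate log^4 n / n -/

theorem one_le_log_of_three_le {n : ℕ} (hn : 3 ≤ n) : 1 ≤ Real.log n := by
  rw [Real.le_log_iff_exp_le (by positivity)]
  have : (3 : ℝ) ≤ n := by exact_mod_cast hn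
  linarith [Real.exp_one_lt_d9]

/-- Partial fractions exhibit `lam` as the exact mean with the two counts replaced by n²/(2d) and
n²/(2(d+1)). -/
theorem lam_succ (p : ℝ) (n : ℕ) {d : ℕ} (hd : 1 ≤ d) :
    lam p n (d + 1) =
      p ^ (d + 1) * ((n : ℝ) ^ 2 / (2 * d) - p * ((n : ℝ) ^ 2 / (2 * ((d + 1 : ℕ) : ℝ)))) := by
  have hd0 : (0 : ℝ) < d := by exact_mod_cast hd
  unfold lam
  push_cast
  rw [add_sub_cancel_right]
  field_simp
  ring

theorem lam_nonneg {p : ℝ} (hp0 : 0 ≤ p) (hp1 : p ≤ 1) (n : ℕ) {r : ℕ} (hr : 2 ≤ r) :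
    0 ≤ lam p n r := by
  have h2 : (2 : ℝ) ≤ r := by exact_mod_cast hr
  have h3 : 0 ≤ 1 - p := by linarith
  have h4 : 0 ≤ (r : ℝ) - 1 := by linarith
  unfold lam
  positivity

theorem lam_le {p : ℝ} (hp0 : 0 ≤ p) (hp1 : p ≤ 1) (n : ℕ) {r : ℕ} (hr : 2 ≤ r) :
    lam p n r ≤ (n : ℝ) ^ 2 * p ^ r := by
  have h2 : (2 : ℝ) ≤ r := by exact_mod_cast hr
  unfold lam
  rw [mul_div_assoc]
  refine mul_le_of_le_one_right (by positivity) ?_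
  rw [div_le_one (by nlinarith)]
  nlinarith

theorem le_lam {p : ℝ} (hp0 : 0 ≤ p) (n : ℕ) {r : ℕ} (hr : 2 ≤ r) :
    (n : ℝ) ^ 2 * p ^ r * (1 - p) / (2 * r) ≤ lam p n r := by
  have h2 : (2 : ℝ) ≤ r := by exact_mod_cast hr
  unfold lam
  rw [mul_div_assoc, mul_div_assoc]
  refine mul_le_mul_of_nonneg_left ?_ (by positivity)
  rw [div_le_div_iff₀ (by linarith) (by nlinarith)]
  have : (1 - p) * (2 * r * ((r : ℝ) - 1)) = 2 * r * ((1 - p) * (r - 1)) := by ring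
  rw [this, mul_comm (p + _)]
  refine mul_le_mul_of_nonneg_left ?_ (by linarith)
  nlinarith

theorem abs_exp_neg_sub_exp_neg_le {x y : ℝ} (hx : 0 ≤ x) (hy : 0 ≤ y) :
    |Real.exp (-x) - Real.exp (-y)| ≤ |x - y| := by
  have key : ∀ {x y : ℝ}, 0 ≤ x → x ≤ y →
      0 ≤ Real.exp (-x) - Real.exp (-y) ∧ Real.exp (-x) - Real.exp (-y) ≤ y - x := by
    intro x y hx hxy
    have h1 : Real.exp (-y) ≤ Real.exp (-x) := Real.exp_le_exp.2 (by linarith)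
    have h2 : Real.exp (-y) = Real.exp (-x) * Real.exp (x - y) := by
      rw [← Real.exp_add]
      congr 1
      ring
    have h3 : Real.exp (-x) ≤ 1 := Real.exp_le_one_iff.2 (by linarith)
    have h4 := Real.add_one_le_exp (x - y)
    have h5 := Real.exp_pos (-x)
    exact ⟨by linarith, by nlinarith⟩
  rcases le_total x y with h | h
  · have := key hx h
    rw [abs_of_nonneg this.1, abs_sub_comm, abs_of_nonneg (by linarith)]
    exact this.2
  · have := key hy h
    rw [abs_sub_comm, abs_of_nonneg this.1, abs_of_nonneg (by linarith)]
    exact this.2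

section

variable {Ω : Type*} [MeasurableSpace Ω] {μ : Measure Ω} [IsProbabilityMeasure μ] {p : ℝ}
  {ξ : ℕ → Ω → ℝ}

theorem IsBernoulliSequence.one_sub_measureReal_U_lt_le (hξ : IsBernoulliSequence μ p ξ)
    (hp0 : 0 ≤ p) (n : ℕ) {r : ℕ} (hr : 2 ≤ r) :
    1 - μ.real {ω | U ξ n ω < r} ≤ (n : ℝ) ^ 2 * p ^ r := by
  obtain ⟨d, rfl⟩ : ∃ d, r = d + 1 := ⟨r - 1, by omega⟩
  have hd : 1 ≤ d := by omega
  rw [← probReal_compl_eq_one_sub (hξ.measurableSet_U_lt n hr)]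
  have hsub : {ω | U ξ n ω < d + 1}ᶜ ⊆ ⋃ c ∈ progressions n d, freshEvent ξ d c := by
    rw [setOf_U_lt_eq ξ n hd]
    intro ω hω
    simpa using hω
  refine (measureReal_mono hsub (measure_ne_top _ _)).trans ((measureReal_biUnion_finset_le _ _).trans ?_)
  refine (Finset.sum_le_card_nsmul _ _ (p ^ (d + 1)) fun c hc => ?_).trans ?_
  · obtain ⟨h1, h2, -⟩ := (mem_progressions hd).1 hc
    exact hξ.measureReal_freshEvent_le hp0 d h1 h2
  · rw [nsmul_eq_mul]
    refine mul_le_mul_of_nonneg_right ?_ (pow_nonneg hp0 _)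
    have : (progressions n d).card ≤ n ^ 2 := by
      rw [sq]
      exact (card_progressions_le hd).trans (Nat.mul_le_mul_left _ (Nat.div_le_self _ _))
    exact_mod_cast this

/-- Both quantities lie within 1/n of 1, the probability by the union bound. -/
theorem IsBernoulliSequence.abs_measureReal_U_lt_sub_le_of_pow_le
    (hξ : IsBernoulliSequence μ p ξ) (hp0 : 0 ≤ p) (hp1 : p ≤ 1) {n : ℕ} (hn : 1 ≤ n) {r : ℕ}
    (hr : 2 ≤ r) (h : p ^ r ≤ 1 / (n : ℝ) ^ 3) :
    |μ.real {ω | U ξ n ω < r} - Real.exp (-lam p n r)| ≤ 2 / n := by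
  have hn0 : (0 : ℝ) < n := by exact_mod_cast hn
  have h1 := hξ.one_sub_measureReal_U_lt_le hp0 n hr
  have h2 : μ.real {ω | U ξ n ω < r} ≤ 1 := measureReal_le_one
  have h3 := lam_le hp0 hp1 n hr
  have h4 := lam_nonneg hp0 hp1 n hr
  have h5 := Real.add_one_le_exp (-lam p n r)
  have h6 : Real.exp (-lam p n r) ≤ 1 := Real.exp_le_one_iff.2 (by linarith)
  have h7 : (n : ℝ) ^ 2 * p ^ r ≤ 1 / n := by
    calc (n : ℝ) ^ 2 * p ^ r ≤ (n : ℝ) ^ 2 * (1 / (n : ℝ) ^ 3) := by gcongr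
      _ = 1 / (n : ℝ) := by field_simp
  have h8 : (2 : ℝ) / n = 1 / n + 1 / n := by ring
  have h9 : 0 ≤ 1 / (n : ℝ) := by positivity
  rw [abs_le]
  constructor <;> linarith

theorem IsBernoulliSequence.abs_exp_neg_sum_sub_exp_neg_lam_le (hξ : IsBernoulliSequence μ p ξ)
    (hp0 : 0 ≤ p) (hp1 : p ≤ 1) (n : ℕ) {d : ℕ} (hd : 1 ≤ d) :
    |Real.exp (-(p ^ (d + 1) * ((progressions n d).card - p * (progressions n (d + 1)).card))) -
      Real.exp (-lam p n (d + 1))| ≤ 2 * n * p ^ (d + 1) := by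
  refine (abs_exp_neg_sub_exp_neg_le ?_ (lam_nonneg hp0 hp1 n (by omega))).trans ?_
  · rw [← hξ.sum_measureReal_freshEvent n hd]
    exact Finset.sum_nonneg fun _ _ => measureReal_nonneg
  rw [lam_succ p n hd, ← mul_sub, abs_mul, abs_of_nonneg (pow_nonneg hp0 _), mul_comm]
  refine mul_le_mul_of_nonneg_right ?_ (pow_nonneg hp0 _)
  have h1 := abs_le.1 (abs_card_progressions_sub_le n hd)
  have h2 := abs_le.1 (abs_card_progressions_sub_le n (d := d + 1) (by omega))
  have hn0 : (0 : ℝ) ≤ n := Nat.cast_nonneg _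
  rw [abs_le]
  constructor <;> nlinarith

/-- The error of the Poisson approximation in the range of lengths around the typical value. -/
theorem exists_bound_of_pow_le (hp0 : 0 < p) (hp1 : p < 1) {b c : ℝ} (hb : 0 < b) (hc : 0 ≤ c) :
    ∃ K : ℝ, 0 ≤ K ∧ ∀ n : ℕ, 3 ≤ n → ∀ d : ℕ, 1 ≤ d → (d : ℝ) ≤ c * Real.log n →
      p ^ (d + 1) ≤ (b * Real.log n / n) ^ 2 →
      (progressions n d).card * (2 * ((d + 2) ^ 2 * ((n / d : ℕ) : ℝ) * p ^ (2 * d + 1)) +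
        2 * (d + 2) ^ 2 * p ^ (2 * d + 1 - d / 2) + (d + 1) ^ 4 * p ^ (2 * d + 1 - d / 3)) +
        2 * n * p ^ (d + 1) ≤ K * (Real.log n ^ 4 / n) := by
  -- Here 5040 = 7! comes from log^7 n ≤ 7! n. The summand 1 gives e ≥ 1, so that e - 1 ≤ e³ and no
  -- cube root of a constant is needed.
  set e : ℝ := b ^ 10 * 5040 / p ^ 2 + 1 with he
  have he1 : 1 ≤ e := by
    have : 0 ≤ b ^ 10 * 5040 / p ^ 2 := by positivity
    linarith
  refine ⟨18 * b ^ 4 / p + 18 * c * b ^ 3 / p + 16 * c ^ 3 * e + 2 * b ^ 2, by positivity, ?_⟩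
  intro n hn d hd hdc hy
  set N := Real.log n with hN
  have hN1 : 1 ≤ N := one_le_log_of_three_le hn
  have hn0 : (0 : ℝ) < n := by positivity
  have hd1 : (1 : ℝ) ≤ d := by exact_mod_cast hd
  have hd0 : (0 : ℝ) < d := by linarith
  set y := p ^ (d + 1) with hydef
  have hy0 : 0 < y := by positivity
  set z := b * N / n with hz
  have hz0 : 0 < z := by positivity
  set m : ℝ := ((n / d : ℕ) : ℝ) with hm
  have hm0 : 0 ≤ m := Nat.cast_nonneg _
  have hmle : m ≤ n / d := Nat.cast_div_le
  have hcard : ((progressions n d).card : ℝ) ≤ n * (n / d) := by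
    have : ((progressions n d).card : ℝ) ≤ n * m := by
      rw [hm]
      exact_mod_cast card_progressions_le (n := n) hd
    exact this.trans (by gcongr)
  have hd2 : ((d : ℝ) + 2) ^ 2 ≤ 9 * d ^ 2 := by nlinarith
  have hd4 : ((d : ℝ) + 1) ^ 4 ≤ 16 * d ^ 4 := by
    calc ((d : ℝ) + 1) ^ 4 ≤ (2 * d) ^ 4 := by gcongr; linarith
      _ = 16 * (d : ℝ) ^ 4 := by ring
  have e1 : p ^ (2 * d + 1) ≤ z ^ 4 / p := by
    rw [le_div_iff₀ hp0]
    calc p ^ (2 * d + 1) * p = y ^ 2 := by rw [hydef]; ring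
      _ ≤ (z ^ 2) ^ 2 := by gcongr
      _ = z ^ 4 := by ring
  -- The power is essentially y^(3/2); squaring avoids the fractional exponent and the floor in d /
  -- 2.
  have e2 : p ^ (2 * d + 1 - d / 2) ≤ z ^ 3 / p := by
    rw [← pow_le_pow_iff_left₀ (by positivity) (by positivity) two_ne_zero, div_pow,
      le_div_iff₀ (by positivity)]
    calc (p ^ (2 * d + 1 - d / 2)) ^ 2 * p ^ 2 = p ^ ((2 * d + 1 - d / 2) * 2 + 2) := by
          rw [← pow_mul, ← pow_add]
      _ ≤ p ^ (3 * (d + 1)) := pow_le_pow_of_le_one hp0.le hp1.le (by omega)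
      _ = y ^ 3 := by rw [hydef, ← pow_mul, mul_comm]
      _ ≤ (z ^ 2) ^ 3 := by gcongr
      _ = (z ^ 3) ^ 2 := by ring
  have hN7 : N ^ 7 ≤ 5040 * n := by
    have := Real.pow_div_factorial_le_exp N (by linarith) 7
    rw [hN, Real.exp_log hn0, ← hN, div_le_iff₀ (by positivity)] at this
    norm_num [Nat.factorial] at this
    linarith
  -- The power is essentially y^(5/3), of order (N/n)^(10/3), so cubes are compared. The spare
  -- n^(-1/3) pays for N^(7/3).
  have e3 : p ^ (2 * d + 1 - d / 3) ≤ e * N / n ^ 3 := by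
    rw [← pow_le_pow_iff_left₀ (by positivity) (by positivity) three_ne_zero]
    calc (p ^ (2 * d + 1 - d / 3)) ^ 3 ≤ y ^ 5 / p ^ 2 := by
          rw [le_div_iff₀ (by positivity), hydef, ← pow_mul, ← pow_add, ← pow_mul]
          exact pow_le_pow_of_le_one hp0.le hp1.le (by omega)
      _ ≤ (z ^ 2) ^ 5 / p ^ 2 := by gcongr
      _ = b ^ 10 / p ^ 2 * (N ^ 7 * N ^ 3 / n ^ 10) := by rw [hz]; field_simp
      _ ≤ b ^ 10 / p ^ 2 * (5040 * n * N ^ 3 / n ^ 10) := by gcongr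
      _ = (e - 1) * (N / n ^ 3) ^ 3 := by rw [he]; field_simp; ring
      _ ≤ e ^ 3 * (N / n ^ 3) ^ 3 := by
          gcongr
          nlinarith [one_le_pow₀ he1 (n := 2)]
      _ = _ := by ring
  -- About n²/d progressions with d² (n/d) neighbours each give n³ z⁴, of order N^4 / n; here the
  -- powers of d cancel.
  have t1 : n * (n / d) * (2 * (9 * d ^ 2 * (n / d) * (z ^ 4 / p))) =
      18 * b ^ 4 / p * (N ^ 4 / n) := by
    rw [hz]
    field_simp
    ring
  have t2 : n * (n / d) * (2 * (9 * d ^ 2) * (z ^ 3 / p)) ≤ 18 * c * b ^ 3 / p * (N ^ 4 / n) := by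
    calc n * (n / d) * (2 * (9 * d ^ 2) * (z ^ 3 / p)) = 18 * d * b ^ 3 / p * (N ^ 3 / n) := by
          rw [hz]
          field_simp
          ring
      _ ≤ 18 * (c * N) * b ^ 3 / p * (N ^ 3 / n) := by gcongr
      _ = _ := by ring
  have t3 : n * (n / d) * (16 * d ^ 4 * (e * N / n ^ 3)) ≤ 16 * c ^ 3 * e * (N ^ 4 / n) := by
    calc n * (n / d) * (16 * d ^ 4 * (e * N / n ^ 3)) = 16 * d ^ 3 * e * (N / n) := by
          field_simp
      _ ≤ 16 * (c * N) ^ 3 * e * (N / n) := by gcongr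
      _ = _ := by ring
  have t4 : 2 * n * y ≤ 2 * b ^ 2 * (N ^ 4 / n) := by
    calc 2 * n * y ≤ 2 * n * z ^ 2 := by gcongr
      _ = 2 * b ^ 2 * (N ^ 2 / n) := by rw [hz]; field_simp
      _ ≤ _ := by gcongr; norm_num
  calc _ ≤ n * (n / d) * (2 * (9 * d ^ 2 * (n / d) * (z ^ 4 / p)) +
        2 * (9 * d ^ 2) * (z ^ 3 / p) + 16 * d ^ 4 * (e * N / n ^ 3)) + 2 * n * y := by
        gcongr
    _ = n * (n / d) * (2 * (9 * d ^ 2 * (n / d) * (z ^ 4 / p))) +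
        n * (n / d) * (2 * (9 * d ^ 2) * (z ^ 3 / p)) +
        n * (n / d) * (16 * d ^ 4 * (e * N / n ^ 3)) + 2 * n * y := by ring
    _ ≤ _ := by linarith

end

/-- The bound p^r > n^(-3) makes r at most a multiple of log n, so a quantity n² p^r of order log²
n, divided by r, is still at least log n once B is large. -/
theorem log_le_lam {p B : ℝ} (hp0 : 0 < p) (hp1 : p < 1)
    (hB : 6 / ((1 - p) * -Real.log p) ≤ B) {n : ℕ} (hn : 3 ≤ n) {r : ℕ} (hr : 2 ≤ r)
    (h3 : 1 / (n : ℝ) ^ 3 < p ^ r) (h : B * (Real.log n / n) ^ 2 ≤ p ^ r) :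
    Real.log n ≤ lam p n r := by
  have hl : 0 < -Real.log p := neg_pos.2 (Real.log_neg hp0 hp1)
  have hq : 0 < 1 - p := by linarith
  have hN1 := one_le_log_of_three_le hn
  have hn0 : (0 : ℝ) < n := by positivity
  have hr2 : (2 : ℝ) ≤ r := by exact_mod_cast hr
  have hrN : r * -Real.log p ≤ 3 * Real.log n := by
    have := Real.log_lt_log (by positivity) h3
    rw [Real.log_pow, one_div, Real.log_inv, Real.log_pow] at this
    push_cast at this
    linarith
  refine le_trans ?_ (le_lam hp0.le n hr)
  rw [le_div_iff₀ (by positivity)]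
  rw [div_le_iff₀ (by positivity)] at hB
  have h4 : B * Real.log n ^ 2 ≤ (n : ℝ) ^ 2 * p ^ r := by
    calc B * Real.log n ^ 2 = (n : ℝ) ^ 2 * (B * (Real.log n / n) ^ 2) := by field_simp
      _ ≤ _ := by gcongr
  have h5 : 6 * Real.log n ^ 2 ≤ (n : ℝ) ^ 2 * p ^ r * (1 - p) * -Real.log p := by
    calc 6 * Real.log n ^ 2 ≤ B * ((1 - p) * -Real.log p) * Real.log n ^ 2 := by gcongr
      _ = B * Real.log n ^ 2 * ((1 - p) * -Real.log p) := by ring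
      _ ≤ (n : ℝ) ^ 2 * p ^ r * ((1 - p) * -Real.log p) := by gcongr
      _ = _ := by ring
  have h6 : Real.log n * (2 * r) * -Real.log p ≤ 6 * Real.log n ^ 2 := by nlinarith
  exact le_of_mul_le_mul_right (h6.trans h5) hl

/-- Poisson approximation for the longest progression, uniformly in the length. -/
theorem exists_poisson_bound (p : ℝ) (hp0 : 0 < p) (hp1 : p < 1) :
    ∃ K : ℝ, 0 ≤ K ∧ ∀ (Ω : Type u) [MeasurableSpace Ω] (μ : Measure Ω) [IsProbabilityMeasure μ]
      (ξ : ℕ → Ω → ℝ), IsBernoulliSequence μ p ξ →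
      ∀ n : ℕ, 3 ≤ n → ∀ r : ℕ, 2 ≤ r →
        |μ.real {ω | U ξ n ω < r} - Real.exp (-lam p n r)| ≤ K * (Real.log n ^ 4 / n) := by
  have hl : 0 < -Real.log p := neg_pos.2 (Real.log_neg hp0 hp1)
  have hq : 0 < 1 - p := by linarith
  -- Division by p makes p * B admissible in `log_le_lam` too, so the first exponent below the
  -- threshold still has mean at least log n; the summand 1 gives p * B > 1.
  set B : ℝ := (6 / ((1 - p) * -Real.log p) + 1) / p with hB
  have hB0 : 0 < B := by positivity
  have hpB : p * B = 6 / ((1 - p) * -Real.log p) + 1 := by rw [hB]; field_simp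
  have h6 : 0 < 6 / ((1 - p) * -Real.log p) := by positivity
  obtain ⟨K, hK0, hK⟩ := exists_bound_of_pow_le hp0 hp1 (b := Real.sqrt B) (Real.sqrt_pos.2 hB0)
    (c := 3 / -Real.log p) (by positivity)
  refine ⟨K + 3, by linarith, fun Ω _ μ _ ξ hξ n hn r hr => ?_⟩
  have hN1 := one_le_log_of_three_le hn
  have hn0 : (0 : ℝ) < n := by positivity
  set N := Real.log n with hN
  have hinv : 1 / (n : ℝ) ≤ N ^ 4 / n := by
    gcongr
    exact one_le_pow₀ hN1
  have hinv0 : 0 ≤ N ^ 4 / n := by positivity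
  have hbase : ∀ r : ℕ, 2 ≤ r → p ^ r ≤ B * (N / n) ^ 2 →
      |μ.real {ω | U ξ n ω < r} - Real.exp (-lam p n r)| ≤ (K + 2) * (N ^ 4 / n) := by
    intro r hr hpr
    by_cases h3 : p ^ r ≤ 1 / (n : ℝ) ^ 3
    · refine (hξ.abs_measureReal_U_lt_sub_le_of_pow_le hp0.le hp1.le (by omega) hr h3).trans ?_
      have : (2 : ℝ) / n = 2 * (1 / n) := by ring
      nlinarith
    · obtain ⟨d, rfl⟩ : ∃ d, r = d + 1 := ⟨r - 1, by omega⟩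
      have hd : 1 ≤ d := by omega
      have hdN : (d : ℝ) ≤ 3 / -Real.log p * N := by
        have := Real.log_lt_log (by positivity) (not_le.1 h3)
        rw [Real.log_pow, one_div, Real.log_inv, Real.log_pow] at this
        push_cast at this
        rw [div_mul_eq_mul_div, le_div_iff₀ hl]
        nlinarith
      have h1 := hK n hn d hd hdN (by rwa [mul_div_assoc, mul_pow, Real.sq_sqrt hB0.le])
      have h2 := hξ.abs_measureReal_U_lt_sub_le hp0.le hp1.le n hd
      have h3 := hξ.abs_exp_neg_sum_sub_exp_neg_lam_le hp0.le hp1.le n hd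
      refine (abs_sub_le _ _ _).trans ((add_le_add h2 h3).trans (h1.trans ?_))
      gcongr
      linarith
  by_cases hpr : p ^ r ≤ B * (N / n) ^ 2
  · exact (hbase r hr hpr).trans (by gcongr; linarith)
  have hexp : ∀ r : ℕ, N ≤ lam p n r → Real.exp (-lam p n r) ≤ 1 / n := by
    intro r h
    calc Real.exp (-lam p n r) ≤ Real.exp (-N) := Real.exp_le_exp.2 (by linarith)
      _ = 1 / n := by rw [Real.exp_neg, hN, Real.exp_log hn0, one_div]
  have hnz : 1 / (n : ℝ) ^ 3 ≤ (N / n) ^ 2 := by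
    rw [div_pow, div_le_div_iff₀ (by positivity) (by positivity), one_mul]
    have h1 : (1 : ℝ) ≤ N ^ 2 := one_le_pow₀ hN1
    have h2 : (1 : ℝ) ≤ n := by exact_mod_cast (by omega : 1 ≤ n)
    nlinarith [pow_le_pow_right₀ h2 (by norm_num : 2 ≤ 3), pow_pos hn0 3]
  have hBp : 6 / ((1 - p) * -Real.log p) ≤ p * B := by linarith
  have hpB1 : 1 < p * B := by linarith
  have hBB : p * B ≤ B := by nlinarith
  have hlarge : ∀ r : ℕ, 2 ≤ r → p * B * (N / n) ^ 2 < p ^ r → N ≤ lam p n r := by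
    intro r hr h
    refine log_le_lam hp0 hp1 hBp hn hr ?_ h.le
    have : 0 < (N / n) ^ 2 := by positivity
    nlinarith
  have hlam : N ≤ lam p n r := hlarge r hr (lt_of_le_of_lt (by gcongr) (not_le.1 hpr))
  -- Short lengths r reduce to the least k past the threshold: the case already treated applies to
  -- k, both exponentials are at most 1/n, and the probability for r is at most that for k.
  have hex : ∃ k : ℕ, p ^ k ≤ B * (N / n) ^ 2 := by
    obtain ⟨k, hk⟩ := exists_pow_lt_of_lt_one (show 0 < B * (N / n) ^ 2 by positivity) hp1
    exact ⟨k, hk.le⟩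
  classical
  have hspec := Nat.find_spec hex
  set k := Nat.find hex with hk
  have hrk : r < k := by
    by_contra hcon
    exact hpr ((pow_le_pow_of_le_one hp0.le hp1.le (not_lt.1 hcon)).trans hspec)
  have hk1 : ¬ p ^ (k - 1) ≤ B * (N / n) ^ 2 := Nat.find_min hex (by omega)
  have hlamk : N ≤ lam p n k := by
    refine hlarge k (by omega) ?_
    calc p * B * (N / n) ^ 2 = p * (B * (N / n) ^ 2) := by ring
      _ < p * p ^ (k - 1) := by gcongr; exact not_le.1 hk1
      _ = p ^ k := by rw [← pow_succ']; congr 1; omega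
  have hmono : μ.real {ω | U ξ n ω < r} ≤ μ.real {ω | U ξ n ω < k} :=
    measureReal_mono fun ω (hω : _ < r) => lt_trans hω hrk
  have h1 := (abs_le.1 (hbase k (by omega) hspec)).2
  have h2 := hexp r hlam
  have h3 := hexp k hlamk
  have h4 : 0 ≤ μ.real {ω | U ξ n ω < r} := measureReal_nonneg
  have h5 := Real.exp_pos (-lam p n r)
  have h6 : 0 ≤ K * (N ^ 4 / n) := by positivity
  rw [abs_le]
  constructor <;> nlinarith

/-! ### The Gumbel-type form -/

theorem log_log_pos {n : ℕ} (hn : 3 ≤ n) : 0 < Real.log (Real.log n) := by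
  apply Real.log_pos
  rw [Real.lt_log_iff_exp_lt (by positivity)]
  have : (3 : ℝ) ≤ n := by exact_mod_cast hn
  linarith [Real.exp_one_lt_d9]

theorem pow_eq_of_h_add_eq {p : ℝ} (hp0 : 0 < p) (hp1 : p < 1) {n : ℕ} (hn : 3 ≤ n) {r : ℕ} {x : ℝ}
    (hr : h p n + x = r) : (n : ℝ) ^ 2 * p ^ r = Real.log n * p ^ x := by
  have hl : Real.log p ≠ 0 := (Real.log_neg hp0 hp1).ne
  have hN1 := one_le_log_of_three_le hn
  have hn0 : (0 : ℝ) < n := by positivity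
  rw [← Real.rpow_natCast p r, ← hr, Real.rpow_add hp0, ← mul_assoc]
  congr 1
  have : p ^ h p n = Real.log n / (n : ℝ) ^ 2 := by
    rw [Real.rpow_def_of_pos hp0]
    have e : Real.log p * h p n = Real.log (Real.log n) - 2 * Real.log n := by
      unfold h C D
      field_simp
      ring
    rw [e, Real.exp_sub, Real.exp_log (by linarith), two_mul, Real.exp_add, Real.exp_log hn0, sq]
  rw [this]
  field_simp

theorem rpow_le_log_rpow {p : ℝ} (hp0 : 0 < p) (hp1 : p < 1) {n : ℕ} (hn : 3 ≤ n) {a x : ℝ}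
    (hx : a * D p * Real.log (Real.log n) ≤ x) : p ^ x ≤ Real.log n ^ a := by
  have hl := Real.log_neg hp0 hp1
  have hN1 := one_le_log_of_three_le hn
  rw [Real.rpow_def_of_pos hp0, Real.rpow_def_of_pos (by linarith), Real.exp_le_exp]
  have : Real.log p * (a * D p * Real.log (Real.log n)) = Real.log (Real.log n) * a := by
    unfold D
    field_simp [hl.ne]
  rw [← this]
  exact mul_le_mul_of_nonpos_left hx hl.le

/-- Split off the least admissible value: x = a D log log n + z with z ≥ 0. The decay of p^z keeps
p^z z bounded, which makes the estimate uniform in unboundedly large x. -/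
theorem abs_mul_rpow_le {p : ℝ} (hp0 : 0 < p) (hp1 : p < 1) {n : ℕ} (hn : 3 ≤ n) {a x : ℝ}
    (hx : a * D p * Real.log (Real.log n) ≤ x) :
    p ^ x * |x| ≤ Real.log n ^ a * ((|a * D p| * Real.log (Real.log n)) + 1 / -Real.log p) := by
  have hl : 0 < -Real.log p := neg_pos.2 (Real.log_neg hp0 hp1)
  have hN1 := one_le_log_of_three_le hn
  have hM := log_log_pos hn
  set M := Real.log (Real.log n) with hMdef
  obtain ⟨z, rfl⟩ : ∃ z, x = a * D p * M + z := ⟨x - a * D p * M, by ring⟩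
  have hz : 0 ≤ z := by linarith
  have h1 : p ^ (a * D p * M) = Real.log n ^ a := by
    rw [Real.rpow_def_of_pos hp0, Real.rpow_def_of_pos (by linarith)]
    congr 1
    unfold D
    field_simp [(Real.log_neg hp0 hp1).ne]
    rfl
  rw [Real.rpow_add hp0, h1, mul_assoc]
  refine mul_le_mul_of_nonneg_left ?_ (Real.rpow_nonneg (by linarith) _)
  have h2 : p ^ z ≤ 1 := Real.rpow_le_one hp0.le hp1.le hz
  have h3 : 0 < p ^ z := Real.rpow_pos_of_pos hp0 z
  have h4 : p ^ z * z ≤ 1 / -Real.log p := by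
    rw [le_div_iff₀ hl]
    have h5 := Real.add_one_le_exp (z * -Real.log p)
    have h6 : p ^ z * Real.exp (z * -Real.log p) = 1 := by
      rw [Real.rpow_def_of_pos hp0, ← Real.exp_add]
      simp [mul_comm]
    nlinarith
  calc p ^ z * |a * D p * M + z| ≤ p ^ z * (|a * D p| * M + z) := by
        gcongr
        refine (abs_add_le _ _).trans ?_
        rw [abs_mul, abs_of_pos hM, abs_of_nonneg hz]
    _ = p ^ z * (|a * D p| * M) + p ^ z * z := by ring
    _ ≤ 1 * (|a * D p| * M) + 1 / -Real.log p := by gcongr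
    _ = _ := by ring

/-- Here n² p^r = log n · p^x, and r |log p| differs from 2 log n by log log n and a multiple of x.
Replacing r by 2 log n / |log p| thus costs a relative error of order (log log n + |x| + 1) / log n.
-/
theorem abs_lam_sub_le {p : ℝ} (hp0 : 0 < p) (hp1 : p < 1) {n : ℕ} (hn : 3 ≤ n) {r : ℕ}
    (hr2 : 2 ≤ r) {x : ℝ} (hr : h p n + x = r) (hN : 2 * -Real.log p ≤ Real.log n)
    (hrN : Real.log n ≤ r * -Real.log p) :
    |lam p n r - (1 - p) * -Real.log p / 4 * p ^ x| ≤
      p ^ x * ((-Real.log p + 3 * (-Real.log p) ^ 2) *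
        (Real.log (Real.log n) + |x| + 1) / Real.log n) := by
  have hl : 0 < -Real.log p := neg_pos.2 (Real.log_neg hp0 hp1)
  have hN1 := one_le_log_of_three_le hn
  have hM := log_log_pos hn
  have hpow := pow_eq_of_h_add_eq hp0 hp1 hn hr
  have hr2' : (2 : ℝ) ≤ r := by exact_mod_cast hr2
  have hrl : r * -Real.log p = 2 * Real.log n - Real.log (Real.log n) + x * -Real.log p := by
    rw [← hr]
    unfold h C D
    field_simp [(Real.log_neg hp0 hp1).ne]
    ring
  unfold lam
  rw [hpow]
  set N := Real.log n with hNdef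
  set M := Real.log N with hMdef
  set l := -Real.log p with hldef
  have hP : 0 < p ^ x := Real.rpow_pos_of_pos hp0 x
  have hr1 : 0 < (r : ℝ) - 1 := by linarith
  have hr0 : 0 < (r : ℝ) := by linarith
  have e1 : N * p ^ x * (p + (1 - p) * r) / (2 * r * (r - 1)) - (1 - p) * l / 4 * p ^ x =
      p ^ x * ((1 - p) * (M - x * l + l) / (4 * (r - 1)) + p * N / (2 * r * (r - 1))) := by
    have : M - x * l + l = 2 * N - (r * l) + l := by rw [hrl]; ring
    rw [this]
    field_simp
    ring
  rw [e1, abs_mul, abs_of_pos hP]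
  refine mul_le_mul_of_nonneg_left ?_ hP.le
  have hr1l : N ≤ 2 * l * (r - 1) := by linarith
  have hx0 := abs_nonneg x
  have hq : 0 ≤ 1 - p := by linarith
  have b1 : |(1 - p) * (M - x * l + l) / (4 * (r - 1))| ≤ (1 + l) * (M + |x| + 1) * l / (2 * N) := by
    rw [abs_div, abs_mul, abs_of_nonneg hq, abs_of_pos (by linarith : 0 < 4 * ((r : ℝ) - 1)),
      div_le_div_iff₀ (by linarith) (by linarith)]
    have h1 : |M - x * l + l| ≤ (1 + l) * (M + |x| + 1) := by
      have : |M - x * l + l| ≤ M + |x| * l + l := by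
        rw [abs_le]
        constructor <;> nlinarith [neg_abs_le x, le_abs_self x]
      nlinarith
    have h2 : (1 - p) * |M - x * l + l| ≤ (1 + l) * (M + |x| + 1) :=
      (mul_le_of_le_one_left (abs_nonneg _) (by linarith)).trans h1
    calc (1 - p) * |M - x * l + l| * (2 * N) ≤ (1 + l) * (M + |x| + 1) * (2 * (2 * l * (r - 1))) := by
          gcongr
      _ = _ := by ring
  have b2 : |p * N / (2 * r * (r - 1))| ≤ l ^ 2 * (M + |x| + 1) / N := by
    rw [abs_of_nonneg (by positivity), div_le_div_iff₀ (by positivity) (by linarith)]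
    calc p * N * N ≤ 1 * (r * l) * (2 * l * (r - 1)) := by gcongr
      _ = l ^ 2 * 1 * (2 * r * (r - 1)) := by ring
      _ ≤ l ^ 2 * (M + |x| + 1) * (2 * r * (r - 1)) := by gcongr; linarith
  refine (abs_add_le _ _).trans ((add_le_add b1 b2).trans ?_)
  have : (1 + l) * (M + |x| + 1) * l / (2 * N) + l ^ 2 * (M + |x| + 1) / N =
      ((1 + l) * l / 2 + l ^ 2) * (M + |x| + 1) / N := by
    field_simp
  rw [this]
  refine div_le_div_of_nonneg_right (mul_le_mul_of_nonneg_right ?_ (by linarith)) (by linarith)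
  nlinarith

/-- The mean in the Poisson approximation in the parametrization by the deviation `x`. -/
theorem exists_abs_lam_sub_le (p : ℝ) (hp0 : 0 < p) (hp1 : p < 1) (a : ℝ) :
    ∃ K : ℝ, 0 ≤ K ∧ ∀ n : ℕ, 3 ≤ n → 1 ≤ Real.log (Real.log n) →
      2 * -Real.log p ≤ Real.log n → ∀ r : ℕ, 2 ≤ r → Real.log n ≤ r * -Real.log p →
      ∀ x : ℝ, h p n + x = r → a * D p * Real.log (Real.log n) ≤ x →
      |lam p n r - (1 - p) * -Real.log p / 4 * p ^ x| ≤
        K * (Real.log (Real.log n) * Real.log n ^ (a - 1)) := by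
  have hl : 0 < -Real.log p := neg_pos.2 (Real.log_neg hp0 hp1)
  refine ⟨(-Real.log p + 3 * (-Real.log p) ^ 2) * (2 + |a * D p| + 1 / -Real.log p),
    by positivity, fun n hn hM hN r hr2 hrN x hr hx => ?_⟩
  refine (abs_lam_sub_le hp0 hp1 hn hr2 hr hN hrN).trans ?_
  have hN1 := one_le_log_of_three_le hn
  have h1 := abs_mul_rpow_le hp0 hp1 hn hx
  have h2 := rpow_le_log_rpow hp0 hp1 hn hx
  have hP : 0 < p ^ x := Real.rpow_pos_of_pos hp0 x
  set M := Real.log (Real.log n) with hMdef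
  set N := Real.log n with hNdef
  have hNa : 0 < N ^ a := Real.rpow_pos_of_pos (by linarith) a
  have h3 : p ^ x * (M + |x| + 1) ≤ N ^ a * M * (2 + |a * D p| + 1 / -Real.log p) := by
    calc p ^ x * (M + |x| + 1) = p ^ x * |x| + p ^ x * (M + 1) := by ring
      _ ≤ N ^ a * (|a * D p| * M + 1 / -Real.log p) + N ^ a * (M + 1) := by gcongr
      _ = N ^ a * (|a * D p| * M + 1 / -Real.log p * 1 + (M + 1)) := by ring
      _ ≤ N ^ a * (|a * D p| * M + 1 / -Real.log p * M + (M + M)) := by gcongr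
      _ = _ := by ring
  rw [Real.rpow_sub_one (by linarith)]
  calc p ^ x * ((-Real.log p + 3 * (-Real.log p) ^ 2) * (M + |x| + 1) / N) =
        (-Real.log p + 3 * (-Real.log p) ^ 2) * (p ^ x * (M + |x| + 1)) / N := by ring
    _ ≤ (-Real.log p + 3 * (-Real.log p) ^ 2) *
        (N ^ a * M * (2 + |a * D p| + 1 / -Real.log p)) / N := by gcongr
    _ = _ := by ring

theorem tendsto_log_natCast : Tendsto (fun n : ℕ => Real.log n) atTop atTop :=
  Real.tendsto_log_atTop.comp tendsto_natCast_atTop_atTop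

theorem eventually_const_mul_log_mul_rpow_le (c : ℝ) {b e : ℝ} (hb : b < 0) (he : 0 < e) :
    ∀ᶠ N : ℝ in atTop, c * (Real.log N * N ^ b) ≤ e := by
  have h1 : Tendsto (fun N : ℝ => c * (Real.log N * N ^ b)) atTop (𝓝 (c * 0)) := by
    refine Tendsto.const_mul c ?_
    have := (isLittleO_log_rpow_atTop (neg_pos.2 hb)).tendsto_div_nhds_zero
    refine this.congr' ?_
    filter_upwards [eventually_gt_atTop 0] with N hN
    rw [Real.rpow_neg hN.le, div_inv_eq_mul]
  rw [mul_zero] at h1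
  exact h1.eventually (eventually_le_nhds he)

theorem eventually_mul_rpow_add_mul_log_le (c d : ℝ) {a : ℝ} (ha : a < 1) :
    ∀ᶠ N : ℝ in atTop, c * N ^ a + d * Real.log N ≤ N := by
  have h1 : Tendsto (fun N : ℝ => c * N ^ (a - 1) + d * (Real.log N / N)) atTop
      (𝓝 (c * 0 + d * 0)) := by
    refine (Tendsto.const_mul c ?_).add (Tendsto.const_mul d ?_)
    · have := tendsto_rpow_neg_atTop (y := 1 - a) (by linarith)
      simpa using this
    · simpa using (Real.isLittleO_log_id_atTop).tendsto_div_nhds_zero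
  rw [mul_zero, mul_zero, add_zero] at h1
  filter_upwards [h1.eventually (eventually_le_nhds one_pos), eventually_gt_atTop 0] with N h hN
  rw [Real.rpow_sub_one hN.ne'] at h
  have := mul_le_mul_of_nonneg_right h hN.le
  field_simp at this
  linarith

/-- After multiplication by exp(c p^x) the main term is exp(c p^x - λ), close to 1. The Poisson
error grows by at most exp(c log^a n), which a < 1 makes negligible against n. -/
theorem exists_gumbel_bound (p : ℝ) (hp0 : 0 < p) (hp1 : p < 1) (a : ℝ) (ha : a < 1) :
    ∃ K : ℝ, ∀ (Ω : Type u) [MeasurableSpace Ω] (μ : Measure Ω) [IsProbabilityMeasure μ]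
      (ξ : ℕ → Ω → ℝ), IsBernoulliSequence μ p ξ →
      ∀ n : ℕ, 3 ≤ n → ∀ x : ℝ, a * D p * Real.log (Real.log n) ≤ x →
        (∃ m : ℤ, h p n + x = m) →
        |Real.exp (-(1 - p) * Real.log p / 4 * p ^ x) *
            μ.real {ω | (U ξ n ω : ℝ) < h p n + x} - 1|
          ≤ K * (Real.log (Real.log n) / Real.log n ^ (1 - a)) := by
  have hl : 0 < -Real.log p := neg_pos.2 (Real.log_neg hp0 hp1)
  have hq : 0 < 1 - p := by linarith
  obtain ⟨K₁, hK₁, hpoi⟩ := exists_poisson_bound.{u} p hp0 hp1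
  obtain ⟨K₂, hK₂, hlam⟩ := exists_abs_lam_sub_le p hp0 hp1 a
  set c := (1 - p) * -Real.log p / 4 with hc
  have hc0 : 0 < c := by positivity
  have hev : ∀ᶠ n : ℕ in atTop, 1 ≤ Real.log (Real.log n) ∧ 2 * -Real.log p ≤ Real.log n ∧
      (1 + |a|) * Real.log (Real.log n) ≤ Real.log n ∧
      K₂ * (Real.log (Real.log n) * Real.log n ^ (a - 1)) ≤ 1 ∧
      -- The coefficient 5 - a is 4 from the Poisson error plus 1 - a from the target rate.
      c * Real.log n ^ a + (5 - a) * Real.log (Real.log n) ≤ Real.log n := by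
    have h1 := Real.tendsto_log_atTop.eventually_ge_atTop 1
    have h2 := eventually_ge_atTop (2 * -Real.log p)
    have h3 := eventually_mul_rpow_add_mul_log_le 0 (1 + |a|) ha
    have h4 := eventually_const_mul_log_mul_rpow_le K₂ (sub_neg.2 ha) one_pos
    have h5 := eventually_mul_rpow_add_mul_log_le c (5 - a) ha
    filter_upwards [tendsto_log_natCast.eventually h1, tendsto_log_natCast.eventually h2,
      tendsto_log_natCast.eventually h3, tendsto_log_natCast.eventually h4,
      tendsto_log_natCast.eventually h5] with n h1 h2 h3 h4 h5
    exact ⟨h1, h2, by linarith, h4, h5⟩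
  obtain ⟨n₀, hn₀⟩ := eventually_atTop.1 hev
  -- The finitely many small n enter the constant through the ratio of the trivial bound to the
  -- target rate.
  set G : ℕ → ℝ := fun n => (Real.exp (c * Real.log n ^ a) + 1) /
    (Real.log (Real.log n) / Real.log n ^ (1 - a)) with hG
  refine ⟨K₁ + 2 * K₂ + ∑ n ∈ Finset.range n₀, |G n|, fun Ω _ μ _ ξ hξ n hn x hx hm => ?_⟩
  have hN1 := one_le_log_of_three_le hn
  have hM0 := log_log_pos hn
  have hPle := rpow_le_log_rpow hp0 hp1 hn hx
  have hP : 0 < p ^ x := Real.rpow_pos_of_pos hp0 x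
  have hn0 : (0 : ℝ) < n := by positivity
  have hrhs : 0 < Real.log (Real.log n) / Real.log n ^ (1 - a) :=
    div_pos hM0 (Real.rpow_pos_of_pos (by linarith) _)
  have hexpc : -(1 - p) * Real.log p / 4 * p ^ x = c * p ^ x := by rw [hc]; ring
  have hexple : Real.exp (c * p ^ x) ≤ Real.exp (c * Real.log n ^ a) :=
    Real.exp_le_exp.2 (by gcongr)
  rw [hexpc]
  by_cases hlt : n < n₀
  · have h1 : |Real.exp (c * p ^ x) * μ.real {ω | (U ξ n ω : ℝ) < h p n + x} - 1| ≤
        Real.exp (c * Real.log n ^ a) + 1 := by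
      have h2 : μ.real {ω | (U ξ n ω : ℝ) < h p n + x} ≤ 1 := measureReal_le_one
      have h3 : 0 ≤ μ.real {ω | (U ξ n ω : ℝ) < h p n + x} := measureReal_nonneg
      have h4 := Real.exp_pos (c * p ^ x)
      rw [abs_le]
      constructor <;> nlinarith
    have h2 : |G n| ≤ ∑ n ∈ Finset.range n₀, |G n| :=
      Finset.single_le_sum (f := fun n => |G n|) (fun _ _ => abs_nonneg _)
        (Finset.mem_range.2 hlt)
    have h3 : Real.exp (c * Real.log n ^ a) + 1 =
        G n * (Real.log (Real.log n) / Real.log n ^ (1 - a)) := by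
      rw [hG]
      field_simp
    refine h1.trans (h3.le.trans (mul_le_mul_of_nonneg_right ?_ hrhs.le))
    linarith [le_abs_self (G n)]
  · obtain ⟨h1, h2, h3, h4, h5⟩ := hn₀ n (not_lt.1 hlt)
    obtain ⟨m, hm⟩ := hm
    -- The lower bound on x gives m |log p| ≥ 2 log n - (1 + |a|) log log n; hence the integer level
    -- is a natural number at least 2.
    have hmN : Real.log n ≤ m * -Real.log p := by
      have hD : D p * -Real.log p = -1 := by
        unfold D
        field_simp [(Real.log_neg hp0 hp1).ne]
      have hC : C p * -Real.log p = 2 := by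
        unfold C
        field_simp [(Real.log_neg hp0 hp1).ne]
      have e1 : m * -Real.log p = C p * -Real.log p * Real.log n +
          D p * -Real.log p * Real.log (Real.log n) + x * -Real.log p := by
        rw [← hm]
        unfold h
        ring
      have e2 : a * (D p * -Real.log p) * Real.log (Real.log n) ≤ x * -Real.log p := by
        calc _ = a * D p * Real.log (Real.log n) * -Real.log p := by ring
          _ ≤ _ := by gcongr
      rw [hC, hD] at e1
      rw [hD] at e2
      nlinarith [le_abs_self a]
    have hm2 : (2 : ℝ) ≤ m := by
      have := h2.trans hmN
      exact le_of_mul_le_mul_right this hl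
    have hm2' : (2 : ℤ) ≤ m := by exact_mod_cast hm2
    obtain ⟨r, rfl⟩ : ∃ r : ℕ, m = r := ⟨m.toNat, (Int.toNat_of_nonneg (by omega)).symm⟩
    have hr2 : 2 ≤ r := by exact_mod_cast hm2'
    rw [Int.cast_natCast] at hm hmN
    have hset : {ω | (U ξ n ω : ℝ) < h p n + x} = {ω | U ξ n ω < r} := by
      ext ω
      simp only [hm, Set.mem_ofPred_eq, Nat.cast_lt]
    rw [hset]
    have b1 := hpoi Ω μ ξ hξ n hn r hr2
    have b2 := hlam n hn h1 h2 r hr2 hmN x hm hx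
    have hMN : Real.log (Real.log n) * Real.log n ^ (a - 1) =
        Real.log (Real.log n) / Real.log n ^ (1 - a) := by
      rw [show a - 1 = -(1 - a) by ring, Real.rpow_neg (by linarith)]
      rfl
    have b3 : |Real.exp (c * p ^ x - lam p n r) - 1| ≤
        2 * K₂ * (Real.log (Real.log n) / Real.log n ^ (1 - a)) := by
      rw [abs_sub_comm] at b2
      refine (Real.abs_exp_sub_one_le (b2.trans h4)).trans ?_
      rw [← hMN]
      linarith
    have b4 : Real.exp (c * p ^ x) * (Real.log n ^ 4 / n) ≤
        Real.log (Real.log n) / Real.log n ^ (1 - a) := by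
      rw [← mul_div_assoc, div_le_div_iff₀ hn0 (Real.rpow_pos_of_pos (by linarith) _)]
      have e1 : Real.log n ^ 4 * Real.log n ^ (1 - a) =
          Real.exp ((5 - a) * Real.log (Real.log n)) := by
        rw [← Real.rpow_natCast, ← Real.rpow_add (by linarith),
          Real.rpow_def_of_pos (by linarith)]
        congr 1
        push_cast
        ring
      calc Real.exp (c * p ^ x) * Real.log n ^ 4 * Real.log n ^ (1 - a) =
            Real.exp (c * p ^ x) * (Real.log n ^ 4 * Real.log n ^ (1 - a)) := by ring
        _ ≤ Real.exp (c * Real.log n ^ a) * Real.exp ((5 - a) * Real.log (Real.log n)) := by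
            rw [e1]
            gcongr
        _ = Real.exp (c * Real.log n ^ a + (5 - a) * Real.log (Real.log n)) :=
            (Real.exp_add _ _).symm
        _ ≤ Real.exp (Real.log n) := Real.exp_le_exp.2 h5
        _ = n := Real.exp_log hn0
        _ ≤ _ := by nlinarith
    have e1 : Real.exp (c * p ^ x) * μ.real {ω | U ξ n ω < r} - 1 =
        Real.exp (c * p ^ x) * (μ.real {ω | U ξ n ω < r} - Real.exp (-lam p n r)) +
          (Real.exp (c * p ^ x - lam p n r) - 1) := by
      rw [mul_sub, ← Real.exp_add]
      ring_nf
    rw [e1]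
    have b5 : |Real.exp (c * p ^ x) * (μ.real {ω | U ξ n ω < r} - Real.exp (-lam p n r))| ≤
        K₁ * (Real.log (Real.log n) / Real.log n ^ (1 - a)) := by
      rw [abs_mul, abs_of_pos (Real.exp_pos _)]
      calc _ ≤ Real.exp (c * p ^ x) * (K₁ * (Real.log n ^ 4 / n)) := by gcongr
        _ = K₁ * (Real.exp (c * p ^ x) * (Real.log n ^ 4 / n)) := by ring
        _ ≤ _ := by gcongr
    have b6 : 0 ≤ (∑ n ∈ Finset.range n₀, |G n|) *
        (Real.log (Real.log n) / Real.log n ^ (1 - a)) :=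
      mul_nonneg (Finset.sum_nonneg fun _ _ => abs_nonneg _) hrhs.le
    refine (abs_add_le _ _).trans ((add_le_add b5 b3).trans ?_)
    linarith

/-- The bound `exists_poisson_bound` is sharper by the factor log log n, which is at least log log 3
> 0. -/
theorem exists_uniform_bound (p : ℝ) (hp0 : 0 < p) (hp1 : p < 1) :
    ∃ K : ℝ, ∀ (Ω : Type u) [MeasurableSpace Ω] (μ : Measure Ω) [IsProbabilityMeasure μ]
      (ξ : ℕ → Ω → ℝ), IsBernoulliSequence μ p ξ →
      ∀ n : ℕ, 3 ≤ n → ∀ r : ℕ, 1 < r → r ≤ n →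
        |μ.real {ω | U ξ n ω < r} - Real.exp (-lam p n r)|
          ≤ K * (Real.log n ^ 4 * Real.log (Real.log n) / n) := by
  obtain ⟨K, hK0, hK⟩ := exists_poisson_bound.{u} p hp0 hp1
  have h3 := log_log_pos (le_refl 3)
  refine ⟨K / Real.log (Real.log (3 : ℕ)), fun Ω _ μ _ ξ hξ n hn r hr _ =>
    (hK Ω μ ξ hξ n hn r hr).trans ?_⟩
  have hN1 := one_le_log_of_three_le (le_refl 3)
  have hN2 := one_le_log_of_three_le hn
  have hmono : Real.log (Real.log (3 : ℕ)) ≤ Real.log (Real.log n) := by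
    gcongr
  calc K * (Real.log n ^ 4 / n) =
        K / Real.log (Real.log (3 : ℕ)) * (Real.log n ^ 4 * Real.log (Real.log (3 : ℕ)) / n) := by
        field_simp
    _ ≤ _ := by gcongr

/-! ### Poisson approximation along powers of two -/

/-- The level `C ln 2^k + y ln k` for the longest progression in `{1, …, 2^k}`. -/
noncomputable def dyadicLevel (p y : ℝ) (k : ℕ) : ℝ :=
  C p * (k * Real.log 2) + y * Real.log k

theorem C_pos {p : ℝ} (hp0 : 0 < p) (hp1 : p < 1) : 0 < C p :=
  div_pos_of_neg_of_neg (by norm_num) (Real.log_neg hp0 hp1)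

theorem D_neg {p : ℝ} (hp0 : 0 < p) (hp1 : p < 1) : D p < 0 :=
  div_neg_of_pos_of_neg one_pos (Real.log_neg hp0 hp1)

theorem tendsto_log_div_natCast :
    Tendsto (fun k : ℕ => Real.log k / k) atTop (𝓝 0) := by
  have := (Real.isLittleO_log_id_atTop).tendsto_div_nhds_zero.comp tendsto_natCast_atTop_atTop
  exact this

theorem eventually_dyadicLevel_ge {p : ℝ} (hp0 : 0 < p) (hp1 : p < 1) (y : ℝ) :
    ∀ᶠ k : ℕ in atTop, C p * Real.log 2 / 2 * k ≤ dyadicLevel p y k := by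
  have hc : 0 < C p * Real.log 2 / 2 := by
    have := C_pos hp0 hp1
    have := Real.log_pos one_lt_two
    positivity
  have h1 : Tendsto (fun k : ℕ => y * (Real.log k / k)) atTop (𝓝 (y * 0)) :=
    tendsto_log_div_natCast.const_mul y
  rw [mul_zero] at h1
  filter_upwards [h1.eventually (eventually_ge_nhds (neg_lt_zero.2 hc)), eventually_gt_atTop 0]
    with k h2 hk
  have hk0 : (0 : ℝ) < k := by exact_mod_cast hk
  have h3 := mul_le_mul_of_nonneg_right h2 hk0.le
  have h4 : y * (Real.log k / k) * k = y * Real.log k := by field_simp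
  rw [h4] at h3
  unfold dyadicLevel
  linarith

theorem rpow_dyadicLevel {p : ℝ} (hp0 : 0 < p) (hp1 : p < 1) (y : ℝ) {k : ℕ} (hk : 0 < k) :
    ((2 ^ k : ℕ) : ℝ) ^ 2 * p ^ dyadicLevel p y k = (k : ℝ) ^ (y * Real.log p) := by
  have hk0 : (0 : ℝ) < k := by exact_mod_cast hk
  have hl := (Real.log_neg hp0 hp1).ne
  have e1 : ((2 ^ k : ℕ) : ℝ) = Real.exp (k * Real.log 2) := by
    rw [mul_comm, Real.exp_mul, Real.exp_log two_pos, Real.rpow_natCast]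
    push_cast
    rfl
  rw [e1, Real.rpow_def_of_pos hp0, Real.rpow_def_of_pos hk0, sq, ← Real.exp_add, ← Real.exp_add]
  congr 1
  unfold dyadicLevel C
  field_simp
  ring

theorem lam_le_div {p : ℝ} (hp0 : 0 ≤ p) (n : ℕ) {r : ℕ} (hr : 2 ≤ r) :
    lam p n r ≤ (n : ℝ) ^ 2 * p ^ r / r := by
  have h2 : (2 : ℝ) ≤ r := by exact_mod_cast hr
  unfold lam
  rw [mul_div_assoc, div_eq_mul_inv ((n : ℝ) ^ 2 * p ^ r)]
  refine mul_le_mul_of_nonneg_left ?_ (by positivity)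
  rw [inv_eq_one_div, div_le_div_iff₀ (by nlinarith) (by linarith)]
  have : p + (1 - p) * r ≤ r := by nlinarith
  nlinarith

/-- The mean at dyadic levels has polynomial order. -/
theorem exists_lam_dyadic_bounds {p : ℝ} (hp0 : 0 < p) (hp1 : p < 1) (y : ℝ) :
    ∃ c₁ c₂ : ℝ, 0 < c₁ ∧ 0 < c₂ ∧ ∀ᶠ k : ℕ in atTop, 2 ≤ ⌈dyadicLevel p y k⌉₊ ∧
      c₁ * (k : ℝ) ^ (y * Real.log p - 1) ≤ lam p (2 ^ k) ⌈dyadicLevel p y k⌉₊ ∧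
      lam p (2 ^ k) ⌈dyadicLevel p y k⌉₊ ≤ c₂ * (k : ℝ) ^ (y * Real.log p - 1) := by
  have hC := C_pos hp0 hp1
  have hl2 := Real.log_pos one_lt_two
  have hq : 0 < 1 - p := by linarith
  set c := C p * Real.log 2 / 2 with hc
  have hc0 : 0 < c := by positivity
  set e := C p * Real.log 2 + |y| + 1 with he
  have he0 : 0 < e := by positivity
  refine ⟨p * (1 - p) / (2 * e), 1 / c, by positivity, by positivity, ?_⟩
  have hlarge : ∀ᶠ k : ℕ in atTop, 2 ≤ c * k :=
    (tendsto_natCast_atTop_atTop.const_mul_atTop hc0).eventually_ge_atTop 2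
  filter_upwards [eventually_dyadicLevel_ge hp0 hp1 y, hlarge, eventually_gt_atTop 0]
    with k h1 h2 hk
  have hk0 : (0 : ℝ) < k := by exact_mod_cast hk
  have hk1 : (1 : ℝ) ≤ k := by exact_mod_cast hk
  rw [← hc] at h1
  set t := dyadicLevel p y k with ht
  have hpow := rpow_dyadicLevel hp0 hp1 y hk
  rw [← ht] at hpow
  have ht0 : 2 ≤ t := by linarith
  have hr1 : t ≤ (⌈t⌉₊ : ℝ) := Nat.le_ceil t
  have hr2 : (⌈t⌉₊ : ℝ) < t + 1 := Nat.ceil_lt_add_one (by linarith)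
  set r := ⌈t⌉₊ with hr
  have hr0 : 2 ≤ r := by exact_mod_cast ht0.trans hr1
  have hrpos : (0 : ℝ) < r := by positivity
  have hp2 : p ^ r ≤ p ^ t := by
    rw [← Real.rpow_natCast]
    exact Real.rpow_le_rpow_of_exponent_ge hp0 hp1.le hr1
  -- Rounding the level up to an integer costs at most a factor p.
  have hp3 : p ^ t * p ≤ p ^ r := by
    rw [← Real.rpow_natCast, ← Real.rpow_add_one hp0.ne']
    exact Real.rpow_le_rpow_of_exponent_ge hp0 hp1.le hr2.le
  have hre : (r : ℝ) ≤ e * k := by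
    have hlog : Real.log k ≤ k := by
      have := Real.log_le_sub_one_of_pos hk0
      linarith
    have hlog0 : 0 ≤ Real.log k := Real.log_nonneg hk1
    have : y * Real.log k ≤ |y| * k := by
      calc y * Real.log k ≤ |y| * Real.log k := by gcongr; exact le_abs_self y
        _ ≤ |y| * k := by gcongr
    have e1 : t = C p * (k * Real.log 2) + y * Real.log k := rfl
    rw [he]
    nlinarith
  have hkpow : (k : ℝ) ^ (y * Real.log p - 1) = (k : ℝ) ^ (y * Real.log p) / k :=
    Real.rpow_sub_one hk0.ne' _
  have hkp : 0 < (k : ℝ) ^ (y * Real.log p) := Real.rpow_pos_of_pos hk0 _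
  refine ⟨hr0, ?_, ?_⟩
  · refine le_trans ?_ (le_lam hp0.le (2 ^ k) hr0)
    rw [hkpow, ← hpow]
    calc p * (1 - p) / (2 * e) * (((2 ^ k : ℕ) : ℝ) ^ 2 * p ^ t / k) =
          ((2 ^ k : ℕ) : ℝ) ^ 2 * (p ^ t * p) * (1 - p) / (2 * (e * k)) := by
          field_simp
      _ ≤ ((2 ^ k : ℕ) : ℝ) ^ 2 * p ^ r * (1 - p) / (2 * r) := by gcongr
  · refine (lam_le_div hp0.le (2 ^ k) hr0).trans ?_
    rw [hkpow, ← hpow]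
    calc ((2 ^ k : ℕ) : ℝ) ^ 2 * p ^ r / r ≤ ((2 ^ k : ℕ) : ℝ) ^ 2 * p ^ t / (c * k) := by
          gcongr
          linarith
      _ = _ := by field_simp

/-- The order of the error of the Poisson approximation for `n = 2^k`. -/
noncomputable def dyadicError (k : ℕ) : ℝ := (k : ℝ) ^ 4 * (1 / 2) ^ k

theorem summable_dyadicError : Summable dyadicError :=
  summable_pow_mul_geometric_of_norm_lt_one 4 (by norm_num)

theorem setOf_U_lt_dyadicLevel {Ω : Type*} (p y : ℝ) (ξ : ℕ → Ω → ℝ) (n k : ℕ) :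
    {ω | U ξ n ω < ⌈dyadicLevel p y k⌉₊} = {ω | (U ξ n ω : ℝ) < dyadicLevel p y k} := by
  ext ω
  exact Nat.lt_ceil

/-- Poisson approximation at dyadic levels. -/
theorem exists_dyadic_bounds (p : ℝ) (hp0 : 0 < p) (hp1 : p < 1) (y : ℝ) :
    ∃ K c₁ c₂ : ℝ, 0 < K ∧ 0 < c₁ ∧ 0 < c₂ ∧ ∀ᶠ k : ℕ in atTop,
      ∀ (Ω : Type u) [MeasurableSpace Ω] (μ : Measure Ω) [IsProbabilityMeasure μ]
      (ξ : ℕ → Ω → ℝ), IsBernoulliSequence μ p ξ →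
      ∃ t : ℝ, c₁ * (k : ℝ) ^ (y * Real.log p - 1) ≤ t ∧
        t ≤ c₂ * (k : ℝ) ^ (y * Real.log p - 1) ∧
        |μ.real {ω | (U ξ (2 ^ k) ω : ℝ) < dyadicLevel p y k} - Real.exp (-t)| ≤
          K * dyadicError k := by
  obtain ⟨K, hK0, hK⟩ := exists_poisson_bound.{u} p hp0 hp1
  obtain ⟨c₁, c₂, h1, h2, hev⟩ := exists_lam_dyadic_bounds hp0 hp1 y
  refine ⟨K + 1, c₁, c₂, by linarith, h1, h2, ?_⟩
  filter_upwards [hev, eventually_ge_atTop 2] with k hk hk2 Ω _ μ _ ξ hξ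
  refine ⟨_, hk.2.1, hk.2.2, ?_⟩
  rw [← setOf_U_lt_dyadicLevel]
  have h3 : 3 ≤ 2 ^ k := by
    calc 3 ≤ 2 ^ 2 := by norm_num
      _ ≤ 2 ^ k := Nat.pow_le_pow_right (by norm_num) hk2
  refine (hK Ω μ ξ hξ (2 ^ k) h3 _ hk.1).trans ?_
  have hlog : Real.log ((2 ^ k : ℕ) : ℝ) ≤ k := by
    push_cast
    rw [Real.log_pow]
    have : Real.log 2 ≤ 1 := by linarith [Real.log_two_lt_d9]
    nlinarith [(Nat.cast_nonneg k : (0 : ℝ) ≤ k)]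
  have h4 : Real.log ((2 ^ k : ℕ) : ℝ) ^ 4 / ((2 ^ k : ℕ) : ℝ) ≤ dyadicError k := by
    have h0 : 0 ≤ Real.log ((2 ^ k : ℕ) : ℝ) := Real.log_natCast_nonneg _
    unfold dyadicError
    rw [one_div, inv_pow, ← div_eq_mul_inv]
    push_cast at *
    gcongr
  have h5 : 0 ≤ dyadicError k := by unfold dyadicError; positivity
  nlinarith

/-! ### Borel-Cantelli arguments along powers of two -/

/-- Since x^(2/θ) e^(-cx) tends to 0, putting x = k^θ bounds the terms by k^(-2). -/
theorem summable_exp_neg_mul_rpow {c θ : ℝ} (hc : 0 < c) (hθ : 0 < θ) :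
    Summable fun k : ℕ => Real.exp (-(c * (k : ℝ) ^ θ)) := by
  have h1 : Tendsto (fun x : ℝ => x ^ (2 / θ) * Real.exp (-c * x)) atTop (𝓝 0) :=
    tendsto_rpow_mul_exp_neg_mul_atTop_nhds_zero (2 / θ) c hc
  have h2 := h1.comp ((tendsto_rpow_atTop hθ).comp tendsto_natCast_atTop_atTop)
  have h3 : Summable fun k : ℕ => (k : ℝ) ^ (-2 : ℝ) :=
    Real.summable_nat_rpow.2 (by norm_num)
  refine Summable.of_norm_bounded_eventually_nat h3 ?_
  filter_upwards [h2.eventually (eventually_le_nhds one_pos), eventually_gt_atTop 0] with k hk hk0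
  have hk1 : (0 : ℝ) < k := by exact_mod_cast hk0
  simp only [Function.comp] at hk
  rw [← Real.rpow_mul hk1.le, mul_div_cancel₀ _ hθ.ne'] at hk
  rw [Real.norm_of_nonneg (Real.exp_pos _).le, Real.rpow_neg hk1.le, ← one_div,
    le_div_iff₀ (Real.rpow_pos_of_pos hk1 _), mul_comm, ← neg_mul]
  exact hk

theorem ae_eventually_notMem_of_summable {Ω : Type*} [MeasurableSpace Ω] {μ : Measure Ω}
    [IsFiniteMeasure μ] {s : ℕ → Set Ω} {f : ℕ → ℝ} (hf : Summable f)
    (h : ∀ᶠ k in atTop, μ.real (s k) ≤ f k) : ∀ᵐ ω ∂μ, ∀ᶠ k in atTop, ω ∉ s k := by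
  have hs : Summable fun k => μ.real (s k) := by
    refine Summable.of_norm_bounded_eventually_nat hf ?_
    filter_upwards [h] with k hk
    rwa [Real.norm_of_nonneg measureReal_nonneg]
  refine ae_eventually_notMem ?_
  have e : ∀ k, ENNReal.ofReal (μ.real (s k)) = μ (s k) := fun k => ofReal_measureReal
  simpa only [e] using hs.tsum_ofReal_ne_top

/-- A shifted Bernoulli sequence is a Bernoulli sequence. -/
theorem IsBernoulliSequence.shift {Ω : Type*} [MeasurableSpace Ω] {μ : Measure Ω} {p : ℝ}
    {ξ : ℕ → Ω → ℝ} (hξ : IsBernoulliSequence μ p ξ) (m : ℕ) :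
    IsBernoulliSequence μ p fun i => ξ (m + i) where
  measurable i hi := hξ.measurable (m + i) (by omega)
  indep := hξ.indep.precomp (g := fun i : {i : ℕ // 1 ≤ i} => (⟨m + i, by have := i.2; omega⟩ :
    {i : ℕ // 1 ≤ i})) fun i j hij => by
      simp only [Subtype.mk.injEq] at hij
      exact Subtype.ext (by omega)
  prob_one i hi := hξ.prob_one (m + i) (by omega)
  prob_zero i hi := hξ.prob_zero (m + i) (by omega)

section

variable {Ω : Type u} [MeasurableSpace Ω] {μ : Measure Ω} [IsProbabilityMeasure μ] {p : ℝ}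
  {ξ : ℕ → Ω → ℝ}

theorem IsBernoulliSequence.eventually_measureReal_le (hξ : IsBernoulliSequence μ p ξ)
    (hp0 : 0 < p) (hp1 : p < 1) (y : ℝ) :
    ∃ K c : ℝ, 0 < K ∧ 0 < c ∧ ∀ᶠ k : ℕ in atTop,
      μ.real {ω | dyadicLevel p y k ≤ (U ξ (2 ^ k) ω : ℝ)} ≤
        c * (k : ℝ) ^ (y * Real.log p - 1) + K * dyadicError k := by
  obtain ⟨K, c₁, c₂, hK, -, h2, hev⟩ := exists_dyadic_bounds.{u} p hp0 hp1 y
  obtain ⟨_, _, -, -, hev'⟩ := exists_lam_dyadic_bounds hp0 hp1 y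
  refine ⟨K, c₂, hK, h2, ?_⟩
  filter_upwards [hev, hev'] with k hk hk'
  obtain ⟨t, -, ht2, ht⟩ := hk Ω μ ξ hξ
  have hm := hξ.measurableSet_U_lt (2 ^ k) hk'.1
  rw [setOf_U_lt_dyadicLevel] at hm
  have hcompl : {ω | dyadicLevel p y k ≤ (U ξ (2 ^ k) ω : ℝ)} =
      {ω | (U ξ (2 ^ k) ω : ℝ) < dyadicLevel p y k}ᶜ := by
    ext ω
    simp
  rw [hcompl, probReal_compl_eq_one_sub hm]
  have h3 := Real.add_one_le_exp (-t)
  have h4 := (abs_le.1 ht).1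
  linarith

/-- For y < D = 1 / log p the exponent y log p - 1 is positive, so exp(-λ) is summable. -/
theorem IsBernoulliSequence.exists_summable_bound (hξ : IsBernoulliSequence μ p ξ)
    (hp0 : 0 < p) (hp1 : p < 1) {y : ℝ} (hy : y < D p) :
    ∃ f : ℕ → ℝ, Summable f ∧ ∀ᶠ k : ℕ in atTop,
      μ.real {ω | (U ξ (2 ^ k) ω : ℝ) < dyadicLevel p y k} ≤ f k := by
  obtain ⟨K, c₁, c₂, hK, h1, -, hev⟩ := exists_dyadic_bounds.{u} p hp0 hp1 y
  have hl := Real.log_neg hp0 hp1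
  have hθ : 0 < y * Real.log p - 1 := by
    have : D p * Real.log p < y * Real.log p := mul_lt_mul_of_neg_right hy hl
    unfold D at this
    rw [one_div_mul_cancel hl.ne] at this
    linarith
  refine ⟨_, (summable_exp_neg_mul_rpow h1 hθ).add (summable_dyadicError.mul_left K), ?_⟩
  filter_upwards [hev] with k hk
  obtain ⟨t, ht1, -, ht⟩ := hk Ω μ ξ hξ
  have h3 : Real.exp (-t) ≤ Real.exp (-(c₁ * (k : ℝ) ^ (y * Real.log p - 1))) :=
    Real.exp_le_exp.2 (by linarith)
  have h4 := (abs_le.1 ht).2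
  linarith

theorem IsBernoulliSequence.ae_eventually_dyadicLevel_le (hξ : IsBernoulliSequence μ p ξ)
    (hp0 : 0 < p) (hp1 : p < 1) {y : ℝ} (hy : y < D p) :
    ∀ᵐ ω ∂μ, ∀ᶠ k : ℕ in atTop, dyadicLevel p y k ≤ (U ξ (2 ^ k) ω : ℝ) := by
  obtain ⟨f, hf, hev⟩ := hξ.exists_summable_bound hp0 hp1 hy
  filter_upwards [ae_eventually_notMem_of_summable hf hev] with ω hω
  filter_upwards [hω] with k hk
  exact not_lt.1 hk

/-- For y > 0 the exponent y log p - 1 is below -1, so the exceedance probabilities are summable. -/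
theorem IsBernoulliSequence.ae_eventually_lt_dyadicLevel (hξ : IsBernoulliSequence μ p ξ)
    (hp0 : 0 < p) (hp1 : p < 1) {y : ℝ} (hy : 0 < y) :
    ∀ᵐ ω ∂μ, ∀ᶠ k : ℕ in atTop, (U ξ (2 ^ k) ω : ℝ) < dyadicLevel p y k := by
  obtain ⟨K, c, hK, hc, hev⟩ := hξ.eventually_measureReal_le hp0 hp1 y
  have hl := Real.log_neg hp0 hp1
  have hs : Summable fun k : ℕ => c * (k : ℝ) ^ (y * Real.log p - 1) + K * dyadicError k := by
    refine Summable.add (Summable.mul_left _ (Real.summable_nat_rpow.2 ?_))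
      (summable_dyadicError.mul_left K)
    nlinarith
  filter_upwards [ae_eventually_notMem_of_summable hs hev] with ω hω
  filter_upwards [hω] with k hk
  exact not_le.1 hk

/-- The exceedances of a level above the typical one are logarithmically summable. -/
theorem IsBernoulliSequence.ae_summable_exceedance (hξ : IsBernoulliSequence μ p ξ)
    (hp0 : 0 < p) (hp1 : p < 1) {y : ℝ} (hy : D p < y) :
    ∀ᵐ ω ∂μ, Summable fun k : ℕ =>
      (if dyadicLevel p y k ≤ (U ξ (2 ^ k) ω : ℝ) then (1 : ℝ) else 0) / k := by
  obtain ⟨K, c, hK, hc, hev⟩ := hξ.eventually_measureReal_le hp0 hp1 y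
  obtain ⟨_, _, -, -, hev'⟩ := exists_lam_dyadic_bounds hp0 hp1 y
  obtain ⟨k₀, hk₀⟩ := eventually_atTop.1 (hev.and (hev'.and (eventually_gt_atTop 0)))
  have hl := Real.log_neg hp0 hp1
  have hθ : y * Real.log p - 1 < 0 := by
    have : y * Real.log p < D p * Real.log p := mul_lt_mul_of_neg_right hy hl
    unfold D at this
    rw [one_div_mul_cancel hl.ne] at this
    linarith
  set s : ℕ → Set Ω := fun k => {ω | dyadicLevel p y k ≤ (U ξ (2 ^ k) ω : ℝ)} with hs
  have hsm : ∀ k, k₀ ≤ k → MeasurableSet (s k) := by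
    intro k hk
    have hm := hξ.measurableSet_U_lt (2 ^ k) (hk₀ k hk).2.1.1
    rw [setOf_U_lt_dyadicLevel] at hm
    have hcompl : s k = {ω | (U ξ (2 ^ k) ω : ℝ) < dyadicLevel p y k}ᶜ := by
      ext ω
      simp [hs]
    rw [hcompl]
    exact hm.compl
  -- The exponent is merely negative, so the probabilities need not be summable; the weight 1/k
  -- brings it below -1. Finite expectation of the weighted sum then gives almost sure finiteness.
  have hsum : Summable fun k => μ.real (s (k + k₀)) / ((k + k₀ : ℕ) : ℝ) := by
    have h1 : Summable fun k : ℕ =>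
        c * (k : ℝ) ^ (y * Real.log p - 1 - 1) + K * dyadicError k :=
      Summable.add (Summable.mul_left _ (Real.summable_nat_rpow.2 (by linarith)))
        (summable_dyadicError.mul_left K)
    refine Summable.of_nonneg_of_le (fun k => by positivity) (fun k => ?_)
      ((summable_nat_add_iff k₀).2 h1)
    obtain ⟨h2, -, h3⟩ := hk₀ (k + k₀) (by omega)
    have h4 : (1 : ℝ) ≤ ((k + k₀ : ℕ) : ℝ) := by exact_mod_cast h3
    have h5 : 0 ≤ dyadicError (k + k₀) := by unfold dyadicError; positivity
    rw [Real.rpow_sub_one (by linarith)]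
    calc μ.real (s (k + k₀)) / ((k + k₀ : ℕ) : ℝ) ≤
          (c * ((k + k₀ : ℕ) : ℝ) ^ (y * Real.log p - 1) + K * dyadicError (k + k₀)) /
            ((k + k₀ : ℕ) : ℝ) := by gcongr
      _ = c * (((k + k₀ : ℕ) : ℝ) ^ (y * Real.log p - 1) / ((k + k₀ : ℕ) : ℝ)) +
          K * dyadicError (k + k₀) / ((k + k₀ : ℕ) : ℝ) := by ring
      _ ≤ _ := by
          gcongr
          exact div_le_self (by positivity) h4
  set F : ℕ → Ω → ENNReal := fun k =>
    (s (k + k₀)).indicator fun _ => ENNReal.ofReal (1 / ((k + k₀ : ℕ) : ℝ)) with hF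
  have hFm : ∀ k, Measurable (F k) := fun k =>
    measurable_const.indicator (hsm (k + k₀) (by omega))
  have hint : ∫⁻ ω, ∑' k, F k ω ∂μ ≠ ⊤ := by
    rw [lintegral_tsum fun k => (hFm k).aemeasurable]
    have : ∀ k, ∫⁻ ω, F k ω ∂μ = ENNReal.ofReal (μ.real (s (k + k₀)) / ((k + k₀ : ℕ) : ℝ)) := by
      intro k
      rw [hF, lintegral_indicator_const (hsm (k + k₀) (by omega)), ← ofReal_measureReal (measure_ne_top μ _),
        ← ENNReal.ofReal_mul (by positivity)]
      congr 1
      ring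
    simp only [this]
    exact hsum.tsum_ofReal_ne_top
  filter_upwards [ae_lt_top (Measurable.tsum hFm) hint] with ω hω
  rw [← summable_nat_add_iff k₀]
  have h1 := ENNReal.summable_toReal hω.ne
  refine h1.congr fun k => ?_
  simp only [hF, Set.indicator_apply, hs, Set.mem_ofPred_eq]
  split_ifs with h
  · rw [ENNReal.toReal_ofReal (by positivity)]
  · simp

end

/-- Events that depend on disjoint blocks of an independent family are independent. -/
theorem iIndepSet_of_pairwise_disjoint {Ω ι κ : Type*} [MeasurableSpace Ω] {μ : Measure Ω}
    {m : κ → MeasurableSpace Ω} (hm : ∀ k, m k ≤ ‹MeasurableSpace Ω›) (hind : iIndep m μ)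
    {E : ι → Set Ω} {A : ι → Set κ} (hE : ∀ i, MeasurableSet[⨆ k ∈ A i, m k] (E i))
    (hA : Pairwise fun i j => Disjoint (A i) (A j)) : iIndepSet E μ := by
  classical
  have := hind.isProbabilityMeasure
  have hEm : ∀ i, MeasurableSet (E i) := fun i =>
    (iSup₂_le fun k _ => hm k : (⨆ k ∈ A i, m k) ≤ _) _ (hE i)
  rw [iIndepSet_iff_meas_biInter hEm]
  intro s
  induction s using Finset.induction_on with
  | empty => simp
  | insert i s hi ih =>
    rw [Finset.set_biInter_insert, Finset.prod_insert hi, ← ih]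
    have hdis : Disjoint (A i) (⋃ j ∈ s, A j) := by
      rw [Set.disjoint_iUnion₂_right]
      exact fun j hj => hA fun hij => hi (hij ▸ hj)
    have hI := indep_iSup_of_disjoint hm hind hdis
    refine (Indep_iff _ _ _).1 hI _ _ (hE i) (Finset.measurableSet_biInter _ fun j hj => ?_)
    exact (biSup_mono fun k hk => Set.mem_biUnion hj hk :
      (⨆ k ∈ A j, m k) ≤ ⨆ k ∈ ⋃ j ∈ s, A j, m k) _ (hE j)

theorem tendsto_mul_dyadicError : Tendsto (fun k : ℕ => (k : ℝ) * dyadicError k) atTop (𝓝 0) := by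
  have h := (summable_pow_mul_geometric_of_norm_lt_one (R := ℝ) 5
    (r := 1 / 2) (by norm_num)).tendsto_atTop_zero
  refine h.congr fun k => ?_
  unfold dyadicError
  ring

/-- Only variables with index in (m, m + n] are involved, so events of disjoint blocks are
independent. -/
theorem measurableSet_blockEvent {Ω : Type*} (ξ : ℕ → Ω → ℝ) (m n : ℕ) {r : ℕ} (hr : 2 ≤ r) :
    MeasurableSet[⨆ k ∈ {k : {i : ℕ // 1 ≤ i} | m < k ∧ (k : ℕ) ≤ m + n},
      MeasurableSpace.comap (ξ (k : ℕ)) inferInstance]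
      {ω | r ≤ U (fun i => ξ (m + i)) n ω} := by
  obtain ⟨d, rfl⟩ : ∃ d, r = d + 1 := ⟨r - 1, by omega⟩
  have hd : 1 ≤ d := by omega
  have hset : {ω | d + 1 ≤ U (fun i => ξ (m + i)) n ω} =
      ⋃ c ∈ progressions n d, ⋂ j ∈ Finset.range (d + 1), {ω | ξ (m + (c.1 + j * c.2)) ω = 1} := by
    ext ω
    simp only [U, Set.mem_ofPred_eq, Set.mem_iUnion, Set.mem_iInter, Finset.mem_range]
    rw [succ_le_longestAP_iff _ _ hd]
    constructor
    · rintro ⟨a, s, h1, h2, h3, h4⟩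
      exact ⟨(a, s), (mem_progressions hd).2 ⟨h1, h2, h3⟩, h4⟩
    · rintro ⟨⟨a, s⟩, h1, h4⟩
      obtain ⟨h1, h2, h3⟩ := (mem_progressions hd).1 h1
      exact ⟨a, s, h1, h2, h3, h4⟩
  rw [hset]
  refine Finset.measurableSet_biUnion _ fun c hc => Finset.measurableSet_biInter _ fun j hj => ?_
  obtain ⟨h1, h2, h3⟩ := (mem_progressions hd).1 hc
  have hjd : j * c.2 ≤ d * c.2 := Nat.mul_le_mul_right _ (by have := Finset.mem_range.1 hj; omega)
  have hle := le_iSup₂ (f := fun (k : {i : ℕ // 1 ≤ i})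
      (_ : k ∈ {k : {i : ℕ // 1 ≤ i} | m < k ∧ (k : ℕ) ≤ m + n}) =>
    MeasurableSpace.comap (ξ (k : ℕ)) (inferInstance : MeasurableSpace ℝ))
    ⟨m + (c.1 + j * c.2), by omega⟩ ⟨by simp only; omega, by simp only; omega⟩
  exact hle _ ⟨{1}, measurableSet_singleton 1, rfl⟩

theorem half_le_one_sub_exp_neg {u t : ℝ} (hu0 : 0 ≤ u) (hu1 : u ≤ 1) (h : u ≤ t) :
    u / 2 ≤ 1 - Real.exp (-t) := by
  have h1 : Real.exp (-t) ≤ Real.exp (-u) := Real.exp_le_exp.2 (by linarith)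
  have h2 := Real.add_one_le_exp u
  have h3 : Real.exp (-u) * Real.exp u = 1 := by rw [← Real.exp_add]; simp
  have h4 := Real.exp_pos (-u)
  nlinarith

/-- Levels slightly below `C ln n` are exceeded infinitely often. -/
theorem IsBernoulliSequence.ae_frequently_dyadicLevel_le {Ω : Type u} [MeasurableSpace Ω]
    {μ : Measure Ω} [IsProbabilityMeasure μ] {p : ℝ} {ξ : ℕ → Ω → ℝ}
    (hξ : IsBernoulliSequence μ p ξ) (hp0 : 0 < p) (hp1 : p < 1) {y : ℝ} (hy : y < 0) :
    ∀ᵐ ω ∂μ, ∃ᶠ k : ℕ in atTop, dyadicLevel p y k ≤ (U ξ (2 ^ (k + 1)) ω : ℝ) := by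
  obtain ⟨K, c₁, c₂, hK, hc1, -, hev⟩ := exists_dyadic_bounds.{u} p hp0 hp1 y
  obtain ⟨_, _, -, -, hev'⟩ := exists_lam_dyadic_bounds hp0 hp1 y
  have hl := Real.log_neg hp0 hp1
  have hK0 : Tendsto (fun k : ℕ => K * (k * dyadicError k)) atTop (𝓝 (K * 0)) :=
    tendsto_mul_dyadicError.const_mul K
  rw [mul_zero] at hK0
  have hlarge := (tendsto_natCast_atTop_atTop (R := ℝ)).eventually_ge_atTop c₁
  obtain ⟨k₀, hk₀⟩ := eventually_atTop.1 (hev.and (hev'.and (hlarge.and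
    ((hK0.eventually (eventually_le_nhds (show 0 < c₁ / 4 by positivity))).and
      (eventually_gt_atTop 0)))))
  -- The block (2^k, 2^(k+1)] carries a copy of the first 2^k variables and lies in {1, …, 2^(k+1)};
  -- this explains the exponent k + 1 in the conclusion.
  set s : ℕ → Set Ω := fun k =>
    {ω | ⌈dyadicLevel p y (k + k₀)⌉₊ ≤ U (fun i => ξ (2 ^ (k + k₀) + i)) (2 ^ (k + k₀)) ω} with hs
  have hm : ∀ k : {i : ℕ // 1 ≤ i},
      MeasurableSpace.comap (ξ (k : ℕ)) inferInstance ≤ ‹MeasurableSpace Ω› := fun k =>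
    (hξ.measurable k k.2).comap_le
  have hsm : ∀ k, MeasurableSet[⨆ i ∈ {i : {i : ℕ // 1 ≤ i} |
        2 ^ (k + k₀) < (i : ℕ) ∧ (i : ℕ) ≤ 2 ^ (k + k₀) + 2 ^ (k + k₀)},
      MeasurableSpace.comap (ξ (i : ℕ)) inferInstance] (s k) := fun k =>
    measurableSet_blockEvent ξ _ _ (hk₀ (k + k₀) (by omega)).2.1.1
  have hsm' : ∀ k, MeasurableSet (s k) := fun k => (iSup₂_le fun i _ => hm i) _ (hsm k)
  have hindep : iIndepSet s μ := by
    refine iIndepSet_of_pairwise_disjoint hm ((iIndepFun_iff_iIndep _ _ _).1 hξ.indep) hsm ?_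
    have key : ∀ i j : ℕ, i < j → Disjoint
        {l : {i : ℕ // 1 ≤ i} | 2 ^ (i + k₀) < (l : ℕ) ∧ (l : ℕ) ≤ 2 ^ (i + k₀) + 2 ^ (i + k₀)}
        {l : {i : ℕ // 1 ≤ i} |
          2 ^ (j + k₀) < (l : ℕ) ∧ (l : ℕ) ≤ 2 ^ (j + k₀) + 2 ^ (j + k₀)} := by
      intro i j hij
      rw [Set.disjoint_left]
      rintro l ⟨-, h1⟩ ⟨h2, -⟩
      have : 2 ^ (i + k₀ + 1) ≤ 2 ^ (j + k₀) := Nat.pow_le_pow_right (by norm_num) (by omega)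
      rw [pow_succ] at this
      omega
    intro i j hij
    rcases lt_or_gt_of_ne hij with h | h
    · exact key i j h
    · exact (key j i h).symm
  -- As y < 0, the mean is at least c₁/k. Half of this survives in 1 - exp(-λ), and the
  -- approximation error takes at most a further c₁/(4k).
  have hprob : ∀ k, c₁ / 4 * (1 / ((k + k₀ : ℕ) : ℝ)) ≤ μ.real (s k) := by
    intro k
    obtain ⟨h1, h2, h3, h4, h5⟩ := hk₀ (k + k₀) (by omega)
    obtain ⟨t, ht1, -, ht⟩ := h1 Ω μ _ (hξ.shift (2 ^ (k + k₀)))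
    have hk0 : (0 : ℝ) < ((k + k₀ : ℕ) : ℝ) := by exact_mod_cast h5
    have hcompl : s k =
        {ω | (U (fun i => ξ (2 ^ (k + k₀) + i)) (2 ^ (k + k₀)) ω : ℝ) <
          dyadicLevel p y (k + k₀)}ᶜ := by
      rw [← setOf_U_lt_dyadicLevel]
      ext ω
      simp [hs]
    have hmc := (hsm' k).compl
    rw [hcompl, compl_compl] at hmc
    rw [hcompl, probReal_compl_eq_one_sub hmc]
    have h6 : c₁ * (1 / ((k + k₀ : ℕ) : ℝ)) ≤ t := by
      refine le_trans ?_ ht1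
      gcongr
      rw [one_div, ← Real.rpow_neg_one]
      refine Real.rpow_le_rpow_of_exponent_le (by exact_mod_cast h5) ?_
      nlinarith
    have h7 : c₁ * (1 / ((k + k₀ : ℕ) : ℝ)) ≤ 1 := by
      rw [mul_one_div, div_le_one hk0]
      exact h3
    have h8 := half_le_one_sub_exp_neg (by positivity) h7 h6
    have h9 : K * dyadicError (k + k₀) ≤ c₁ / 4 * (1 / ((k + k₀ : ℕ) : ℝ)) := by
      rw [mul_one_div, le_div_iff₀ hk0]
      linarith
    have h10 := (abs_le.1 ht).2
    linarith
  have hsum : ∑' k, μ (s k) = ⊤ := by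
    by_contra hne
    have h1 := ENNReal.summable_toReal hne
    have h2 : Summable fun k : ℕ => c₁ / 4 * (1 / ((k + k₀ : ℕ) : ℝ)) :=
      Summable.of_nonneg_of_le (fun k => by positivity) hprob h1
    have h3 := (summable_mul_left_iff (by positivity : c₁ / 4 ≠ 0)).1 h2
    exact Real.not_summable_one_div_natCast
      ((summable_nat_add_iff (f := fun k : ℕ => 1 / (k : ℝ)) k₀).1 h3)
  have hone := measure_limsup_eq_one hsm' hindep hsum
  have hae := (mem_ae_iff_prob_eq_one (MeasurableSet.measurableSet_limsup hsm')).2 hone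
  filter_upwards [hae] with ω hω
  rw [mem_limsup_iff_frequently_mem] at hω
  rw [frequently_atTop] at hω ⊢
  intro a
  obtain ⟨k, hk, hmem⟩ := hω a
  refine ⟨k + k₀, by omega, ?_⟩
  have h2 := (hk₀ (k + k₀) (by omega)).2.1.1
  have h3 := longestAP_shift_le (fun i => ξ i ω) _ _ h2 hmem
  rw [← two_mul, ← pow_succ'] at h3
  exact Nat.ceil_le.1 h3

/-! ### From powers of two to all n -/

/-- The limit behaviour of a sequence along powers of two that determines the almost sure limits of
the longest progression. -/
structure DyadicRegular (p : ℝ) (u : ℕ → ℕ) : Prop where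
  mono : Monotone u
  eventually_ge : ∀ y, y < D p → ∀ᶠ k : ℕ in atTop, dyadicLevel p y k ≤ (u (2 ^ k) : ℝ)
  eventually_lt : ∀ y, 0 < y → ∀ᶠ k : ℕ in atTop, (u (2 ^ k) : ℝ) < dyadicLevel p y k
  frequently_ge : ∀ y, y < 0 → ∃ᶠ k : ℕ in atTop, dyadicLevel p y k ≤ (u (2 ^ (k + 1)) : ℝ)
  summable : ∀ y, D p < y → Summable fun k : ℕ =>
    (if dyadicLevel p y k ≤ (u (2 ^ k) : ℝ) then (1 : ℝ) else 0) / k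

theorem dyadicLevel_mono (p : ℝ) (k : ℕ) : Monotone fun y => dyadicLevel p y k := by
  intro y y' h
  have := mul_le_mul_of_nonneg_right h (Real.log_natCast_nonneg k)
  simp only [dyadicLevel]
  linarith

/-- Levels are monotone in y, so the values of y at distance 1/(j + 1) from D and from 0 suffice;
countably many null sets are discarded. -/
theorem IsBernoulliSequence.ae_dyadicRegular {Ω : Type u} [MeasurableSpace Ω]
    {μ : Measure Ω} [IsProbabilityMeasure μ] {p : ℝ} {ξ : ℕ → Ω → ℝ}
    (hξ : IsBernoulliSequence μ p ξ) (hp0 : 0 < p) (hp1 : p < 1) :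
    ∀ᵐ ω ∂μ, DyadicRegular p fun n => U ξ n ω := by
  have h1 := ae_all_iff.2 fun j : ℕ => hξ.ae_eventually_dyadicLevel_le hp0 hp1
    (y := D p - 1 / ((j : ℝ) + 1)) (sub_lt_self _ Nat.one_div_pos_of_nat)
  have h2 := ae_all_iff.2 fun j : ℕ => hξ.ae_eventually_lt_dyadicLevel hp0 hp1
    (y := 1 / ((j : ℝ) + 1)) Nat.one_div_pos_of_nat
  have h3 := ae_all_iff.2 fun j : ℕ => hξ.ae_frequently_dyadicLevel_le hp0 hp1
    (y := -(1 / ((j : ℝ) + 1))) (neg_lt_zero.2 Nat.one_div_pos_of_nat)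
  have h4 := ae_all_iff.2 fun j : ℕ => hξ.ae_summable_exceedance hp0 hp1
    (y := D p + 1 / ((j : ℝ) + 1)) (lt_add_of_pos_right _ Nat.one_div_pos_of_nat)
  filter_upwards [h1, h2, h3, h4] with ω h1 h2 h3 h4
  refine ⟨fun m n hmn => longestAP_mono _ hmn, fun y hy => ?_, fun y hy => ?_, fun y hy => ?_,
    fun y hy => ?_⟩
  · obtain ⟨j, hj⟩ := exists_nat_one_div_lt (sub_pos.2 hy)
    filter_upwards [h1 j] with k hk
    exact (dyadicLevel_mono p k (by linarith : y ≤ D p - 1 / ((j : ℝ) + 1))).trans hk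
  · obtain ⟨j, hj⟩ := exists_nat_one_div_lt hy
    filter_upwards [h2 j] with k hk
    exact hk.trans_le (dyadicLevel_mono p k hj.le)
  · obtain ⟨j, hj⟩ := exists_nat_one_div_lt (neg_pos.2 hy)
    refine (h3 j).mono fun k hk => le_trans ?_ hk
    exact dyadicLevel_mono p k (by linarith : y ≤ -(1 / ((j : ℝ) + 1)))
  · obtain ⟨j, hj⟩ := exists_nat_one_div_lt (sub_pos.2 hy)
    refine Summable.of_nonneg_of_le (fun k => ?_) (fun k => ?_) (h4 j)
    · split_ifs <;> positivity
    · have := dyadicLevel_mono p k (by linarith : D p + 1 / ((j : ℝ) + 1) ≤ y)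
      gcongr
      split_ifs with h5 h6 h6
      · exact le_rfl
      · exact absurd (this.trans h5) h6
      · exact zero_le_one
      · exact le_rfl

theorem log_two_pow_bounds {n : ℕ} (hn : 1 ≤ n) :
    (Nat.log 2 n : ℝ) * Real.log 2 ≤ Real.log n ∧
      Real.log n ≤ ((Nat.log 2 n : ℝ) + 1) * Real.log 2 := by
  have hn0 : (0 : ℝ) < n := by exact_mod_cast hn
  constructor
  · rw [← Real.log_pow]
    refine Real.log_le_log (by positivity) ?_
    exact_mod_cast Nat.pow_log_le_self 2 (by omega)
  · have h : ((Nat.log 2 n : ℝ) + 1) * Real.log 2 = Real.log (2 ^ (Nat.log 2 n + 1)) := by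
      rw [Real.log_pow]
      push_cast
      ring
    rw [h]
    refine Real.log_le_log hn0 ?_
    exact_mod_cast (Nat.lt_pow_succ_log_self (by norm_num) n).le

/-- With k the binary logarithm of n, log n lies between k log 2 and 2 k log 2, so log n and k agree
up to a factor e. -/
theorem abs_log_log_sub_le {n : ℕ} (hn : 2 ≤ n) :
    |Real.log (Real.log n) - Real.log (Nat.log 2 n)| ≤ 1 ∧
      |Real.log (Real.log n) - Real.log ((Nat.log 2 n + 1 : ℕ) : ℝ)| ≤ 2 := by
  obtain ⟨h1, h2⟩ := log_two_pow_bounds (n := n) (by omega)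
  have hk : 1 ≤ Nat.log 2 n := Nat.log_pos (by norm_num) hn
  set k := Nat.log 2 n with hkdef
  have hk1 : (1 : ℝ) ≤ k := by exact_mod_cast hk
  have hk0 : (0 : ℝ) < k := by linarith
  have hl2 := Real.log_two_gt_d9
  have hl2' := Real.log_two_lt_d9
  have he := Real.exp_one_gt_d9
  have hN : 0 < Real.log n := lt_of_lt_of_le (by positivity) h1
  have e1 : Real.log (Real.log n) ≤ Real.log k + 1 := by
    rw [Real.log_le_iff_le_exp hN, Real.exp_add, Real.exp_log hk0]
    nlinarith
  have e2 : Real.log k ≤ Real.log (Real.log n) + 1 := by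
    rw [Real.log_le_iff_le_exp hk0, Real.exp_add, Real.exp_log hN]
    nlinarith
  have e3 : Real.log k ≤ Real.log ((k + 1 : ℕ) : ℝ) := by
    refine Real.log_le_log hk0 ?_
    push_cast
    linarith
  have e4 : Real.log ((k + 1 : ℕ) : ℝ) ≤ Real.log k + 1 := by
    rw [Real.log_le_iff_le_exp (by positivity), Real.exp_add, Real.exp_log hk0]
    push_cast
    nlinarith
  constructor <;> rw [abs_le] <;> constructor <;> linarith

theorem tendsto_log_log_natCast : Tendsto (fun n : ℕ => Real.log (Real.log n)) atTop atTop :=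
  Real.tendsto_log_atTop.comp tendsto_log_natCast

/-- A lower bound at the preceding power of two gives a lower bound for the normalized
sequence. -/
theorem eventually_le_normalized {p : ℝ} (hp0 : 0 < p) (hp1 : p < 1) (y : ℝ) {ε : ℝ}
    (hε : 0 < ε) : ∀ᶠ n : ℕ in atTop, ∀ u : ℕ → ℕ, Monotone u →
      dyadicLevel p y (Nat.log 2 n) ≤ (u (2 ^ Nat.log 2 n) : ℝ) →
      y - ε ≤ ((u n : ℝ) - C p * Real.log n) / Real.log (Real.log n) := by
  have hC := C_pos hp0 hp1
  -- Passing from n to the power of two changes C log n by at most C log 2 and y log log n by at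
  -- most |y|; ε log log n absorbs both.
  have hlarge := (tendsto_log_log_natCast.const_mul_atTop hε).eventually_ge_atTop
    (|y| + C p * Real.log 2)
  filter_upwards [hlarge, eventually_ge_atTop 3] with n h1 hn u hu h
  have hM := log_log_pos hn
  rw [le_div_iff₀ hM]
  have h2 : (u (2 ^ Nat.log 2 n) : ℝ) ≤ u n := by
    exact_mod_cast hu (Nat.pow_log_le_self 2 (by omega))
  have h3 := (abs_log_log_sub_le (n := n) (by omega)).1
  have h4 := (log_two_pow_bounds (n := n) (by omega)).2
  have h5 : y * (Real.log (Real.log n) - Real.log (Nat.log 2 n)) ≤ |y| := by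
    refine (le_abs_self _).trans ?_
    rw [abs_mul]
    exact mul_le_of_le_one_right (abs_nonneg _) h3
  have h6 := mul_le_mul_of_nonneg_left h4 hC.le
  unfold dyadicLevel at h
  linarith

/-- An upper bound at the following power of two gives an upper bound for the normalized
sequence. -/
theorem eventually_normalized_le {p : ℝ} (hp0 : 0 < p) (hp1 : p < 1) (y : ℝ) {ε : ℝ}
    (hε : 0 < ε) : ∀ᶠ n : ℕ in atTop, ∀ u : ℕ → ℕ, Monotone u →
      (u (2 ^ (Nat.log 2 n + 1)) : ℝ) ≤ dyadicLevel p y (Nat.log 2 n + 1) →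
      ((u n : ℝ) - C p * Real.log n) / Real.log (Real.log n) ≤ y + ε := by
  have hC := C_pos hp0 hp1
  have hlarge := (tendsto_log_log_natCast.const_mul_atTop hε).eventually_ge_atTop
    (|y| * 2 + C p * Real.log 2)
  filter_upwards [hlarge, eventually_ge_atTop 3] with n h1 hn u hu h
  have hM := log_log_pos hn
  rw [div_le_iff₀ hM]
  have h2 : (u n : ℝ) ≤ u (2 ^ (Nat.log 2 n + 1)) := by
    exact_mod_cast hu (Nat.lt_pow_succ_log_self (by norm_num) n).le
  have h3 := (abs_log_log_sub_le (n := n) (by omega)).2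
  have h4 := (log_two_pow_bounds (n := n) (by omega)).1
  have h5 : -(|y| * 2) ≤
      y * (Real.log (Real.log n) - Real.log ((Nat.log 2 n + 1 : ℕ) : ℝ)) := by
    refine le_trans (neg_le_neg ?_) (neg_abs_le _)
    rw [abs_mul]
    gcongr
  have h6 := mul_le_mul_of_nonneg_left h4 hC.le
  unfold dyadicLevel at h
  push_cast at h h5
  linarith

theorem tendsto_natLog_atTop : Tendsto (Nat.log 2) atTop atTop := by
  refine tendsto_atTop.2 fun b => ?_
  filter_upwards [eventually_ge_atTop (2 ^ b)] with n hn
  exact Nat.le_log_of_pow_le (by norm_num) hn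

/-! ### Averages along powers of two -/

/-- A simple form of Kronecker's lemma for nonnegative sequences. -/
theorem tendsto_average_of_summable_div {b : ℕ → ℝ} (hb : ∀ k, 0 ≤ b k)
    (hs : Summable fun k : ℕ => b k / k) :
    Tendsto (fun n : ℕ => (∑ k ∈ Finset.Icc 1 n, b k) / n) atTop (𝓝 0) := by
  have key : ∀ n : ℕ, (∑ k ∈ Finset.Icc 1 n, b k) / n =
      ∑' k : ℕ, if k ∈ Finset.Icc 1 n then b k / n else 0 := by
    intro n
    rw [tsum_eq_sum (s := Finset.Icc 1 n) fun k hk => if_neg hk, Finset.sum_div]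
    exact Finset.sum_congr rfl fun k hk => (if_pos hk).symm
  simp only [key]
  have h0 : (0 : ℝ) = ∑' _ : ℕ, (0 : ℝ) := tsum_zero.symm
  conv => rhs; rw [h0]
  -- The terms present have k ≤ n, so b k / n is dominated by the summable b k / k.
  refine tendsto_tsum_of_dominated_convergence hs (fun k => ?_) (Eventually.of_forall fun n k => ?_)
  · have h1 : Tendsto (fun n : ℕ => b k / (n : ℝ)) atTop (𝓝 0) :=
      tendsto_const_div_atTop_nhds_zero_nat _
    refine squeeze_zero (fun n => ?_) (fun n => ?_) h1
    · have := hb k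
      split_ifs
      · exact div_nonneg this (Nat.cast_nonneg _)
      · exact le_rfl
    · have := hb k
      split_ifs
      · exact le_rfl
      · exact div_nonneg this (Nat.cast_nonneg _)
  · have := hb k
    rw [Real.norm_of_nonneg (by
      split_ifs
      · exact div_nonneg this (Nat.cast_nonneg _)
      · exact le_rfl)]
    split_ifs with h
    · obtain ⟨h1, h2⟩ := Finset.mem_Icc.1 h
      have h3 : (0 : ℝ) < k := by exact_mod_cast h1
      gcongr
    · positivity

theorem sum_log_eq_log_factorial (n : ℕ) :
    ∑ k ∈ Finset.Icc 1 n, Real.log k = Real.log n.factorial := by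
  induction n with
  | zero => simp
  | succ n ih =>
    rw [Finset.sum_Icc_succ_top (by omega), ih, Nat.factorial_succ, Nat.cast_mul,
      Real.log_mul (by positivity) (by positivity), add_comm]

/-- The sum is log n!, and n^n / n! ≤ e^n gives the lower bound n log n - n. -/
theorem tendsto_sum_log_div : Tendsto (fun n : ℕ =>
    (∑ k ∈ Finset.Icc 1 n, Real.log k) / (n * Real.log n)) atTop (𝓝 1) := by
  have h1 : Tendsto (fun n : ℕ => 1 - 1 / Real.log n) atTop (𝓝 (1 - 0)) := by
    refine tendsto_const_nhds.sub ?_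
    exact tendsto_log_natCast.const_div_atTop 1
  rw [sub_zero] at h1
  refine tendsto_of_tendsto_of_tendsto_of_le_of_le' h1 tendsto_const_nhds ?_ ?_
  · filter_upwards [eventually_ge_atTop 3] with n hn
    have hN := one_le_log_of_three_le hn
    have hn0 : (0 : ℝ) < n := by positivity
    have hfac := sum_log_eq_log_factorial n
    have h2 := Real.pow_div_factorial_le_exp (n : ℝ) hn0.le n
    have h3 := Real.log_le_log (by positivity) h2
    rw [Real.log_exp, Real.log_div (by positivity) (by positivity), Real.log_pow] at h3
    rw [hfac, le_div_iff₀ (by positivity)]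
    have : (1 - 1 / Real.log n) * (n * Real.log n) = n * Real.log n - n := by
      field_simp
    linarith
  · filter_upwards [eventually_ge_atTop 3] with n hn
    have hN := one_le_log_of_three_le hn
    have hn0 : (0 : ℝ) < n := by positivity
    rw [div_le_one (by positivity)]
    refine (Finset.sum_le_card_nsmul _ _ (Real.log n) fun k hk => ?_).trans ?_
    · obtain ⟨h1, h2⟩ := Finset.mem_Icc.1 hk
      exact Real.log_le_log (by exact_mod_cast h1) (by exact_mod_cast h2)
    · simp

/-- The averaged deviation along powers of two vanishes. -/
theorem DyadicRegular.tendsto_sum_sub {p : ℝ} {u : ℕ → ℕ} (hp0 : 0 < p) (hp1 : p < 1)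
    (hu : DyadicRegular p u) :
    Tendsto (fun n : ℕ => (∑ k ∈ Finset.Icc 1 n,
      ((u (2 ^ k) : ℝ) - C p * (k * Real.log 2) - D p * Real.log k)) / (n * Real.log n))
      atTop (𝓝 0) := by
  have hD := D_neg hp0 hp1
  rw [Metric.tendsto_atTop']
  intro ε hε
  set w : ℕ → ℝ := fun k => (u (2 ^ k) : ℝ) - C p * (k * Real.log 2) - D p * Real.log k with hw
  set b : ℕ → ℝ := fun k =>
    if dyadicLevel p (D p + ε / 4) k ≤ (u (2 ^ k) : ℝ) then (1 : ℝ) else 0 with hb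
  have hb0 : ∀ k, 0 ≤ b k := fun k => by simp only [hb]; split_ifs <;> norm_num
  have hbav := tendsto_average_of_summable_div hb0 (hu.summable (D p + ε / 4) (by linarith))
  obtain ⟨k₀, hk₀⟩ := eventually_atTop.1 ((hu.eventually_ge (D p - ε / 4) (by linarith)).and
    (hu.eventually_lt (ε / 4) (by linarith)))
  -- Without an exceedance of level D + ε/4 the deviation is at most (ε/4) log k. With one, the
  -- level ε/4 still caps it at (ε/4 - D) log k, and such k have density zero.
  have hwk : ∀ k, k₀ ≤ k → |w k| ≤ Real.log k * (ε / 4 + -D p * b k) := by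
    intro k hk
    obtain ⟨h1, h2⟩ := hk₀ k hk
    have hlog := Real.log_natCast_nonneg k
    simp only [hw, hb]
    split_ifs with h3
    · unfold dyadicLevel at h1 h2
      rw [abs_le]
      constructor <;> nlinarith
    · unfold dyadicLevel at h1 h3
      rw [abs_le]
      constructor <;> nlinarith
  set M := ∑ k ∈ Finset.range k₀, |w k| with hM
  have hsum : ∀ n : ℕ, |∑ k ∈ Finset.Icc 1 n, w k| ≤
      M + Real.log n * (n * (ε / 4) + -D p * ∑ k ∈ Finset.Icc 1 n, b k) := by
    intro n
    refine (Finset.abs_sum_le_sum_abs _ _).trans ?_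
    rw [← Finset.sum_filter_add_sum_filter_not _ (fun k => k < k₀)]
    refine add_le_add ?_ ?_
    · refine Finset.sum_le_sum_of_subset_of_nonneg (fun k hk => ?_) fun _ _ _ => abs_nonneg _
      exact Finset.mem_range.2 (Finset.mem_filter.1 hk).2
    · have h1 : ∀ k ∈ Finset.Icc 1 n, 0 ≤ Real.log n * (ε / 4 + -D p * b k) := fun k _ =>
        mul_nonneg (Real.log_natCast_nonneg n) (by have := hb0 k; nlinarith)
      calc _ ≤ ∑ k ∈ (Finset.Icc 1 n).filter (fun k => ¬ k < k₀),
            Real.log n * (ε / 4 + -D p * b k) := by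
            refine Finset.sum_le_sum fun k hk => ?_
            obtain ⟨h2, h3⟩ := Finset.mem_filter.1 hk
            obtain ⟨h4, h5⟩ := Finset.mem_Icc.1 h2
            refine (hwk k (not_lt.1 h3)).trans (mul_le_mul_of_nonneg_right ?_ ?_)
            · exact Real.log_le_log (by exact_mod_cast h4) (by exact_mod_cast h5)
            · have := hb0 k
              nlinarith
        _ ≤ ∑ k ∈ Finset.Icc 1 n, Real.log n * (ε / 4 + -D p * b k) :=
            Finset.sum_le_sum_of_subset_of_nonneg (Finset.filter_subset _ _)
              fun k hk _ => h1 k hk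
        _ = _ := by
            rw [← Finset.mul_sum, Finset.sum_add_distrib, ← Finset.mul_sum]
            simp
  have hlim1 : Tendsto (fun n : ℕ => M / (n : ℝ)) atTop (𝓝 0) :=
    tendsto_const_div_atTop_nhds_zero_nat _
  have hlim2 := hbav.const_mul (-D p)
  rw [mul_zero] at hlim2
  obtain ⟨n₀, hn₀⟩ := eventually_atTop.1 ((hlim1.eventually (eventually_le_nhds
    (show 0 < ε / 4 by linarith))).and ((hlim2.eventually (eventually_le_nhds
    (show 0 < ε / 4 by linarith))).and (eventually_ge_atTop 3)))
  refine ⟨n₀, fun n hn => ?_⟩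
  obtain ⟨h1, h2, h3⟩ := hn₀ n hn.le
  have hN := one_le_log_of_three_le h3
  have hn0 : (0 : ℝ) < n := by positivity
  have hM0 : 0 ≤ M := Finset.sum_nonneg fun _ _ => abs_nonneg _
  rw [Real.dist_eq, sub_zero, abs_div, abs_of_pos (by positivity : 0 < (n : ℝ) * Real.log n)]
  have h4 : (M + Real.log n * (n * (ε / 4) + -D p * ∑ k ∈ Finset.Icc 1 n, b k)) /
      (n * Real.log n) = M / n / Real.log n + ε / 4 + -D p * ((∑ k ∈ Finset.Icc 1 n, b k) / n) := by
    field_simp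
    ring
  have h5 : M / n / Real.log n ≤ M / n := div_le_self (by positivity) hN
  calc _ ≤ (M + Real.log n * (n * (ε / 4) + -D p * ∑ k ∈ Finset.Icc 1 n, b k)) /
        (n * Real.log n) := by
        gcongr
        exact hsum n
    _ < ε := by rw [h4]; linarith

theorem sum_Icc_cast (n : ℕ) : ∑ k ∈ Finset.Icc 1 n, (k : ℝ) = n * (n + 1) / 2 := by
  induction n with
  | zero => simp
  | succ n ih =>
    rw [Finset.sum_Icc_succ_top (by omega), ih]
    push_cast
    ring

/-- The terms C k log 2 sum to -(log 2 / log p)(n² + n); the linear part is negligible against n log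
n, and D log k supplies the limit. -/
theorem DyadicRegular.tendsto_sum_dyadic {p : ℝ} {u : ℕ → ℕ} (hp0 : 0 < p) (hp1 : p < 1)
    (hu : DyadicRegular p u) :
    Tendsto (fun n : ℕ => 1 / ((n : ℝ) * Real.log n) *
      (∑ k ∈ Finset.Icc 1 n, (u (2 ^ k) : ℝ) + Real.log 2 / Real.log p * (n : ℝ) ^ 2))
      atTop (𝓝 (D p)) := by
  have h1 := (hu.tendsto_sum_sub hp0 hp1).add ((tendsto_sum_log_div.const_mul (D p)).add
    (tendsto_log_natCast.inv_tendsto_atTop.const_mul (C p * Real.log 2 / 2)))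
  rw [mul_one, mul_zero, add_zero, zero_add] at h1
  refine h1.congr' ?_
  filter_upwards [eventually_ge_atTop 3] with n hn
  have hN := one_le_log_of_three_le hn
  have hn0 : (0 : ℝ) < n := by positivity
  have hl := (Real.log_neg hp0 hp1).ne
  rw [Finset.sum_sub_distrib, Finset.sum_sub_distrib, ← Finset.mul_sum, ← Finset.mul_sum,
    ← Finset.sum_mul, sum_Icc_cast]
  simp only [Pi.inv_apply]
  unfold C
  field_simp
  ring

/-! ### Lower and upper limits -/

section

variable {p : ℝ} {u : ℕ → ℕ}

theorem DyadicRegular.liminf_eq (hp0 : 0 < p) (hp1 : p < 1) (hu : DyadicRegular p u) :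
    liminf (fun n : ℕ => ((((u n : ℝ) - C p * Real.log n) / Real.log (Real.log n) : ℝ) : EReal))
      atTop = (D p : EReal) := by
  apply le_antisymm
  · refine le_of_forall_gt_imp_ge_of_dense fun c hc => ?_
    obtain ⟨z, hz1, hz2⟩ := EReal.lt_iff_exists_real_btwn.1 hc
    rw [EReal.coe_lt_coe_iff] at hz1
    refine le_trans ?_ hz2.le
    refine liminf_le_of_frequently_le ?_
    set ε := (z - D p) / 2 with hε
    have hε0 : 0 < ε := by rw [hε]; linarith
    -- Otherwise the level D + ε would be exceeded from some index on, with averages at least 1/2,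
    -- against density zero.
    have hfreq : ∃ᶠ k : ℕ in atTop, (u (2 ^ (k + 1)) : ℝ) ≤ dyadicLevel p (D p + ε) (k + 1) := by
      intro hcon
      have hbav := tendsto_average_of_summable_div (fun k => by split_ifs <;> norm_num)
        (hu.summable (D p + ε) (by linarith))
      obtain ⟨k₀, hk₀⟩ := eventually_atTop.1 hcon
      have h1 : ∀ k, k₀ + 1 ≤ k → dyadicLevel p (D p + ε) k ≤ (u (2 ^ k) : ℝ) := by
        intro k hk
        have : ¬ (u (2 ^ (k - 1 + 1)) : ℝ) ≤ dyadicLevel p (D p + ε) (k - 1 + 1) :=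
          hk₀ (k - 1) (by omega)
        rw [Nat.sub_add_cancel (by omega)] at this
        exact (not_le.1 this).le
      have h2 : ∀ᶠ n : ℕ in atTop, (1 : ℝ) / 2 ≤ (∑ k ∈ Finset.Icc 1 n,
          if dyadicLevel p (D p + ε) k ≤ (u (2 ^ k) : ℝ) then (1 : ℝ) else 0) / n := by
        filter_upwards [eventually_ge_atTop (2 * k₀ + 2)] with n hn
        have hn0 : (0 : ℝ) < n := by
          have : 0 < n := by omega
          exact_mod_cast this
        rw [le_div_iff₀ hn0]
        have h3 : ∑ k ∈ Finset.Icc (k₀ + 1) n, (1 : ℝ) ≤ ∑ k ∈ Finset.Icc 1 n,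
            if dyadicLevel p (D p + ε) k ≤ (u (2 ^ k) : ℝ) then (1 : ℝ) else 0 := by
          calc ∑ k ∈ Finset.Icc (k₀ + 1) n, (1 : ℝ) = ∑ k ∈ Finset.Icc (k₀ + 1) n,
                if dyadicLevel p (D p + ε) k ≤ (u (2 ^ k) : ℝ) then (1 : ℝ) else 0 :=
                Finset.sum_congr rfl fun k hk => (if_pos (h1 k (Finset.mem_Icc.1 hk).1)).symm
            _ ≤ _ := Finset.sum_le_sum_of_subset_of_nonneg
                (Finset.Icc_subset_Icc_left (by omega)) fun k _ _ => by split_ifs <;> norm_num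
        refine le_trans ?_ h3
        simp only [Finset.sum_const, Nat.card_Icc, nsmul_eq_mul, mul_one]
        rw [Nat.cast_sub (by omega)]
        have : ((2 * k₀ + 2 : ℕ) : ℝ) ≤ n := by exact_mod_cast hn
        push_cast at this ⊢
        linarith
      obtain ⟨n, h3, h4⟩ := (h2.and (hbav.eventually (eventually_lt_nhds
        (show (0 : ℝ) < 1 / 2 by norm_num)))).exists
      linarith
    have htr := eventually_normalized_le hp0 hp1 (D p + ε) hε0
    have hpow : Tendsto (fun k : ℕ => 2 ^ k) atTop atTop :=
      tendsto_pow_atTop_atTop_of_one_lt one_lt_two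
    have := hfreq.and_eventually (hpow.eventually htr)
    refine hpow.frequently (this.mono fun k hk => ?_)
    obtain ⟨h1, h2⟩ := hk
    have h3 := h2 u hu.mono (by rw [Nat.log_pow (by norm_num)]; exact h1)
    rw [EReal.coe_le_coe_iff]
    refine h3.trans ?_
    rw [hε]
    linarith
  · refine le_of_forall_lt_imp_le_of_dense fun c hc => ?_
    obtain ⟨z, hz1, hz2⟩ := EReal.lt_iff_exists_real_btwn.1 hc
    rw [EReal.coe_lt_coe_iff] at hz2
    refine hz1.le.trans (le_liminf_of_le (by isBoundedDefault) ?_)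
    set ε := (D p - z) / 2 with hε
    have hε0 : 0 < ε := by rw [hε]; linarith
    filter_upwards [eventually_le_normalized hp0 hp1 (D p - ε) hε0,
      tendsto_natLog_atTop.eventually (hu.eventually_ge (D p - ε) (by linarith))] with n h1 h2
    rw [EReal.coe_le_coe_iff]
    refine le_trans ?_ (h1 u hu.mono h2)
    rw [hε]
    linarith

theorem DyadicRegular.limsup_eq (hp0 : 0 < p) (hp1 : p < 1) (hu : DyadicRegular p u) :
    limsup (fun n : ℕ => ((((u n : ℝ) - C p * Real.log n) / Real.log (Real.log n) : ℝ) : EReal))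
      atTop = 0 := by
  apply le_antisymm
  · refine le_of_forall_gt_imp_ge_of_dense fun c hc => ?_
    obtain ⟨z, hz1, hz2⟩ := EReal.lt_iff_exists_real_btwn.1 hc
    have hz0 : 0 < z := by exact_mod_cast hz1
    refine le_trans (limsup_le_of_le (by isBoundedDefault) ?_) hz2.le
    filter_upwards [eventually_normalized_le hp0 hp1 (z / 2) (half_pos hz0),
      ((tendsto_add_atTop_nat 1).comp tendsto_natLog_atTop).eventually
        (hu.eventually_lt (z / 2) (half_pos hz0))] with n h1 h2
    rw [EReal.coe_le_coe_iff]
    refine (h1 u hu.mono h2.le).trans ?_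
    linarith
  · refine le_of_forall_lt_imp_le_of_dense fun c hc => ?_
    obtain ⟨z, hz1, hz2⟩ := EReal.lt_iff_exists_real_btwn.1 hc
    have hz0 : z < 0 := by exact_mod_cast hz2
    refine hz1.le.trans (le_limsup_of_frequently_le ?_)
    have hpow : Tendsto (fun k : ℕ => 2 ^ (k + 1)) atTop atTop :=
      (tendsto_pow_atTop_atTop_of_one_lt one_lt_two).comp (tendsto_add_atTop_nat 1)
    have hC := C_pos hp0 hp1
    -- The frequent bound pairs level k with 2^(k+1). Lowering y from z/3 to 2z/3 gains (-z/3) log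
    -- k, which covers the increment C log 2 of the level from k to k + 1.
    have hlarge := (tendsto_log_natCast.const_mul_atTop
      (show 0 < -z / 3 by linarith)).eventually_ge_atTop (C p * Real.log 2 + -z)
    have := ((hu.frequently_ge (z / 3) (by linarith)).and_eventually
      ((hpow.eventually (eventually_le_normalized hp0 hp1 (2 * z / 3)
        (show 0 < -z / 3 by linarith))).and (hlarge.and (eventually_gt_atTop 0))))
    refine hpow.frequently (this.mono fun k hk => ?_)
    obtain ⟨h1, h2, h3, h4⟩ := hk
    have h5 := h2 u hu.mono (by
      rw [Nat.log_pow (by norm_num)]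
      refine le_trans ?_ h1
      have hk0 : (0 : ℝ) < k := by exact_mod_cast h4
      have h6 : Real.log k ≤ Real.log ((k + 1 : ℕ) : ℝ) :=
        Real.log_le_log hk0 (by push_cast; linarith)
      unfold dyadicLevel
      push_cast at h6 ⊢
      nlinarith)
    rw [EReal.coe_le_coe_iff]
    refine le_trans ?_ h5
    linarith

end

/-! ### Logarithmic averages -/

theorem log_sub_log_le_sum_Ico {a b : ℕ} (ha : 1 ≤ a) (hab : a ≤ b) :
    Real.log b - Real.log a ≤ ∑ k ∈ Finset.Ico a b, 1 / (k : ℝ) := by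
  induction b, hab using Nat.le_induction with
  | base => simp
  | succ b hab ih =>
    rw [Finset.sum_Ico_succ_top hab]
    have hb : (0 : ℝ) < b := by exact_mod_cast ha.trans hab
    have h1 := Real.log_le_sub_one_of_pos (show 0 < ((b + 1 : ℕ) : ℝ) / b by positivity)
    rw [Real.log_div (by positivity) hb.ne'] at h1
    have h2 : ((b + 1 : ℕ) : ℝ) / b - 1 = 1 / b := by
      push_cast
      field_simp
      ring
    linarith

theorem sum_Ioc_le_log_sub_log {a b : ℕ} (ha : 1 ≤ a) (hab : a ≤ b) :
    ∑ k ∈ Finset.Ioc a b, 1 / (k : ℝ) ≤ Real.log b - Real.log a := by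
  induction b, hab using Nat.le_induction with
  | base => simp
  | succ b hab ih =>
    rw [← Finset.insert_Ioc_right_eq_Ioc_add_one hab, Finset.sum_insert (by simp)]
    have hb : (0 : ℝ) < b := by exact_mod_cast ha.trans hab
    have h1 := Real.log_le_sub_one_of_pos (show 0 < (b : ℝ) / ((b + 1 : ℕ) : ℝ) by positivity)
    rw [Real.log_div hb.ne' (by positivity)] at h1
    have h2 : (b : ℝ) / ((b + 1 : ℕ) : ℝ) - 1 = -(1 / ((b + 1 : ℕ) : ℝ)) := by
      push_cast
      field_simp
      ring
    linarith

/-- On [2^k, 2^(k+1)) the sequence is at least its value at 2^k, and the reciprocals sum to at least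
log 2. For the upper estimate the blocks are taken half-open on the other side. -/
theorem log_two_mul_sum_le {u : ℕ → ℕ} (hu : Monotone u) (j : ℕ) :
    Real.log 2 * ∑ k ∈ Finset.Icc 1 j, (u (2 ^ k) : ℝ) ≤
      ∑ k ∈ Finset.Ico 1 (2 ^ (j + 1)), (u k : ℝ) / k := by
  induction j with
  | zero =>
    simp only [Finset.Icc_eq_empty_of_lt (show 0 < 1 by norm_num), Finset.sum_empty, mul_zero]
    exact Finset.sum_nonneg fun _ _ => by positivity
  | succ j ih =>
    have hle : 2 ^ (j + 1) ≤ 2 ^ (j + 1 + 1) := Nat.pow_le_pow_right (by norm_num) (by omega)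
    rw [Finset.sum_Icc_succ_top (by omega), mul_add,
      ← Finset.sum_Ico_consecutive _ Nat.one_le_two_pow hle]
    refine add_le_add ih ?_
    have h1 := log_sub_log_le_sum_Ico Nat.one_le_two_pow hle
    have h2 : Real.log ((2 ^ (j + 1 + 1) : ℕ) : ℝ) - Real.log ((2 ^ (j + 1) : ℕ) : ℝ) =
        Real.log 2 := by
      push_cast
      rw [Real.log_pow, Real.log_pow]
      push_cast
      ring
    rw [h2] at h1
    refine (mul_le_mul_of_nonneg_right h1 (Nat.cast_nonneg _)).trans ?_
    rw [Finset.sum_mul]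
    refine Finset.sum_le_sum fun k hk => ?_
    rw [one_div_mul_eq_div]
    gcongr
    exact hu (Finset.mem_Ico.1 hk).1

theorem sum_le_log_two_mul {u : ℕ → ℕ} (hu : Monotone u) (j : ℕ) :
    ∑ k ∈ Finset.Ioc 1 (2 ^ j), (u k : ℝ) / k ≤
      Real.log 2 * ∑ k ∈ Finset.Icc 1 j, (u (2 ^ k) : ℝ) := by
  induction j with
  | zero => simp
  | succ j ih =>
    have hle : 2 ^ j ≤ 2 ^ (j + 1) := Nat.pow_le_pow_right (by norm_num) (by omega)
    rw [Finset.sum_Icc_succ_top (by omega), mul_add,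
      ← Finset.sum_Ioc_consecutive _ Nat.one_le_two_pow hle]
    refine add_le_add ih ?_
    have h1 := sum_Ioc_le_log_sub_log Nat.one_le_two_pow hle
    have h2 : Real.log ((2 ^ (j + 1) : ℕ) : ℝ) - Real.log ((2 ^ j : ℕ) : ℝ) = Real.log 2 := by
      push_cast
      rw [Real.log_pow, Real.log_pow]
      push_cast
      ring
    rw [h2] at h1
    refine le_trans ?_ (mul_le_mul_of_nonneg_right h1 (Nat.cast_nonneg _))
    rw [Finset.sum_mul]
    refine Finset.sum_le_sum fun k hk => ?_
    rw [one_div_mul_eq_div]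
    gcongr
    exact hu (Finset.mem_Ioc.1 hk).2

/-- Passage from averages along powers of two to logarithmic averages. -/
theorem tendsto_log_average_of_dyadic {p : ℝ} (hp0 : 0 < p) (hp1 : p < 1) {S : ℕ → ℝ}
    (hS : Tendsto (fun n : ℕ => 1 / ((n : ℝ) * Real.log n) *
      (S n + Real.log 2 / Real.log p * (n : ℝ) ^ 2)) atTop (𝓝 (D p))) {j : ℕ → ℕ}
    (hj : ∀ᶠ n : ℕ in atTop, |(j n : ℝ) * Real.log 2 - Real.log n| ≤ 2) :
    Tendsto (fun n : ℕ => 1 / (Real.log n * Real.log (Real.log n)) *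
      (Real.log 2 * S (j n) + D p * Real.log n ^ 2)) atTop (𝓝 (D p)) := by
  have hl2 := Real.log_pos one_lt_two
  set x : ℕ → ℝ := fun n => (j n : ℝ) * Real.log 2 / Real.log n with hx
  have hx1 : Tendsto x atTop (𝓝 1) := by
    rw [tendsto_iff_norm_sub_tendsto_zero]
    refine squeeze_zero' (Eventually.of_forall fun _ => norm_nonneg _) ?_
      (tendsto_log_natCast.const_div_atTop 2)
    filter_upwards [hj, eventually_ge_atTop 3] with n h1 h2
    have hN := one_le_log_of_three_le h2
    rw [Real.norm_eq_abs, hx, div_sub_one (by linarith), abs_div,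
      abs_of_pos (by linarith : 0 < Real.log n)]
    gcongr
  have hjtop : Tendsto j atTop atTop := by
    rw [← tendsto_natCast_atTop_iff (R := ℝ)]
    have h1 : Tendsto (fun n : ℕ => (Real.log n + -2) / Real.log 2) atTop atTop :=
      (tendsto_atTop_add_const_right _ (-2) tendsto_log_natCast).atTop_div_const hl2
    refine tendsto_atTop_mono' _ ?_ h1
    filter_upwards [hj] with n h
    rw [div_le_iff₀ hl2]
    linarith [(abs_le.1 h).1]
  have hlogj : Tendsto (fun n => Real.log (j n) / Real.log (Real.log n)) atTop (𝓝 1) := by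
    have h1 : Tendsto (fun n => 1 + (Real.log (x n) - Real.log (Real.log 2)) *
        (Real.log (Real.log n))⁻¹) atTop
        (𝓝 (1 + (Real.log 1 - Real.log (Real.log 2)) * 0)) :=
      tendsto_const_nhds.add ((((Real.continuousAt_log one_ne_zero).tendsto.comp hx1).sub
        tendsto_const_nhds).mul tendsto_log_log_natCast.inv_tendsto_atTop)
    rw [mul_zero, add_zero] at h1
    refine h1.congr' ?_
    filter_upwards [eventually_ge_atTop 3, hjtop.eventually_gt_atTop 0] with n h2 h3
    have hN := one_le_log_of_three_le h2
    have hM := log_log_pos h2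
    have hj0 : (0 : ℝ) < j n := by exact_mod_cast h3
    rw [hx, Real.log_div (by positivity) (by positivity), Real.log_mul hj0.ne' hl2.ne']
    field_simp
    ring
  have hdiff : Tendsto (fun n : ℕ => (Real.log n - j n * Real.log 2) / Real.log (Real.log n))
      atTop (𝓝 0) := by
    rw [tendsto_zero_iff_norm_tendsto_zero]
    refine squeeze_zero' (Eventually.of_forall fun _ => norm_nonneg _) ?_
      (tendsto_log_log_natCast.const_div_atTop 2)
    filter_upwards [hj, eventually_ge_atTop 3] with n h1 h2
    have hM := log_log_pos h2
    rw [Real.norm_eq_abs, abs_div, abs_of_pos hM, abs_sub_comm]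
    gcongr
  -- Complete the expression to (j log 2)²: this gives the dyadic average times ratios tending to 1,
  -- plus D (log n - j log 2)(log n + j log 2) / (log n log log n), which vanishes.
  have hmain := (((hS.comp hjtop).mul hx1).mul hlogj).add
    ((hdiff.mul (hx1.const_add 1)).const_mul (D p))
  rw [mul_one, mul_one, zero_mul, mul_zero, add_zero] at hmain
  refine hmain.congr' ?_
  filter_upwards [eventually_ge_atTop 3, hjtop.eventually_ge_atTop 2] with n h2 h3
  have hN := one_le_log_of_three_le h2
  have hM := log_log_pos h2
  have hj0 : (2 : ℝ) ≤ j n := by exact_mod_cast h3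
  have hlj : 0 < Real.log (j n) := Real.log_pos (by linarith)
  have hl := (Real.log_neg hp0 hp1).ne
  have hN0 : Real.log n ≠ 0 := by linarith
  have hj0' : (j n : ℝ) ≠ 0 := by linarith
  simp only [Function.comp, hx]
  unfold D
  field_simp
  ring

/-- The logarithmic sum lies between log 2 times the dyadic sums up to one below and one above the
binary logarithm of n, apart from the term u 1. -/
theorem DyadicRegular.tendsto_sum_div {p : ℝ} {u : ℕ → ℕ} (hp0 : 0 < p) (hp1 : p < 1)
    (hu : DyadicRegular p u) :
    Tendsto (fun n : ℕ => 1 / (Real.log n * Real.log (Real.log n)) *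
      (∑ k ∈ Finset.Icc 1 n, (u k : ℝ) / k + D p * Real.log n ^ 2)) atTop (𝓝 (D p)) := by
  have hS := hu.tendsto_sum_dyadic hp0 hp1
  have hl2 := Real.log_pos one_lt_two
  have hl2' := Real.log_two_lt_d9
  have h1 := tendsto_log_average_of_dyadic hp0 hp1 hS (j := fun n => Nat.log 2 n - 1) (by
    filter_upwards [eventually_ge_atTop 2] with n hn
    obtain ⟨h1, h2⟩ := log_two_pow_bounds (n := n) (by omega)
    have hk : 1 ≤ Nat.log 2 n := Nat.log_pos (by norm_num) hn
    rw [Nat.cast_sub hk, abs_le]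
    push_cast
    constructor <;> linarith)
  have h2 := tendsto_log_average_of_dyadic hp0 hp1 hS (j := fun n => Nat.log 2 n + 1) (by
    filter_upwards [eventually_ge_atTop 2] with n hn
    obtain ⟨h1, h2⟩ := log_two_pow_bounds (n := n) (by omega)
    rw [abs_le]
    push_cast
    constructor <;> linarith)
  have h3 := h2.add ((tendsto_log_natCast.atTop_mul_atTop₀
    tendsto_log_log_natCast).const_div_atTop (u 1 : ℝ))
  rw [add_zero] at h3
  refine tendsto_of_tendsto_of_tendsto_of_le_of_le' h1 h3 ?_ ?_
  · filter_upwards [eventually_ge_atTop 3] with n hn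
    have hN := one_le_log_of_three_le hn
    have hM := log_log_pos hn
    have hk : 1 ≤ Nat.log 2 n := Nat.log_pos (by norm_num) (by omega)
    have h4 := log_two_mul_sum_le hu.mono (Nat.log 2 n - 1)
    rw [Nat.sub_add_cancel hk] at h4
    have h5 : ∑ k ∈ Finset.Ico 1 (2 ^ Nat.log 2 n), (u k : ℝ) / k ≤
        ∑ k ∈ Finset.Icc 1 n, (u k : ℝ) / k := by
      refine Finset.sum_le_sum_of_subset_of_nonneg (fun k hk => ?_) fun _ _ _ => by positivity
      have h6 := Nat.pow_log_le_self 2 (show n ≠ 0 by omega)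
      obtain ⟨h7, h8⟩ := Finset.mem_Ico.1 hk
      exact Finset.mem_Icc.2 ⟨h7, by omega⟩
    gcongr
    exact h4.trans h5
  · filter_upwards [eventually_ge_atTop 3] with n hn
    have hN := one_le_log_of_three_le hn
    have hM := log_log_pos hn
    have h4 := sum_le_log_two_mul hu.mono (Nat.log 2 n + 1)
    have h5 : ∑ k ∈ Finset.Icc 1 n, (u k : ℝ) / k ≤
        u 1 + ∑ k ∈ Finset.Ioc 1 (2 ^ (Nat.log 2 n + 1)), (u k : ℝ) / k := by
      have h6 := Nat.lt_pow_succ_log_self (b := 2) (by norm_num) n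
      have h7 : (u 1 : ℝ) + ∑ k ∈ Finset.Ioc 1 (2 ^ (Nat.log 2 n + 1)), (u k : ℝ) / k =
          ∑ k ∈ insert 1 (Finset.Ioc 1 (2 ^ (Nat.log 2 n + 1))), (u k : ℝ) / k := by
        rw [Finset.sum_insert (by simp)]
        simp
      rw [h7]
      refine Finset.sum_le_sum_of_subset_of_nonneg (fun k hk => ?_) fun _ _ _ => by positivity
      obtain ⟨h8, h9⟩ := Finset.mem_Icc.1 hk
      rw [Finset.mem_insert, Finset.mem_Ioc]
      omega
    have h6 : 1 / (Real.log n * Real.log (Real.log n)) * (Real.log 2 *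
        ∑ k ∈ Finset.Icc 1 (Nat.log 2 n + 1), (u (2 ^ k) : ℝ) + D p * Real.log n ^ 2) +
        u 1 / (Real.log n * Real.log (Real.log n)) =
        1 / (Real.log n * Real.log (Real.log n)) * (u 1 + Real.log 2 *
        ∑ k ∈ Finset.Icc 1 (Nat.log 2 n + 1), (u (2 ^ k) : ℝ) + D p * Real.log n ^ 2) := by
      ring
    rw [h6]
    gcongr
    linarith

/-! ### Convergence in probability and conclusion -/

/-- For large n, a deviation of the normalized length by ε forces a low value at the preceding power
of two or a high one at the following; both have probabilities tending to 0. -/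
theorem IsBernoulliSequence.tendstoInMeasure_normU {Ω : Type u} [MeasurableSpace Ω]
    {μ : Measure Ω} [IsProbabilityMeasure μ] {p : ℝ} {ξ : ℕ → Ω → ℝ}
    (hξ : IsBernoulliSequence μ p ξ) (hp0 : 0 < p) (hp1 : p < 1) :
    TendstoInMeasure μ (fun n ω => normU p ξ n ω) atTop fun _ => D p := by
  rw [tendstoInMeasure_iff_measureReal_dist]
  intro ε hε
  have hl := Real.log_neg hp0 hp1
  obtain ⟨f, hf, hfev⟩ := hξ.exists_summable_bound hp0 hp1
    (show D p - ε / 4 < D p by linarith)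
  obtain ⟨K, c, hK, hc, hev⟩ := hξ.eventually_measureReal_le hp0 hp1 (D p + ε / 4)
  have hθ : 0 < -((D p + ε / 4) * Real.log p - 1) := by
    have : D p * Real.log p = 1 := by
      unfold D
      exact one_div_mul_cancel hl.ne
    nlinarith
  have hlim : Tendsto (fun k : ℕ => c * (k : ℝ) ^ ((D p + ε / 4) * Real.log p - 1) +
      K * dyadicError k) atTop (𝓝 (c * 0 + K * 0)) := by
    refine Tendsto.add (Tendsto.const_mul c ?_)
      (summable_dyadicError.tendsto_atTop_zero.const_mul K)
    have := (tendsto_rpow_neg_atTop hθ).comp (tendsto_natCast_atTop_atTop (R := ℝ))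
    simp only [neg_neg] at this
    exact this
  have hlim' := (hf.tendsto_atTop_zero.comp tendsto_natLog_atTop).add
    (hlim.comp ((tendsto_add_atTop_nat 1).comp tendsto_natLog_atTop))
  rw [mul_zero, mul_zero, add_zero, add_zero] at hlim'
  refine squeeze_zero' (Eventually.of_forall fun _ => measureReal_nonneg) ?_ hlim'
  filter_upwards [tendsto_natLog_atTop.eventually hfev,
    ((tendsto_add_atTop_nat 1).comp tendsto_natLog_atTop).eventually hev,
    eventually_le_normalized hp0 hp1 (D p - ε / 4) (show 0 < ε / 4 by linarith),
    eventually_normalized_le hp0 hp1 (D p + ε / 4) (show 0 < ε / 4 by linarith)] with n h1 h2 h3 h4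
  refine le_trans (measureReal_mono ?_ (measure_ne_top _ _))
    ((measureReal_union_le _ _).trans (add_le_add h1 h2))
  intro ω hω
  by_contra hcon
  simp only [Set.mem_union, Set.mem_ofPred_eq, not_or, not_lt, not_le, Function.comp] at hcon hω
  have hmono : Monotone fun n => U ξ n ω := fun m n hmn => longestAP_mono _ hmn
  have h5 := h3 _ hmono hcon.1
  have h6 := h4 _ hmono hcon.2.le
  rw [Real.dist_eq] at hω
  have h7 : |normU p ξ n ω - D p| ≤ ε / 2 := by
    unfold normU
    rw [abs_le]
    constructor <;> linarith
  linarith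

end LongestAP

theorem theorem1p1 (p : ℝ) (hp0 : 0 < p) (hp1 : p < 1) :
    -- (1) uniform error bound, with a constant depending only on `p`
    (∃ K : ℝ, ∀ (Ω : Type u) [MeasurableSpace Ω] (μ : Measure Ω) [IsProbabilityMeasure μ]
      (ξ : ℕ → Ω → ℝ), LongestAP.IsBernoulliSequence μ p ξ →
      ∀ n : ℕ, 3 ≤ n → ∀ r : ℕ, 1 < r → r ≤ n →
        |μ.real {ω | LongestAP.U ξ n ω < r} - Real.exp (-LongestAP.lam p n r)|
          ≤ K * (Real.log n ^ 4 * Real.log (Real.log n) / n)) ∧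
    -- (2) Gumbel-type form, with a constant depending only on `p` and `a`
    (∀ a : ℝ, a < 1 → ∃ K : ℝ,
      ∀ (Ω : Type u) [MeasurableSpace Ω] (μ : Measure Ω) [IsProbabilityMeasure μ]
      (ξ : ℕ → Ω → ℝ), LongestAP.IsBernoulliSequence μ p ξ →
      ∀ n : ℕ, 3 ≤ n → ∀ x : ℝ, a * LongestAP.D p * Real.log (Real.log n) ≤ x →
        (∃ m : ℤ, LongestAP.h p n + x = m) →
        |Real.exp (-(1 - p) * Real.log p / 4 * p ^ x) *
            μ.real {ω | (LongestAP.U ξ n ω : ℝ) < LongestAP.h p n + x} - 1|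
          ≤ K * (Real.log (Real.log n) / Real.log n ^ (1 - a))) ∧
    (∀ (Ω : Type u) [MeasurableSpace Ω] (μ : Measure Ω) [IsProbabilityMeasure μ]
      (ξ : ℕ → Ω → ℝ), LongestAP.IsBernoulliSequence μ p ξ →
      -- (3) convergence in probability
      TendstoInMeasure μ (fun n ω => LongestAP.normU p ξ n ω) atTop (fun _ => LongestAP.D p) ∧
      -- (4) almost sure limits; liminf and limsup are taken in the extended reals
      (∀ᵐ ω ∂μ,
        (liminf (fun n : ℕ => (LongestAP.normU p ξ n ω : EReal)) atTop = (LongestAP.D p : EReal) ∧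
          liminf (fun n : ℕ => (LongestAP.normU p ξ n ω : EReal)) atTop <
            limsup (fun n : ℕ => (LongestAP.normU p ξ n ω : EReal)) atTop ∧
          limsup (fun n : ℕ => (LongestAP.normU p ξ n ω : EReal)) atTop = 0) ∧
        Tendsto (fun n : ℕ => 1 / ((n : ℝ) * Real.log n) *
            (∑ k ∈ Finset.Icc 1 n, (LongestAP.U ξ (2 ^ k) ω : ℝ) +
              Real.log 2 / Real.log p * (n : ℝ) ^ 2))
          atTop (𝓝 (LongestAP.D p)) ∧
        Tendsto (fun n : ℕ => 1 / (Real.log n * Real.log (Real.log n)) *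
            (∑ k ∈ Finset.Icc 1 n, (LongestAP.U ξ k ω : ℝ) / (k : ℝ) +
              LongestAP.D p * Real.log n ^ 2))
          atTop (𝓝 (LongestAP.D p)))) := by
  refine ⟨LongestAP.exists_uniform_bound.{u} p hp0 hp1, LongestAP.exists_gumbel_bound.{u} p hp0 hp1,
    fun Ω _ μ _ ξ hξ => ⟨hξ.tendstoInMeasure_normU hp0 hp1, ?_⟩⟩
  filter_upwards [hξ.ae_dyadicRegular hp0 hp1] with ω hω
  have h1 := hω.liminf_eq hp0 hp1
  have h2 := hω.limsup_eq hp0 hp1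
  refine ⟨⟨h1, ?_, h2⟩, hω.tendsto_sum_dyadic hp0 hp1, hω.tendsto_sum_div hp0 hp1⟩
  exact (h1.trans_lt (EReal.coe_neg'.2 (LongestAP.D_neg hp0 hp1))).trans_eq h2.symm
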